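/- **Theorem (density for $|\alpha|=\pi/2$).** Let $\alpha\in\{\pi/2,-\pi/2\}$, let $p,s>0$ be real, and let $a_1,a_2,\dots$ be independent random variables, each with the gamma density $\gamma_{p,s}(a)=\frac{1}{s^p\Gamma(p)}a^{p-1}e^{-a/s}$, $a\ge 0$. Upper signs below refer to $\alpha=\pi/2$, lower signs to $\alpha=-\pi/2$. For $y\in\mathbb R\setminus\{0\}$ put $$ f_{\pm}(y)=\frac{1}{\pi^2\left[J_p^2(2/s)+Y_p^2(2/s)\right]}\,\frac{1}{|y|^{p+1}}\exp\left[\pm\frac1s\left(\frac1y-y\right)\right]\int_{I_\pm(y)}\exp\left[\mp\frac1s\left(\frac1t-t\right)\right]|t|^{p-1}\,dt , $$ where $J_p,Y_p$ are the Bessel functions of the first and second kind and $I_\pm(y)$ is the interval with endpoints $c_\pm(y)$ and $y$: $$ c_+(y)=\begin{cases}-\infty & y<0\\ 0 & y>0\end{cases},\qquad c_-(y)=\begin{cases}0 & y<0\\ +\infty & y>0\end{cases} $$ (so that $f_-(y)=f_+(-y)$). The integral over $I_\pm(y)$ converges for every $y\ne0$, and the following hold. 1. The random continued fraction $$ Z=\cfrac{1}{a_1e^{i\alpha}+\cfrac{1}{a_2e^{i\alpha}+\cfrac{1}{a_3e^{i\alpha}+\cdots}}}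 $$ converges almost surely in $\mathbb C$, and the law of $Z$ has density $\delta(x)f_\pm(y)$, $z=x+iy$; that is, $Z$ is almost surely purely imaginary and $\operatorname{Im}Z$ has probability density $f_\pm$ on $\mathbb R$. 2. Equivalently, there is exactly one Borel probability measure $\nu$ on the complex projective line $\mathbb C\cup\{\infty\}$ that is invariant under the projective action $z\mapsto 1/(z+ae^{i\alpha})$ of the random matrix $\begin{pmatrix}0&1\\1&ae^{i\alpha}\end{pmatrix}$, $a\sim\gamma_{p,s}$, in the sense that $\nu(B)=\int_0^\infty \nu\{z: 1/(z+ae^{i\alpha})\in B\}\,\gamma_{p,s}(a)\,da$ for all Borel sets $B$; and $\nu(dz)=\delta(x)f_\pm(y)\,dx\,dy$. In particular, $\nu$ is supported on the imaginary axis, i.e. $\nu$ vanishes on the complement of $i\mathbb R$, and its density there decays like $1/y^2$ at $\pm\infty$: there is a constant $C>0$ (depending on $p,s$) such that $y^2f_\pm(y)\to C$ as $y\to+\infty$ and as $y\to-\infty$. -/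

import Mathlib

open MeasureTheory ProbabilityTheory Filter Topology

noncomputable section

/-! ### Bessel functions of real order -/

/-- The Bessel function of the first kind `J_ν(x)`, `x > 0`, by its power series. Since Mathlib's
`Real.Gamma` vanishes at its poles, `1 / Γ` is read correctly (as `0`) there. -/
def besselJ (ν x : ℝ) : ℝ :=
  ∑' k : ℕ, (-1) ^ k / ((k.factorial : ℝ) * Real.Gamma (ν + k + 1)) *
    (x / 2) ^ (2 * (k : ℝ) + ν)

/-- `(J_ν(x) cos νπ - J_{-ν}(x)) / sin νπ`, meaningful for orders `ν` that are not integers. -/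
def besselYAux (x ν : ℝ) : ℝ :=
  (besselJ ν x * Real.cos (ν * Real.pi) - besselJ (-ν) x) / Real.sin (ν * Real.pi)

open Classical in
/-- The Bessel function of the second kind `Y_ν(x)`, `x > 0`; for an integer order it is the limit
of the functions of neighbouring orders. -/
def besselY (ν x : ℝ) : ℝ :=
  if ∃ n : ℤ, (n : ℝ) = ν then limUnder (𝓝[≠] ν) (besselYAux x) else besselYAux x ν

/-! ### The random matrices, their action, and the continued fraction -/

/-- The matrix `(0 1; 1 a e^{iα})`. -/
def cfMatrix (α a : ℝ) : GL (Fin 2) ℂ :=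
  Matrix.GeneralLinearGroup.mkOfDetNeZero
    !![0, 1; 1, (a : ℂ) * Complex.exp (Complex.I * α)] (by simp [Matrix.det_fin_two])

/-- The complex projective line `ℂ ∪ {∞}` carries its Borel σ-algebra. -/
instance instMeasurableSpaceOnePointComplex : MeasurableSpace (OnePoint ℂ) := borel _

instance instBorelSpaceOnePointComplex : BorelSpace (OnePoint ℂ) := ⟨rfl⟩

/-- A measure `ν` on the projective line is invariant for the random matrix `cfMatrix α a`, with
`a` distributed according to `μ`, if `∫ ν (A⁻¹ B) μ(dA) = ν B` for all Borel sets `B`. The action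
is the action of `GL(2, ℂ)` on `ℂ ∪ {∞}` by linear fractional transformations. -/
def IsInvariantMeasure (α : ℝ) (μ : Measure ℝ) (ν : Measure (OnePoint ℂ)) : Prop :=
  ∀ B : Set (OnePoint ℂ), MeasurableSet B →
    ∫⁻ a, ν ((fun z : OnePoint ℂ => cfMatrix α a • z) ⁻¹' B) ∂μ = ν B

/-- The continued fraction `1 / (a₀ e^{iα} + 1 / (a₁ e^{iα} + 1 / (a₂ e^{iα} + ⋯)))`. -/
def rayContFract (α : ℝ) (a : ℕ → ℝ) : GenContFract ℂ where
  h := 0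
  s := Stream'.Seq.ofStream
    (fun n => (⟨1, (a n : ℂ) * Complex.exp (Complex.I * α)⟩ : GenContFract.Pair ℂ))

/-! ### The density on the imaginary axis -/

/-- The interval between `y` and the lower limit of integration, for the sign `σ = ±1`: that limit
is `0` if `σ y > 0`, and it is the infinite endpoint on the side of `y` if `σ y < 0`. -/
def integrationRange (σ y : ℝ) : Set ℝ :=
  if 0 < σ then (if 0 < y then Set.Ioc 0 y else Set.Iic y)
  else (if 0 < y then Set.Ici y else Set.Ico y 0)

/-- The integrand `exp[∓(1/t - t)/s] |t|^{p-1}`. -/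
def innerIntegrand (p s σ t : ℝ) : ℝ :=
  Real.exp (-σ * (1 / s * (1 / t - t))) * |t| ^ (p - 1)

/-- The normalisation constant `1 / (π² (J_p(2/s)² + Y_p(2/s)²))`. -/
def normConst (p s : ℝ) : ℝ :=
  1 / (Real.pi ^ 2 * (besselJ p (2 / s) ^ 2 + besselY p (2 / s) ^ 2))

/-- The density along the imaginary axis, as a function of `y = Im z`. -/
def axisDensity (p s σ y : ℝ) : ℝ :=
  normConst p s * (1 / |y| ^ (p + 1)) * Real.exp (σ * (1 / s * (1 / y - y))) *
    ∫ t in integrationRange σ y, innerIntegrand p s σ t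

/-- The measure `δ(x) f(y) dx dy` on `ℂ`, where `f` is the density above. -/
def axisMeasure (p s σ : ℝ) : Measure ℂ :=
  (volume.withDensity fun y : ℝ => ENNReal.ofReal (axisDensity p s σ y)).map
    fun y : ℝ => (y : ℂ) * Complex.I

/-- The same measure, on the projective line `ℂ ∪ {∞}`. -/
def axisMeasureProj (p s σ : ℝ) : Measure (OnePoint ℂ) :=
  (axisMeasure p s σ).map ((↑) : ℂ → OnePoint ℂ)

end

/-!
After multiplication by a scalar, the matrices `!![0, 1; 1, a e^{iα}]` with `e^{iα} = iσ`, `σ = ±1`,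
have determinant `1`, and they preserve the imaginary axis: `z = iσy` is mapped to
`-iσ / (y + a)`. Everything on the axis therefore concerns the random maps `y ↦ -1 / (y + a)` of the
real line, and the density for `σ = -1` is the mirror image of that for `σ = 1`.

*Invariance.* The density at `w` is, up to its constant, the integral of a kernel over the points `t`
of an arc that ends at `w` (`rawDensity`). Invariance says that convolution with the gamma law acts
on it as the inversion does. After an interchange of integrals, the substitution
`1 / w = 1 / t + 1 / u - 1 / v` moves the gamma factor to the variable `t`, over which it integrates
to one (`lintegral_gammaPDF_mul_rawDensity`).

*Normalisation.* The total mass of the unnormalised density is a double integral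
(`lintegral_rawDensity`) that has to be identified with `π² (J_p² + Y_p²)(2 / s)`, which is Nicholson's
formula (`nicholson_eq`). It is the value at `b = iπ` of a family of integrals that depend on
`cosh b`. For real `b` these factor into two integrals that represent the modified Bessel function
`K_p` (`macdonald_mul_macdonald`), which for a noninteger order is a combination of two power series
(`macdonald_eq_series`). Both sides continue analytically to `b = iφ` with `|φ| < π`
(`nicholson_cos`), and `φ → π` by monotone convergence. Integer orders follow by continuity in the
order.

*Convergence and uniqueness.* L'Hôpital's rule shows that the density is comparable to
`1 / (1 + y²)` (`exists_axisDensity_bounds`), which also gives its decay. Hence it defines a function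
`F` on the plane, homogeneous of degree `-2` and comparable to `‖x‖⁻²`, whose average over the random
matrices is at most itself. Its square root `√F` is comparable to `‖x‖⁻¹`, and by the
strict Cauchy–Schwarz inequality averaging contracts it by a fixed factor, at the latest after two
steps. So the sum over `n` of the averages of `1 / ‖T_n x‖` is finite for the products `T_n` of the
random matrices (`tsum_iterate_avgOp_inv_norm_lt_top`), and almost surely `∑ 1 / ‖T_n x‖` converges
for each `x ≠ 0`. Since `T_n` preserves determinants of pairs of vectors, the points of the
projective line given by `T_n x` form a Cauchy sequence whose limit does not depend on `x`
(`exists_limit_rayProd`). Every invariant probability measure is the law of this limit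
(`map_sphereChart_homCoord_eq`), which proves uniqueness. The measure on the axis being invariant,
the limit has that law; in particular it is almost surely finite, and it is the value of the
continued fraction, whose convergents are the points given by the products (`convs_rayContFract`).
-/

open scoped ENNReal

/-! ### The entire functions behind the Bessel functions -/

/-- The entire function `Φ_μ(z) = ∑ z ^ k / (k! Γ(μ + k + 1))`; the Bessel function of order `μ` is
`J_μ(x) = (x / 2) ^ μ Φ_μ(-x² / 4)`. It is entire in both variables. -/
noncomputable def besselPhi (μ z : ℂ) : ℂ :=
  ∑' k : ℕ, (Complex.Gamma (μ + k + 1))⁻¹ * (z ^ k / (k.factorial : ℂ))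

/-- The values of `besselPhi` at real arguments. -/
noncomputable def besselPhiReal (μ y : ℝ) : ℝ :=
  ∑' k : ℕ, (Real.Gamma (μ + k + 1))⁻¹ * (y ^ k / (k.factorial : ℝ))

lemma ofReal_besselPhiReal (μ y : ℝ) : ((besselPhiReal μ y : ℝ) : ℂ) = besselPhi μ y := by
  unfold besselPhiReal besselPhi
  rw [Complex.ofReal_tsum]
  refine tsum_congr fun k => ?_
  have : ((μ : ℂ) + k + 1) = ((μ + k + 1 : ℝ) : ℂ) := by push_cast; rfl
  rw [this, Complex.Gamma_ofReal]
  push_cast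
  rfl

lemma norm_inv_Gamma_add_one_le {s : ℂ} (hs : 1 ≤ ‖s‖) :
    ‖(Complex.Gamma (s + 1))⁻¹‖ ≤ ‖(Complex.Gamma s)⁻¹‖ := by
  rw [Complex.one_div_Gamma_eq_self_mul_one_div_Gamma_add_one s, norm_mul]
  exact le_mul_of_one_le_left (norm_nonneg _) hs

/-- On a bounded set of orders, `1 / Γ(μ + k + 1)` is bounded uniformly in `k`: once `k` exceeds the
size of `μ`, the functional equation makes the modulus decrease in `k`. -/
lemma exists_bound_inv_Gamma (R : ℝ) :
    ∃ C : ℝ, 0 ≤ C ∧ ∀ (k : ℕ) (μ : ℂ), ‖μ‖ ≤ R → ‖(Complex.Gamma (μ + k + 1))⁻¹‖ ≤ C := by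
  have hb : ∀ k : ℕ, ∃ C : ℝ, 0 ≤ C ∧
      ∀ μ : ℂ, ‖μ‖ ≤ R → ‖(Complex.Gamma (μ + k + 1))⁻¹‖ ≤ C := by
    intro k
    have hc : ContinuousOn (fun μ : ℂ => (Complex.Gamma (μ + k + 1))⁻¹)
        (Metric.closedBall 0 R) := by
      have h := Complex.differentiable_one_div_Gamma.continuous
      exact (h.comp (by fun_prop : Continuous fun μ : ℂ => μ + k + 1)).continuousOn
    obtain ⟨C, hC⟩ := (isCompact_closedBall (0 : ℂ) R).exists_bound_of_continuousOn hc
    exact ⟨max C 0, le_max_right _ _, fun μ hμ => (hC μ (by simpa using hμ)).trans (le_max_left _ _)⟩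
  choose C hC0 hC using hb
  obtain ⟨N, hN⟩ := exists_nat_ge R
  refine ⟨∑ k ∈ Finset.range (N + 1), C k, Finset.sum_nonneg fun k _ => hC0 k, ?_⟩
  have hsmall : ∀ k ≤ N, ∀ μ : ℂ, ‖μ‖ ≤ R →
      ‖(Complex.Gamma (μ + k + 1))⁻¹‖ ≤ ∑ k ∈ Finset.range (N + 1), C k := by
    intro k hk μ hμ
    exact (hC k μ hμ).trans (Finset.single_le_sum (f := C) (fun i _ => hC0 i) (by simp; omega))
  intro k μ hμ
  rcases le_total k N with hk | hk
  · exact hsmall k hk μ hμ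
  · induction k, hk using Nat.le_induction with
    | base => exact hsmall N le_rfl μ hμ
    | succ k hk ih =>
      have h1 : 1 ≤ ‖μ + k + 1‖ := by
        have h2 : ‖((k : ℂ) + 1)‖ ≤ ‖μ + k + 1‖ + ‖μ‖ := by
          calc ‖((k : ℂ) + 1)‖ = ‖(μ + k + 1) - μ‖ := by ring_nf
            _ ≤ _ := norm_sub_le _ _
        have h3 : ‖((k : ℂ) + 1)‖ = k + 1 := by
          have : ((k : ℂ) + 1) = ((k + 1 : ℕ) : ℂ) := by push_cast; rfl
          rw [this, Complex.norm_natCast]; push_cast; rfl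
        have h4 : (N : ℝ) ≤ k := by exact_mod_cast hk
        linarith
      have h5 : μ + ((k + 1 : ℕ) : ℂ) + 1 = (μ + k + 1) + 1 := by push_cast; ring
      rw [h5]
      exact (norm_inv_Gamma_add_one_le h1).trans ih

lemma exists_bound_besselPhi_term (R B : ℝ) :
    ∃ u : ℕ → ℝ, Summable u ∧ ∀ (k : ℕ) (μ z : ℂ), ‖μ‖ ≤ R → ‖z‖ ≤ B →
      ‖(Complex.Gamma (μ + k + 1))⁻¹ * (z ^ k / (k.factorial : ℂ))‖ ≤ u k := by
  obtain ⟨C, hC0, hC⟩ := exists_bound_inv_Gamma R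
  refine ⟨fun k => C * (B ^ k / k.factorial), (Real.summable_pow_div_factorial B).mul_left C, ?_⟩
  intro k μ z hμ hz
  rw [norm_mul, norm_div, norm_pow, Complex.norm_natCast]
  refine mul_le_mul (hC k μ hμ) ?_ (by positivity) hC0
  gcongr

lemma summable_besselPhi (μ z : ℂ) :
    Summable fun k : ℕ => (Complex.Gamma (μ + k + 1))⁻¹ * (z ^ k / (k.factorial : ℂ)) := by
  obtain ⟨u, hu, h⟩ := exists_bound_besselPhi_term ‖μ‖ ‖z‖
  exact Summable.of_norm_bounded hu fun k => h k μ z le_rfl le_rfl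

lemma differentiable_besselPhi_order (z : ℂ) : Differentiable ℂ fun μ => besselPhi μ z := by
  intro μ
  obtain ⟨u, hu, h⟩ := exists_bound_besselPhi_term (‖μ‖ + 1) ‖z‖
  have hd : DifferentiableOn ℂ (fun μ => besselPhi μ z) (Metric.ball 0 (‖μ‖ + 1)) := by
    refine Complex.differentiableOn_tsum_of_summable_norm hu (fun k => ?_) Metric.isOpen_ball
      fun k w hw => h k w z (by simpa using (Metric.mem_ball.1 hw).le) le_rfl
    have h1 : Differentiable ℂ fun w : ℂ => (Complex.Gamma (w + k + 1))⁻¹ :=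
      Complex.differentiable_one_div_Gamma.comp (by fun_prop : Differentiable ℂ fun w : ℂ => w + k + 1)
    exact (h1.mul_const _).differentiableOn
  exact hd.differentiableAt (Metric.isOpen_ball.mem_nhds (by simp))

lemma hasDerivAt_besselPhi (μ z : ℂ) :
    HasDerivAt (besselPhi μ) (besselPhi (μ + 1) z) z := by
  obtain ⟨u, hu, h⟩ := exists_bound_besselPhi_term ‖μ‖ (‖z‖ + 1)
  have hz : z ∈ Metric.ball (0 : ℂ) (‖z‖ + 1) := by simp
  have hF : ∀ k : ℕ, Differentiable ℂ
      fun w : ℂ => (Complex.Gamma (μ + k + 1))⁻¹ * (w ^ k / (k.factorial : ℂ)) := by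
    intro k; fun_prop
  have hle : ∀ (k : ℕ) (w : ℂ), w ∈ Metric.ball (0 : ℂ) (‖z‖ + 1) →
      ‖(Complex.Gamma (μ + k + 1))⁻¹ * (w ^ k / (k.factorial : ℂ))‖ ≤ u k :=
    fun k w hw => h k μ w le_rfl (by simpa using (Metric.mem_ball.1 hw).le)
  have hd : DifferentiableAt ℂ (besselPhi μ) z :=
    (Complex.differentiableOn_tsum_of_summable_norm hu (fun k => (hF k).differentiableOn)
      Metric.isOpen_ball hle).differentiableAt (Metric.isOpen_ball.mem_nhds hz)
  have hs := Complex.hasSum_deriv_of_summable_norm hu (fun k => (hF k).differentiableOn)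
      Metric.isOpen_ball hle hz
  have heq : deriv (besselPhi μ) z = besselPhi (μ + 1) z := by
    have h1 : deriv (besselPhi μ) z = ∑' k : ℕ, deriv (fun w : ℂ =>
        (Complex.Gamma (μ + k + 1))⁻¹ * (w ^ k / (k.factorial : ℂ))) z := hs.tsum_eq.symm
    rw [h1, hs.summable.tsum_eq_zero_add]
    unfold besselPhi
    simp only [pow_zero, deriv_const, zero_add]
    refine tsum_congr fun k => ?_
    have h2 : (μ + ((k + 1 : ℕ) : ℂ) + 1) = μ + 1 + k + 1 := by push_cast; ring
    rw [h2]
    rw [deriv_const_mul _ (by fun_prop), deriv_div_const, deriv_pow_field, Nat.factorial_succ]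
    have h3 : ((k : ℂ) + 1) ≠ 0 := by exact_mod_cast Nat.succ_ne_zero k
    have h4 : ((k.factorial : ℕ) : ℂ) ≠ 0 := by exact_mod_cast Nat.factorial_ne_zero k
    push_cast
    field_simp
  rw [← heq]
  exact hd.hasDerivAt

/-- The three-term recurrence in the order, from `1 / Γ(s) = s / Γ(s + 1)`. -/
lemma besselPhi_recurrence (μ z : ℂ) :
    besselPhi (μ - 1) z = μ * besselPhi μ z + z * besselPhi (μ + 1) z := by
  have hs0 := summable_besselPhi μ z
  have hs1 := summable_besselPhi (μ + 1) z
  have hs2 := summable_besselPhi (μ - 1) z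
  have e : besselPhi (μ - 1) z - μ * besselPhi μ z =
      ∑' k : ℕ, (k : ℂ) * ((Complex.Gamma (μ + k + 1))⁻¹ * (z ^ k / (k.factorial : ℂ))) := by
    unfold besselPhi
    rw [← tsum_mul_left, ← (hs2.tsum_sub (hs0.mul_left μ))]
    refine tsum_congr fun k => ?_
    have h1 : μ - 1 + k + 1 = μ + k := by ring
    rw [h1, Complex.one_div_Gamma_eq_self_mul_one_div_Gamma_add_one (μ + k)]
    ring
  have hsum : Summable fun k : ℕ =>
      (k : ℂ) * ((Complex.Gamma (μ + k + 1))⁻¹ * (z ^ k / (k.factorial : ℂ))) := by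
    refine (hs2.sub (hs0.mul_left μ)).congr fun k => ?_
    have h1 : μ - 1 + k + 1 = μ + k := by ring
    rw [h1, Complex.one_div_Gamma_eq_self_mul_one_div_Gamma_add_one (μ + k)]
    ring
  have e2 : z * besselPhi (μ + 1) z =
      ∑' k : ℕ, (k : ℂ) * ((Complex.Gamma (μ + k + 1))⁻¹ * (z ^ k / (k.factorial : ℂ))) := by
    rw [hsum.tsum_eq_zero_add]
    unfold besselPhi
    rw [← tsum_mul_left]
    simp only [Nat.cast_zero, zero_mul, zero_add]
    refine tsum_congr fun k => ?_
    have h2 : (μ + ((k + 1 : ℕ) : ℂ) + 1) = μ + 1 + k + 1 := by push_cast; ring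
    rw [h2, Nat.factorial_succ]
    have h3 : ((k : ℂ) + 1) ≠ 0 := by exact_mod_cast Nat.succ_ne_zero k
    have h4 : ((k.factorial : ℕ) : ℂ) ≠ 0 := by exact_mod_cast Nat.factorial_ne_zero k
    push_cast
    rw [pow_succ]
    field_simp
  rw [e2, ← e]; ring

lemma hasDerivAt_besselPhiReal (μ y : ℝ) :
    HasDerivAt (besselPhiReal μ) (besselPhiReal (μ + 1) y) y := by
  have h := (hasDerivAt_besselPhi μ y).real_of_complex
  have h1 : (fun x : ℝ => (besselPhi μ x).re) = besselPhiReal μ := by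
    ext x; rw [← ofReal_besselPhiReal, Complex.ofReal_re]
  have h2 : (besselPhi ((μ : ℂ) + 1) y).re = besselPhiReal (μ + 1) y := by
    have : (μ : ℂ) + 1 = ((μ + 1 : ℝ) : ℂ) := by push_cast; rfl
    rw [this, ← ofReal_besselPhiReal, Complex.ofReal_re]
  rw [h1, h2] at h
  exact h

lemma besselPhiReal_recurrence (μ y : ℝ) :
    besselPhiReal (μ - 1) y = μ * besselPhiReal μ y + y * besselPhiReal (μ + 1) y := by
  have h := besselPhi_recurrence μ y
  have h1 : (μ : ℂ) - 1 = ((μ - 1 : ℝ) : ℂ) := by push_cast; rfl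
  have h2 : (μ : ℂ) + 1 = ((μ + 1 : ℝ) : ℂ) := by push_cast; rfl
  rw [h1, h2, ← ofReal_besselPhiReal, ← ofReal_besselPhiReal, ← ofReal_besselPhiReal] at h
  exact_mod_cast h

lemma besselPhiReal_zero (μ : ℝ) : besselPhiReal μ 0 = (Real.Gamma (μ + 1))⁻¹ := by
  unfold besselPhiReal
  rw [tsum_eq_single 0]
  · simp
  · intro k hk; simp [hk]

lemma hasDerivAt_rpow_mul_besselPhiReal (μ : ℝ) {y : ℝ} (hy : 0 < y) :
    HasDerivAt (fun y => y ^ μ * besselPhiReal μ y) (y ^ (μ - 1) * besselPhiReal (μ - 1) y) y := by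
  have h := (Real.hasDerivAt_rpow_const (p := μ) (Or.inl hy.ne')).mul
    (hasDerivAt_besselPhiReal μ y)
  refine h.congr_deriv ?_
  rw [besselPhiReal_recurrence μ y, Real.rpow_sub_one hy.ne']
  field_simp

lemma besselJ_eq (ν : ℝ) {x : ℝ} (hx : 0 < x) :
    besselJ ν x = (x / 2) ^ ν * besselPhiReal ν (-(x / 2) ^ 2) := by
  unfold besselJ besselPhiReal
  rw [← tsum_mul_left]
  refine tsum_congr fun k => ?_
  have hx2 : 0 < x / 2 := by positivity
  rw [Real.rpow_add hx2, Real.rpow_mul hx2.le]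
  have h1 : ((x / 2 : ℝ) ^ (2 : ℝ)) ^ (k : ℝ) = ((x / 2) ^ 2) ^ k := by
    rw [Real.rpow_natCast]; congr 1; exact_mod_cast Real.rpow_natCast (x / 2) 2
  rw [h1, neg_pow ((x / 2) ^ 2), div_eq_mul_inv ((-1 : ℝ) ^ k), mul_inv]
  ring

/-! ### The modified Bessel function of the second kind, up to normalisation -/

/-- The integral `∫₀^∞ v ^ (ν - 1) exp (-v - y / v) dv`. It equals `2 y ^ (ν / 2) K_ν(2 √y)`, with the
modified Bessel function `K_ν`. -/
noncomputable def macdonald (ν y : ℝ) : ℝ :=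
  ∫ v in Set.Ioi (0 : ℝ), v ^ (ν - 1) * Real.exp (-v - y / v)

lemma measurable_macdonald_integrand (ν y : ℝ) :
    Measurable fun v : ℝ => v ^ (ν - 1) * Real.exp (-v - y / v) := by fun_prop

lemma integrableOn_macdonald (ν : ℝ) {y : ℝ} (hy : 0 < y) :
    IntegrableOn (fun v : ℝ => v ^ (ν - 1) * Real.exp (-v - y / v)) (Set.Ioi 0) := by
  -- near the origin `exp (-y / v)` is smaller than any power `v ^ k`
  obtain ⟨k, hk⟩ := exists_nat_gt (-ν)
  have h := (Real.GammaIntegral_convergent (s := ν + k) (by linarith)).const_mul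
    (k.factorial / y ^ k)
  refine Integrable.mono' h (measurable_macdonald_integrand ν y).aestronglyMeasurable ?_
  filter_upwards [ae_restrict_mem measurableSet_Ioi] with v hv
  have hv : 0 < v := hv
  rw [Real.norm_of_nonneg (by positivity)]
  have h1 := Real.pow_div_factorial_le_exp (y / v) (by positivity) k
  have h2 : Real.exp (-(y / v)) ≤ k.factorial / y ^ k * v ^ k := by
    rw [Real.exp_neg]
    refine (inv_anti₀ (by positivity) h1).trans (le_of_eq ?_)
    rw [div_pow]; field_simp
  have h3 : v ^ (ν + k - 1) = v ^ (ν - 1) * v ^ k := by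
    rw [← Real.rpow_natCast v k, ← Real.rpow_add hv]; ring_nf
  rw [h3, sub_eq_add_neg (-v), Real.exp_add]
  calc v ^ (ν - 1) * (Real.exp (-v) * Real.exp (-(y / v)))
      ≤ v ^ (ν - 1) * (Real.exp (-v) * (k.factorial / y ^ k * v ^ k)) := by gcongr
    _ = _ := by ring

lemma macdonald_pos (ν : ℝ) {y : ℝ} (hy : 0 < y) : 0 < macdonald ν y := by
  unfold macdonald
  rw [setIntegral_pos_iff_support_of_nonneg_ae]
  · have : (Function.support fun v : ℝ => v ^ (ν - 1) * Real.exp (-v - y / v)) ∩ Set.Ioi 0 =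
        Set.Ioi 0 := by
      ext v
      simp only [Set.mem_inter_iff, Function.mem_support, Set.mem_Ioi, and_iff_right_iff_imp]
      intro hv; positivity
    rw [this]; simp
  · filter_upwards [ae_restrict_mem measurableSet_Ioi] with v hv
    have hv : 0 < v := hv
    simp only [Pi.zero_apply]; positivity
  · exact integrableOn_macdonald ν hy

lemma hasDerivAt_macdonald (ν : ℝ) {y : ℝ} (hy : 0 < y) :
    HasDerivAt (macdonald ν) (-macdonald (ν - 1) y) y := by
  have hb := integrableOn_macdonald (ν - 1) (y := y / 2) (by positivity)
  have key := hasDerivAt_integral_of_dominated_loc_of_deriv_le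
    (μ := volume.restrict (Set.Ioi (0 : ℝ)))
    (F := fun y v => v ^ (ν - 1) * Real.exp (-v - y / v))
    (F' := fun y v => -(v ^ (ν - 1 - 1) * Real.exp (-v - y / v))) (x₀ := y)
    (s := Set.Ioi (y / 2))
    (bound := fun v => v ^ (ν - 1 - 1) * Real.exp (-v - y / 2 / v))
    (Ioi_mem_nhds (by linarith))
    (Eventually.of_forall fun z => (measurable_macdonald_integrand ν z).aestronglyMeasurable)
    (integrableOn_macdonald ν hy)
    ((measurable_macdonald_integrand (ν - 1) y).neg.aestronglyMeasurable)
    ?_ hb ?_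
  · have h2 := key.2
    rw [integral_neg] at h2
    exact h2
  · filter_upwards [ae_restrict_mem measurableSet_Ioi] with v hv z hz
    have hv : 0 < v := hv
    have hz : y / 2 < z := hz
    rw [norm_neg, Real.norm_of_nonneg (by positivity)]
    gcongr
  · filter_upwards [ae_restrict_mem measurableSet_Ioi] with v hv z hz
    have hv : 0 < v := hv
    have h1 : HasDerivAt (fun y : ℝ => -v - y / v) (-(1 / v)) z := by
      simpa using ((hasDerivAt_id z).div_const v).const_sub (-v)
    refine (h1.exp.const_mul (v ^ (ν - 1))).congr_deriv ?_
    rw [Real.rpow_sub_one hv.ne' (ν - 1)]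
    field_simp

lemma tendsto_macdonald_zero {ν : ℝ} (hν : 0 < ν) :
    Tendsto (macdonald ν) (𝓝[>] 0) (𝓝 (Real.Gamma ν)) := by
  have hG : Real.Gamma ν = ∫ v in Set.Ioi (0 : ℝ), v ^ (ν - 1) * Real.exp (-v - 0 / v) := by
    rw [Real.Gamma_eq_integral hν]
    simp [mul_comm]
  rw [hG]
  refine tendsto_integral_filter_of_dominated_convergence
    (fun v => Real.exp (-v) * v ^ (ν - 1))
    (Eventually.of_forall fun z => (measurable_macdonald_integrand ν z).aestronglyMeasurable)
    ?_ (Real.GammaIntegral_convergent hν) ?_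
  · filter_upwards [self_mem_nhdsWithin] with y hy
    have hy : 0 < y := hy
    filter_upwards [ae_restrict_mem measurableSet_Ioi] with v hv
    have hv : 0 < v := hv
    rw [Real.norm_of_nonneg (by positivity), mul_comm]
    gcongr
    have : 0 < y / v := by positivity
    linarith
  · filter_upwards with v
    refine Tendsto.mono_left ?_ nhdsWithin_le_nhds
    have : Continuous fun y : ℝ => v ^ (ν - 1) * Real.exp (-v - y / v) := by fun_prop
    exact this.tendsto 0

/-- Integration by parts gives the three-term recurrence. -/
lemma macdonald_recurrence {ν : ℝ} (hν : 0 < ν) {y : ℝ} (hy : 0 < y) :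
    macdonald (ν + 1) y = ν * macdonald ν y + y * macdonald (ν - 1) y := by
  have h1 := integrableOn_macdonald (ν + 1) hy
  have h0 := (integrableOn_macdonald ν hy).const_mul ν
  have hm := (integrableOn_macdonald (ν - 1) hy).const_mul y
  have hder : ∀ v ∈ Set.Ioi (0 : ℝ), HasDerivAt (fun v : ℝ => v ^ ν * Real.exp (-v - y / v))
      (ν * (v ^ (ν - 1) * Real.exp (-v - y / v)) + y * (v ^ (ν - 1 - 1) * Real.exp (-v - y / v)) -
        v ^ (ν + 1 - 1) * Real.exp (-v - y / v)) v := by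
    intro v hv
    have hv : 0 < v := hv
    have ha := Real.hasDerivAt_rpow_const (p := ν) (Or.inl hv.ne')
    have hb : HasDerivAt (fun v : ℝ => -v - y / v) (-1 + y / v ^ 2) v := by
      refine ((hasDerivAt_id v).neg.sub ((hasDerivAt_inv hv.ne').const_mul y)).congr_deriv ?_
      field_simp
      ring
    refine (ha.mul hb.exp).congr_deriv ?_
    rw [Real.rpow_sub_one hv.ne' (ν - 1), Real.rpow_sub_one hv.ne', add_sub_cancel_right]
    field_simp
    ring
  have hint : IntegrableOn (fun v : ℝ => ν * (v ^ (ν - 1) * Real.exp (-v - y / v)) +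
      y * (v ^ (ν - 1 - 1) * Real.exp (-v - y / v)) -
        v ^ (ν + 1 - 1) * Real.exp (-v - y / v)) (Set.Ioi 0) := (h0.add hm).sub h1
  have hcont : IntegrableOn (fun v : ℝ => v ^ ν * Real.exp (-v - y / v)) (Set.Ioi 0) := by
    simpa using h1
  have hlim0 : ContinuousWithinAt (fun v : ℝ => v ^ ν * Real.exp (-v - y / v)) (Set.Ici 0) 0 := by
    have h2 : Tendsto (fun v : ℝ => v ^ ν) (𝓝[Set.Ici 0] 0) (𝓝 0) := by
      have := (Real.continuous_rpow_const hν.le).tendsto 0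
      rw [Real.zero_rpow hν.ne'] at this
      exact this.mono_left nhdsWithin_le_nhds
    unfold ContinuousWithinAt
    simp only [Real.zero_rpow hν.ne', zero_mul]
    refine squeeze_zero' ?_ ?_ h2
    · filter_upwards [self_mem_nhdsWithin] with v hv
      have hv : 0 ≤ v := hv
      positivity
    · filter_upwards [self_mem_nhdsWithin] with v hv
      have hv : 0 ≤ v := hv
      refine mul_le_of_le_one_right (by positivity) (Real.exp_le_one_iff.2 ?_)
      have : 0 ≤ y / v := by positivity
      linarith
  have hlim1 : Tendsto (fun v : ℝ => v ^ ν * Real.exp (-v - y / v)) atTop (𝓝 0) :=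
    tendsto_zero_of_hasDerivAt_of_integrableOn_Ioi hder hint hcont
  have h := integral_Ioi_of_hasDerivAt_of_tendsto hlim0 hder hint hlim1
  rw [Real.zero_rpow hν.ne', zero_mul] at h
  have e1 := integral_sub (h0.add hm) h1
  have e2 := integral_add h0 hm
  rw [integral_const_mul, integral_const_mul] at e2
  simp only [Pi.add_apply] at e1
  unfold macdonald
  linarith

lemma macdonald_neg (ν : ℝ) {y : ℝ} (hy : 0 < y) :
    macdonald ν y = y ^ ν * macdonald (-ν) y := by
  unfold macdonald
  rw [← integral_comp_rpow_Ioi (fun v : ℝ => v ^ (ν - 1) * Real.exp (-v - y / v))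
      (p := -1) (by norm_num)]
  have h := integral_comp_mul_left_Ioi
    (fun v : ℝ => (|(-1 : ℝ)| * v ^ ((-1 : ℝ) - 1)) •
      ((v ^ (-1 : ℝ)) ^ (ν - 1) * Real.exp (-(v ^ (-1 : ℝ)) - y / (v ^ (-1 : ℝ))))) 0
      (b := y⁻¹) (by positivity)
  rw [mul_zero, inv_inv, smul_eq_mul] at h
  have h' : ∀ A B : ℝ, A = y * B → B = y⁻¹ * A := by intro A B h; rw [h]; field_simp
  rw [h' _ _ h, ← integral_const_mul, ← integral_const_mul]
  refine setIntegral_congr_fun measurableSet_Ioi fun v hv => ?_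
  have hv : 0 < v := hv
  have h1 : (y⁻¹ * v) ^ (-1 : ℝ) = y / v := by
    rw [Real.rpow_neg_one]; field_simp
  have h2 : (y⁻¹ * v) ^ ((-1 : ℝ) - 1) = (y / v) ^ 2 := by
    rw [Real.rpow_sub_one (by positivity), h1]; field_simp
  simp only [smul_eq_mul, h1, h2]
  have h3 : y / (y / v) = v := by field_simp
  rw [h3, Real.div_rpow hy.le hv.le, Real.rpow_sub_one hy.ne', Real.rpow_sub_one hv.ne',
    Real.rpow_sub_one hv.ne', Real.rpow_neg hv.le, abs_neg, abs_one]
  have h4 : -(y / v) - v = -v - y / v := by ring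
  rw [h4]
  have : 0 < v ^ ν := by positivity
  field_simp

/-- The combination of entire functions that represents `macdonald ν` for a noninteger order. -/
noncomputable def macdonaldSeries (ν y : ℝ) : ℝ :=
  Real.pi / Real.sin (Real.pi * ν) *
    (besselPhiReal (-ν) y - y ^ ν * besselPhiReal ν y)

lemma sin_pi_mul_sub_one (ν : ℝ) : Real.sin (Real.pi * (ν - 1)) = -Real.sin (Real.pi * ν) := by
  rw [mul_sub, mul_one, Real.sin_sub_pi]

lemma sin_pi_mul_add_one (ν : ℝ) : Real.sin (Real.pi * (ν + 1)) = -Real.sin (Real.pi * ν) := by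
  rw [mul_add, mul_one, Real.sin_add_pi]

lemma hasDerivAt_macdonaldSeries (ν : ℝ) {y : ℝ} (hy : 0 < y) :
    HasDerivAt (macdonaldSeries ν) (-macdonaldSeries (ν - 1) y) y := by
  have h := ((hasDerivAt_besselPhiReal (-ν) y).sub (hasDerivAt_rpow_mul_besselPhiReal ν hy)).const_mul
    (Real.pi / Real.sin (Real.pi * ν))
  refine h.congr_deriv ?_
  unfold macdonaldSeries
  rw [sin_pi_mul_sub_one]
  have : -(ν - 1) = -ν + 1 := by ring
  rw [this, div_neg]
  ring

lemma macdonaldSeries_neg (ν : ℝ) {y : ℝ} (hy : 0 < y) :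
    macdonaldSeries ν y = y ^ ν * macdonaldSeries (-ν) y := by
  unfold macdonaldSeries
  rw [mul_neg, Real.sin_neg, neg_neg, Real.rpow_neg hy.le, div_neg]
  have : 0 < y ^ ν := by positivity
  field_simp
  ring

lemma macdonaldSeries_recurrence (ν : ℝ) {y : ℝ} (hy : 0 < y) :
    macdonaldSeries (ν + 1) y = ν * macdonaldSeries ν y + y * macdonaldSeries (ν - 1) y := by
  have h1 := besselPhiReal_recurrence (-ν) y
  have h2 := besselPhiReal_recurrence ν y
  unfold macdonaldSeries
  rw [sin_pi_mul_sub_one, sin_pi_mul_add_one, Real.rpow_sub_one hy.ne', Real.rpow_add_one hy.ne']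
  have e1 : -(ν + 1) = -ν - 1 := by ring
  have e2 : -(ν - 1) = -ν + 1 := by ring
  rw [e1, e2, h1, h2, div_neg]
  field_simp
  ring

lemma tendsto_macdonaldSeries_zero {ν : ℝ} (hν : 0 < ν) (hs : Real.sin (Real.pi * ν) ≠ 0) :
    Tendsto (macdonaldSeries ν) (𝓝[>] 0) (𝓝 (Real.Gamma ν)) := by
  have c1 : Continuous (besselPhiReal (-ν)) :=
    continuous_iff_continuousAt.2 fun y => (hasDerivAt_besselPhiReal _ y).continuousAt
  have c2 : Continuous (besselPhiReal ν) :=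
    continuous_iff_continuousAt.2 fun y => (hasDerivAt_besselPhiReal _ y).continuousAt
  have c3 : Continuous fun y : ℝ => y ^ ν := Real.continuous_rpow_const hν.le
  have c : Continuous (macdonaldSeries ν) := by unfold macdonaldSeries; fun_prop
  have h := c.tendsto 0
  have e : macdonaldSeries ν 0 = Real.Gamma ν := by
    unfold macdonaldSeries
    rw [Real.zero_rpow hν.ne', besselPhiReal_zero]
    have h1 := Real.Gamma_mul_Gamma_one_sub ν
    have h2 : Real.Gamma (1 - ν) ≠ 0 := by
      intro h0
      rw [h0, mul_zero] at h1
      exact (div_ne_zero Real.pi_pos.ne' hs) h1.symm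
    rw [← h1, neg_add_eq_sub]
    field_simp
    ring
  rw [e] at h
  exact h.mono_left nhdsWithin_le_nhds

/-- A solution of the singular first-order system satisfied by Bessel functions of orders `ν` and
`1 - ν` vanishes if it tends to `0` at the origin: the coefficients are integrable there. -/
lemma eq_zero_of_bessel_system {ν : ℝ} (h0 : 0 < ν) (h1 : ν < 1) {f g : ℝ → ℝ}
    (hf : ∀ y, 0 < y → HasDerivAt f (-(y ^ (ν - 1) * g y)) y)
    (hg : ∀ y, 0 < y → HasDerivAt g (-(y ^ (-ν) * f y)) y)
    (hf0 : Tendsto f (𝓝[>] 0) (𝓝 0)) (hg0 : Tendsto g (𝓝[>] 0) (𝓝 0)) {y : ℝ} (hy : 0 < y) :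
    f y = 0 := by
  -- `a` is a primitive of the sum of the coefficients, which makes `E` antitone
  set a : ℝ → ℝ := fun y => y ^ ν / ν + y ^ (1 - ν) / (1 - ν) with ha
  set E : ℝ → ℝ := fun y => (f y ^ 2 + g y ^ 2) * Real.exp (-a y) with hE
  have hν1 : 1 - ν ≠ 0 := by linarith
  have hda : ∀ y, 0 < y → HasDerivAt a (y ^ (ν - 1) + y ^ (-ν)) y := by
    intro y hy
    have e1 := (Real.hasDerivAt_rpow_const (p := ν) (Or.inl hy.ne')).div_const ν
    have e2 := (Real.hasDerivAt_rpow_const (p := 1 - ν) (Or.inl hy.ne')).div_const (1 - ν)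
    refine (e1.add e2).congr_deriv ?_
    have : 1 - ν - 1 = -ν := by ring
    rw [this]
    field_simp
  have hdE : ∀ y, 0 < y → HasDerivAt E
      (-((y ^ (ν - 1) + y ^ (-ν)) * (f y + g y) ^ 2 * Real.exp (-a y))) y := by
    intro y hy
    have e := (((hf y hy).pow 2).add ((hg y hy).pow 2)).mul (hda y hy).neg.exp
    refine e.congr_deriv ?_
    simp only [Pi.add_apply, Pi.pow_apply, Pi.neg_apply]
    push_cast
    ring
  have hanti : AntitoneOn E (Set.Ioi 0) := by
    refine antitoneOn_of_deriv_nonpos (convex_Ioi 0)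
      (fun y hy => (hdE y hy).continuousAt.continuousWithinAt)
      (fun y hy => (hdE y (by simpa using hy)).differentiableAt.differentiableWithinAt) ?_
    intro y hy
    have hy : 0 < y := by simpa using hy
    rw [(hdE y hy).deriv]
    have : 0 ≤ (y ^ (ν - 1) + y ^ (-ν)) * (f y + g y) ^ 2 * Real.exp (-a y) := by positivity
    linarith
  have hlim : Tendsto E (𝓝[>] 0) (𝓝 0) := by
    have e1 : Tendsto (fun y => f y ^ 2 + g y ^ 2) (𝓝[>] 0) (𝓝 0) := by
      simpa using (hf0.pow 2).add (hg0.pow 2)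
    refine squeeze_zero' (Eventually.of_forall fun y => by positivity) ?_ e1
    filter_upwards [self_mem_nhdsWithin] with y hy
    have hy : 0 < y := hy
    refine mul_le_of_le_one_right (by positivity) (Real.exp_le_one_iff.2 ?_)
    have : 0 < 1 - ν := by linarith
    have : 0 ≤ a y := by positivity
    linarith
  have hle : E y ≤ 0 := by
    refine ge_of_tendsto hlim ?_
    filter_upwards [Ioo_mem_nhdsGT hy] with z hz
    exact hanti hz.1 hy hz.2.le
  have h2 : f y ^ 2 + g y ^ 2 ≤ 0 := by
    by_contra hc
    push Not at hc
    have : 0 < E y := by positivity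
    linarith
  have : f y ^ 2 ≤ 0 := by nlinarith [sq_nonneg (g y)]
  exact pow_eq_zero_iff (two_ne_zero) |>.1 (le_antisymm this (sq_nonneg _))

lemma real_sin_pi_mul_ne_zero {ν : ℝ} {n : ℤ} (h0 : (n : ℝ) < ν) (h1 : ν < n + 1) :
    Real.sin (Real.pi * ν) ≠ 0 := by
  intro h
  obtain ⟨m, hm⟩ := Real.sin_eq_zero_iff.1 h
  have : (m : ℝ) = ν := by
    have := Real.pi_pos
    rw [mul_comm] at hm
    exact mul_left_cancel₀ this.ne' hm
  rw [← this] at h0 h1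
  have a1 : n < m := by exact_mod_cast h0
  have a2 : m < n + 1 := by exact_mod_cast h1
  omega

lemma macdonald_eq_series_of_lt_one {ν : ℝ} (h0 : 0 < ν) (h1 : ν < 1) {y : ℝ} (hy : 0 < y) :
    macdonald ν y = macdonaldSeries ν y := by
  have key : ∀ ν : ℝ, 0 < ν → ν < 1 →
      Tendsto (fun y => macdonald ν y - macdonaldSeries ν y) (𝓝[>] 0) (𝓝 0) := by
    intro ν h0 h1
    have hs : Real.sin (Real.pi * ν) ≠ 0 :=
      real_sin_pi_mul_ne_zero (n := 0) (by simpa using h0) (by simpa using h1)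
    simpa using (tendsto_macdonald_zero h0).sub (tendsto_macdonaldSeries_zero h0 hs)
  have hder : ∀ ν y : ℝ, 0 < y →
      HasDerivAt (fun y => macdonald ν y - macdonaldSeries ν y)
        (-(y ^ (ν - 1) * (macdonald (1 - ν) y - macdonaldSeries (1 - ν) y))) y := by
    intro ν y hy
    refine ((hasDerivAt_macdonald ν hy).sub (hasDerivAt_macdonaldSeries ν hy)).congr_deriv ?_
    rw [macdonald_neg (ν - 1) hy, macdonaldSeries_neg (ν - 1) hy]
    rw [neg_sub]; ring
  refine sub_eq_zero.1 (eq_zero_of_bessel_system h0 h1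
    (f := fun y => macdonald ν y - macdonaldSeries ν y)
    (g := fun y => macdonald (1 - ν) y - macdonaldSeries (1 - ν) y)
    (hder ν) (fun y hy => ?_) (key ν h0 h1) (key (1 - ν) (by linarith) (by linarith)) hy)
  refine (hder (1 - ν) y hy).congr_deriv ?_
  have e1 : 1 - ν - 1 = -ν := by ring
  have e2 : 1 - (1 - ν) = ν := by ring
  rw [e1, e2]

/-- The power series of `K_ν` for noninteger order: both sides obey the same recurrence in the order,
and orders in `(0, 1)` are settled by the differential system. -/
theorem macdonald_eq_series {ν : ℝ} (h0 : 0 < ν) (hs : ¬ ∃ n : ℤ, (n : ℝ) = ν) {y : ℝ}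
    (hy : 0 < y) : macdonald ν y = macdonaldSeries ν y := by
  -- the recurrence has three terms, so two consecutive intervals are carried along
  have key : ∀ n : ℕ, (∀ ν : ℝ, (n : ℝ) < ν → ν < n + 1 → macdonald ν y = macdonaldSeries ν y) ∧
      (∀ ν : ℝ, (n : ℝ) - 1 < ν → ν < n → macdonald ν y = macdonaldSeries ν y) := by
    intro n
    induction n with
    | zero =>
      refine ⟨fun ν a b => macdonald_eq_series_of_lt_one (by simpa using a) (by simpa using b) hy,
        fun ν a b => ?_⟩
      simp only [Nat.cast_zero] at a b
      rw [macdonald_neg ν hy, macdonaldSeries_neg ν hy,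
        macdonald_eq_series_of_lt_one (by linarith) (by linarith) hy]
    | succ n ih =>
      refine ⟨fun ν a b => ?_, fun ν a b => ih.1 ν ?_ ?_⟩
      · push_cast at a b
        have hν : 0 < ν - 1 := lt_of_le_of_lt (Nat.cast_nonneg n) (by linarith)
        have r1 := macdonald_recurrence hν hy
        have r2 := macdonaldSeries_recurrence (ν - 1) hy
        rw [sub_add_cancel] at r1 r2
        rw [r1, r2, ih.1 (ν - 1) (by linarith) (by linarith),
          ih.2 (ν - 1 - 1) (by linarith) (by linarith)]
      · push_cast at a; linarith
      · push_cast at b; linarith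
  have hf : ((⌊ν⌋₊ : ℕ) : ℝ) ≤ ν := Nat.floor_le h0.le
  refine (key ⌊ν⌋₊).1 ν (lt_of_le_of_ne hf fun h => hs ⟨⌊ν⌋₊, by simpa using h⟩) (Nat.lt_floor_add_one ν)

/-! ### The integral in Nicholson's formula -/

lemma lintegral_Ioi_comp_mul {c : ℝ} (hc : 0 < c) (f : ℝ → ℝ≥0∞) :
    ∫⁻ v in Set.Ioi (0 : ℝ), f v = ∫⁻ r in Set.Ioi (0 : ℝ), ENNReal.ofReal c * f (c * r) := by
  have h := lintegral_image_eq_lintegral_abs_deriv_mul (s := Set.Ioi (0 : ℝ)) (f := fun r => c * r)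
    (f' := fun _ => c) measurableSet_Ioi
    (fun r _ => by simpa using ((hasDerivAt_id r).const_mul c).hasDerivWithinAt)
    (fun a _ b _ hab => mul_left_cancel₀ hc.ne' hab) f
  have him : (fun r => c * r) '' Set.Ioi (0 : ℝ) = Set.Ioi 0 := by
    rw [Set.image_mul_left_Ioi hc, mul_zero]
  rw [him, abs_of_pos hc] at h
  exact h

lemma ofReal_macdonald (ν : ℝ) {y : ℝ} (hy : 0 < y) :
    ENNReal.ofReal (macdonald ν y) =
      ∫⁻ v in Set.Ioi (0 : ℝ), ENNReal.ofReal (v ^ (ν - 1) * Real.exp (-v - y / v)) := by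
  unfold macdonald
  refine ofReal_integral_eq_lintegral_ofReal (integrableOn_macdonald ν hy) ?_
  filter_upwards [ae_restrict_mem measurableSet_Ioi] with v hv
  have hv : 0 < v := hv
  simp only [Pi.zero_apply]; positivity

/-- The double integral of
`m ^ (ν - 1) r⁻¹ exp (-κ r (m + m⁻¹ + 2 c) - r⁻¹)` over `m, r > 0`. For `c = cosh b` it is, up to a
factor, the product of the values of `macdonald ν` at `κ exp b` and at `κ exp (-b)`; for `c = -1` it
is the integral in Nicholson's formula. -/
noncomputable def nicholson (ν κ c : ℝ) : ℝ≥0∞ :=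
  ∫⁻ m in Set.Ioi (0 : ℝ), ∫⁻ r in Set.Ioi (0 : ℝ),
    ENNReal.ofReal (m ^ (ν - 1) * r⁻¹ * Real.exp (-(κ * r * (m + m⁻¹ + 2 * c)) - r⁻¹))

/-- The product formula: multiply the two integrals out, introduce the product of the variables as a
new variable `m`, and rescale. -/
lemma macdonald_mul_macdonald (ν b : ℝ) {κ : ℝ} (hκ : 0 < κ) :
    ENNReal.ofReal (macdonald ν (κ * Real.exp b)) *
      ENNReal.ofReal (macdonald ν (κ * Real.exp (-b))) =
        ENNReal.ofReal (κ ^ ν) * nicholson ν κ (Real.cosh b) := by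
  rw [ofReal_macdonald ν (by positivity), ofReal_macdonald ν (by positivity)]
  have hm : ∀ y : ℝ, Measurable fun v : ℝ =>
      ENNReal.ofReal (v ^ (ν - 1) * Real.exp (-v - y / v)) :=
    fun y => (measurable_macdonald_integrand ν y).ennreal_ofReal
  rw [← lintegral_mul_const _ (hm _)]
  have step1 : ∀ v ∈ Set.Ioi (0 : ℝ),
      ENNReal.ofReal (v ^ (ν - 1) * Real.exp (-v - κ * Real.exp b / v)) *
        ∫⁻ w in Set.Ioi (0 : ℝ),
          ENNReal.ofReal (w ^ (ν - 1) * Real.exp (-w - κ * Real.exp (-b) / w)) =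
      ∫⁻ m in Set.Ioi (0 : ℝ), ENNReal.ofReal (κ ^ ν * (m ^ (ν - 1) * v⁻¹ *
        Real.exp (-(v * (1 + Real.exp (-b) / m)) - κ * (m + Real.exp b) / v))) := by
    intro v hv
    have hv : 0 < v := hv
    rw [lintegral_Ioi_comp_mul (c := κ / v) (by positivity), ← lintegral_const_mul]
    · refine setLIntegral_congr_fun measurableSet_Ioi fun m hm => ?_
      have hm : 0 < m := hm
      rw [← ENNReal.ofReal_mul (by positivity), ← ENNReal.ofReal_mul (by positivity)]
      congr 1
      rw [Real.mul_rpow (by positivity) hm.le, Real.div_rpow hκ.le hv.le]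
      have e1 : κ ^ ν = κ ^ (ν - 1) * κ := by
        rw [← Real.rpow_add_one hκ.ne', sub_add_cancel]
      have e2 : Real.exp (-(v * (1 + Real.exp (-b) / m)) - κ * (m + Real.exp b) / v) =
          Real.exp (-v - κ * Real.exp b / v) *
            Real.exp (-(κ / v * m) - κ * Real.exp (-b) / (κ / v * m)) := by
        rw [← Real.exp_add]
        congr 1
        field_simp
        ring
      rw [e1, e2]
      have : 0 < v ^ (ν - 1) := by positivity
      field_simp
    · exact ((hm _).comp (by fun_prop)).const_mul _
  rw [setLIntegral_congr_fun measurableSet_Ioi step1, lintegral_lintegral_swap (by fun_prop)]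
  unfold nicholson
  rw [← lintegral_const_mul']
  swap; · exact ENNReal.ofReal_ne_top
  refine setLIntegral_congr_fun measurableSet_Ioi fun m hm => ?_
  have hm : 0 < m := hm
  rw [lintegral_Ioi_comp_mul (c := κ * (m + Real.exp b)) (by positivity), ← lintegral_const_mul']
  swap; · exact ENNReal.ofReal_ne_top
  refine setLIntegral_congr_fun measurableSet_Ioi fun r hr => ?_
  have hr : 0 < r := hr
  rw [← ENNReal.ofReal_mul (by positivity), ← ENNReal.ofReal_mul (by positivity)]
  congr 1
  have e3 : -(κ * (m + Real.exp b) * r * (1 + Real.exp (-b) / m)) -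
      κ * (m + Real.exp b) / (κ * (m + Real.exp b) * r) =
      -(κ * r * (m + m⁻¹ + 2 * Real.cosh b)) - r⁻¹ := by
    have h1 : Real.exp b * Real.exp (-b) = 1 := by rw [← Real.exp_add]; simp
    have h2 : κ * (m + Real.exp b) / (κ * (m + Real.exp b) * r) = r⁻¹ := by field_simp
    rw [h2, Real.cosh_eq]
    have h3 : (m + Real.exp b) * (1 + Real.exp (-b) / m) =
        m + m⁻¹ + 2 * ((Real.exp b + Real.exp (-b)) / 2) := by
      field_simp
      linear_combination h1
    rw [← h3]
    ring
  rw [e3]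
  field_simp

lemma nicholson_eq_mul (ν b : ℝ) {κ : ℝ} (hκ : 0 < κ) :
    nicholson ν κ (Real.cosh b) =
      ENNReal.ofReal ((κ ^ ν)⁻¹ * (macdonald ν (κ * Real.exp b) * macdonald ν (κ * Real.exp (-b)))) := by
  have h := macdonald_mul_macdonald ν b hκ
  have hk : 0 < κ ^ ν := by positivity
  have hne : ENNReal.ofReal (κ ^ ν) ≠ 0 := by simpa using hk
  rw [← ENNReal.ofReal_mul (macdonald_pos ν (by positivity)).le] at h
  rw [ENNReal.ofReal_mul (by positivity), h, ENNReal.ofReal_inv_of_pos hk, ← mul_assoc,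
    ENNReal.inv_mul_cancel hne ENNReal.ofReal_ne_top, one_mul]

lemma nicholson_mono {ν κ κ' c c' : ℝ}
    (h : ∀ m : ℝ, 0 < m → κ' * (m + m⁻¹ + 2 * c') ≤ κ * (m + m⁻¹ + 2 * c)) :
    nicholson ν κ c ≤ nicholson ν κ' c' := by
  unfold nicholson
  refine setLIntegral_mono' measurableSet_Ioi fun m hm => setLIntegral_mono' measurableSet_Ioi
    fun r hr => ?_
  have hm : 0 < m := hm
  have hr : 0 < r := hr
  refine ENNReal.ofReal_le_ofReal ?_
  have := mul_le_mul_of_nonneg_right (h m hm) hr.le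
  gcongr ?_ * Real.exp (?_ - _)
  linarith

lemma nicholson_lt_top (ν : ℝ) {κ c : ℝ} (hκ : 0 < κ) (hc : -1 < c) : nicholson ν κ c < ∞ := by
  have hcosh : nicholson ν (κ * min 1 ((1 + c) / 2)) 1 < ∞ := by
    have h := nicholson_eq_mul ν 0 (κ := κ * min 1 ((1 + c) / 2))
      (mul_pos hκ (lt_min one_pos (by linarith)))
    rw [Real.cosh_zero] at h
    rw [h]
    exact ENNReal.ofReal_lt_top
  refine lt_of_le_of_lt (nicholson_mono fun m hm => ?_) hcosh
  -- `m + 1 / m + 2 c` is at least a multiple of `m + 1 / m + 2`, the case `c = 1`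
  have h1 : 2 ≤ m + m⁻¹ := by
    have : m + m⁻¹ - 2 = (m - 1) ^ 2 / m := by field_simp; ring
    have : 0 ≤ (m - 1) ^ 2 / m := by positivity
    linarith
  rw [mul_assoc]
  refine mul_le_mul_of_nonneg_left ?_ hκ.le
  set d := min 1 ((1 + c) / 2)
  have hd1 : d ≤ 1 := min_le_left _ _
  have hd2 : d ≤ (1 + c) / 2 := min_le_right _ _
  nlinarith

/-- The measure whose Laplace transform in the variable `c` is `nicholson ν κ c`. -/
noncomputable def nicholsonMeasure (ν κ : ℝ) : Measure (ℝ × ℝ) :=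
  ((volume.restrict (Set.Ioi (0 : ℝ))).prod (volume.restrict (Set.Ioi (0 : ℝ)))).withDensity
    fun q => ENNReal.ofReal (q.1 ^ (ν - 1) * q.2⁻¹ *
      Real.exp (-(κ * q.2 * (q.1 + q.1⁻¹)) - q.2⁻¹))

lemma lintegral_nicholsonMeasure (ν κ c : ℝ) :
    ∫⁻ q, ENNReal.ofReal (Real.exp (c * (-2 * κ * q.2))) ∂nicholsonMeasure ν κ =
      nicholson ν κ c := by
  unfold nicholsonMeasure nicholson
  rw [lintegral_withDensity_eq_lintegral_mul _ (by fun_prop) (by fun_prop),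
    lintegral_prod _ (by fun_prop)]
  refine setLIntegral_congr_fun measurableSet_Ioi fun m hm =>
    setLIntegral_congr_fun measurableSet_Ioi fun r hr => ?_
  have hm : 0 < m := hm
  have hr : 0 < r := hr
  simp only [Pi.mul_apply]
  rw [← ENNReal.ofReal_mul (by positivity), mul_assoc, ← Real.exp_add]
  congr 3
  ring

lemma integrable_exp_nicholsonMeasure (ν : ℝ) {κ c : ℝ} (hκ : 0 < κ) (hc : -1 < c) :
    Integrable (fun q : ℝ × ℝ => Real.exp (c * (-2 * κ * q.2))) (nicholsonMeasure ν κ) := by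
  refine ⟨by fun_prop, ?_⟩
  rw [hasFiniteIntegral_iff_ofReal (Eventually.of_forall fun q => (Real.exp_pos _).le),
    lintegral_nicholsonMeasure]
  exact nicholson_lt_top ν hκ hc

lemma mgf_nicholsonMeasure (ν : ℝ) {κ c : ℝ} :
    mgf (fun q : ℝ × ℝ => -2 * κ * q.2) (nicholsonMeasure ν κ) c = (nicholson ν κ c).toReal := by
  unfold mgf
  rw [integral_eq_lintegral_of_nonneg_ae (Eventually.of_forall fun q => (Real.exp_pos _).le)
    (by fun_prop), lintegral_nicholsonMeasure]

/-! ### Analytic continuation to the imaginary axis -/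

/-- The analytic continuation of `b ↦ macdonald ν (κ exp b)` to the complex plane. -/
noncomputable def macdonaldCont (ν κ : ℝ) (b : ℂ) : ℂ :=
  (Real.pi / Real.sin (Real.pi * ν) : ℝ) * (besselPhi (-ν : ℝ) (κ * Complex.exp b) -
    (κ ^ ν : ℝ) * Complex.exp (ν * b) * besselPhi ν (κ * Complex.exp b))

lemma macdonaldCont_ofReal {ν κ : ℝ} (hκ : 0 < κ) (b : ℝ) :
    macdonaldCont ν κ b = (macdonaldSeries ν (κ * Real.exp b) : ℝ) := by
  unfold macdonaldCont macdonaldSeries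
  have e1 : (κ : ℂ) * Complex.exp b = ((κ * Real.exp b : ℝ) : ℂ) := by push_cast; rfl
  have e2 : Complex.exp (ν * b) = ((Real.exp (ν * b) : ℝ) : ℂ) := by push_cast; rfl
  have e3 : (κ * Real.exp b) ^ ν = κ ^ ν * Real.exp (ν * b) := by
    rw [Real.mul_rpow hκ.le (Real.exp_pos _).le, ← Real.exp_mul, mul_comm b]
  rw [e1, e2, ← ofReal_besselPhiReal, ← ofReal_besselPhiReal, e3]
  push_cast
  ring

lemma differentiable_macdonaldCont (ν κ : ℝ) : Differentiable ℂ (macdonaldCont ν κ) := by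
  have h : ∀ μ : ℂ, Differentiable ℂ (besselPhi μ) := fun μ z => (hasDerivAt_besselPhi μ z).differentiableAt
  unfold macdonaldCont
  have h1 : ∀ μ : ℂ, Differentiable ℂ fun b : ℂ => besselPhi μ (κ * Complex.exp b) :=
    fun μ => (h μ).comp (by fun_prop)
  have h2 := h1 (-ν : ℝ)
  have h3 := h1 ν
  fun_prop

/-- A region, star-shaped about the origin, that contains the real axis and the segment from `-π i`
to `π i` without its ends, and on which `Re cosh > -1`. -/
def coshRegion : Set ℂ := {b | |b.im| < Real.pi ∧ -1 < (Complex.cosh b).re}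

lemma re_cosh (b : ℂ) : (Complex.cosh b).re = Real.cosh b.re * Real.cos b.im := by
  conv_lhs => rw [← Complex.re_add_im b]
  rw [Complex.cosh_add, Complex.cosh_mul_I, Complex.sinh_mul_I, ← Complex.ofReal_cosh,
    ← Complex.ofReal_sinh, ← Complex.ofReal_cos, ← Complex.ofReal_sin]
  rw [Complex.add_re, ← mul_assoc, ← Complex.ofReal_mul, ← Complex.ofReal_mul, Complex.ofReal_re,
    Complex.re_ofReal_mul, Complex.I_re, mul_zero, add_zero]

lemma isOpen_coshRegion : IsOpen coshRegion := by
  have h1 : IsOpen {b : ℂ | |b.im| < Real.pi} :=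
    isOpen_lt Complex.continuous_im.abs continuous_const
  have h2 : IsOpen {b : ℂ | -1 < (Complex.cosh b).re} :=
    isOpen_lt continuous_const (Complex.continuous_re.comp Complex.continuous_cosh)
  exact h1.inter h2

lemma isPreconnected_coshRegion : IsPreconnected coshRegion := by
  have h0 : (0 : ℂ) ∈ coshRegion := by simp [coshRegion, Real.pi_pos]
  have hstar : StarConvex ℝ (0 : ℂ) coshRegion := by
    rw [starConvex_zero_iff]
    intro b hb t ht0 ht1
    obtain ⟨h1, h2⟩ := hb
    rw [re_cosh] at h2
    have e1 : (t • b).im = t * b.im := by simp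
    have e2 : (t • b).re = t * b.re := by simp
    have h3 : |t * b.im| ≤ |b.im| := by
      rw [abs_mul, abs_of_nonneg ht0]; exact mul_le_of_le_one_left (abs_nonneg _) ht1
    have h4 : |t * b.re| ≤ |b.re| := by
      rw [abs_mul, abs_of_nonneg ht0]; exact mul_le_of_le_one_left (abs_nonneg _) ht1
    refine ⟨by rw [e1]; exact h3.trans_lt h1, ?_⟩
    rw [re_cosh, e1, e2]
    rcases le_or_gt 0 (Real.cos (t * b.im)) with hc | hc
    · have := mul_nonneg (Real.cosh_pos (t * b.re)).le hc
      linarith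
    · have h5 : Real.cos b.im ≤ Real.cos (t * b.im) := by
        rw [← Real.cos_abs b.im, ← Real.cos_abs (t * b.im)]
        exact Real.cos_le_cos_of_nonneg_of_le_pi (abs_nonneg _) h1.le h3
      have h6 : Real.cosh (t * b.re) ≤ Real.cosh b.re := Real.cosh_le_cosh.2 h4
      have h7 := (Real.cosh_pos b.re)
      nlinarith
  exact (hstar.isPathConnected h0).isConnected.isPreconnected

/-- The identity theorem extends the product formula from real `b` to `b = i φ`. -/
lemma nicholson_cos {ν κ : ℝ} (hν : 0 < ν) (hs : ¬ ∃ n : ℤ, (n : ℝ) = ν) (hκ : 0 < κ) {φ : ℝ}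
    (hφ : |φ| < Real.pi) :
    (((κ ^ ν) * (nicholson ν κ (Real.cos φ)).toReal : ℝ) : ℂ) =
      macdonaldCont ν κ (φ * Complex.I) * macdonaldCont ν κ (-(φ * Complex.I)) := by
  set X : ℝ × ℝ → ℝ := fun q => -2 * κ * q.2 with hX
  set μ := nicholsonMeasure ν κ with hμ
  have hint : ∀ c : ℝ, -1 < c → c ∈ interior (integrableExpSet X μ) := by
    intro c hc
    refine mem_interior.2 ⟨Set.Ioi (-1), fun c hc => ?_, isOpen_Ioi, hc⟩
    exact integrable_exp_nicholsonMeasure ν hκ hc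
  have hf : AnalyticOnNhd ℂ (fun b => ((κ ^ ν : ℝ) : ℂ) * complexMGF X μ (Complex.cosh b))
      coshRegion := by
    refine DifferentiableOn.analyticOnNhd (fun b hb => ?_) isOpen_coshRegion
    have h1 := (hasDerivAt_complexMGF (hint _ hb.2)).differentiableAt
    exact ((h1.comp b Complex.differentiable_cosh.differentiableAt).const_mul _).differentiableWithinAt
  have hg : AnalyticOnNhd ℂ (fun b => macdonaldCont ν κ b * macdonaldCont ν κ (-b)) coshRegion := by
    have h1 := differentiable_macdonaldCont ν κ
    have h2 : Differentiable ℂ fun b => macdonaldCont ν κ (-b) := h1.comp differentiable_neg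
    exact (h1.mul h2).differentiableOn.analyticOnNhd isOpen_coshRegion
  have hreal : ∀ b : ℝ, ((κ ^ ν : ℝ) : ℂ) * complexMGF X μ (Complex.cosh b) =
      macdonaldCont ν κ b * macdonaldCont ν κ (-b) := by
    intro b
    have e1 : Complex.cosh b = ((Real.cosh b : ℝ) : ℂ) := by push_cast; rfl
    have e2 : (-b : ℂ) = ((-b : ℝ) : ℂ) := by push_cast; rfl
    rw [e1, complexMGF_ofReal, mgf_nicholsonMeasure, e2, macdonaldCont_ofReal hκ,
      macdonaldCont_ofReal hκ, nicholson_eq_mul ν b hκ, ENNReal.toReal_ofReal,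
      macdonald_eq_series hν hs (by positivity), macdonald_eq_series hν hs (by positivity)]
    · have : κ ^ ν ≠ 0 := by positivity
      norm_cast
      field_simp
    · have := macdonald_pos ν (y := κ * Real.exp b) (by positivity)
      have := macdonald_pos ν (y := κ * Real.exp (-b)) (by positivity)
      positivity
  have h0 : (0 : ℂ) ∈ coshRegion := by simp [coshRegion, Real.pi_pos]
  have heq := hf.eqOn_of_preconnected_of_frequently_eq hg isPreconnected_coshRegion h0 (by
    have h1 : ∃ᶠ x : ℝ in 𝓝[≠] (0 : ℝ), ((κ ^ ν : ℝ) : ℂ) * complexMGF X μ (Complex.cosh x) =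
        macdonaldCont ν κ x * macdonaldCont ν κ (-x) := (Eventually.of_forall hreal).frequently
    have h2 : Tendsto (fun x : ℝ => (x : ℂ)) (𝓝[≠] 0) (𝓝[≠] 0) := by
      refine tendsto_nhdsWithin_iff.2 ⟨?_, ?_⟩
      · have := Complex.continuous_ofReal.tendsto 0
        rw [Complex.ofReal_zero] at this
        exact this.mono_left nhdsWithin_le_nhds
      · filter_upwards [self_mem_nhdsWithin] with x hx
        simpa using hx
    exact h2.frequently h1)
  have hφI : (φ * Complex.I : ℂ) ∈ coshRegion := by
    refine ⟨by simpa using hφ, ?_⟩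
    rw [re_cosh]
    have : -1 < Real.cos φ := by
      rw [← Real.cos_abs φ, ← Real.cos_pi]
      exact Real.cos_lt_cos_of_nonneg_of_le_pi (abs_nonneg _) le_rfl hφ
    simpa using this
  have h3 := heq hφI
  simp only at h3
  rw [← h3, Complex.cosh_mul_I, ← Complex.ofReal_cos, complexMGF_ofReal, mgf_nicholsonMeasure]
  push_cast
  rfl

/-! ### Nicholson's formula -/

lemma tendsto_nicholson (ν : ℝ) {κ c₀ : ℝ} (hκ : 0 < κ) {c : ℕ → ℝ} (hc : Antitone c)
    (hlim : Tendsto c atTop (𝓝 c₀)) :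
    Tendsto (fun n => nicholson ν κ (c n)) atTop (𝓝 (nicholson ν κ c₀)) := by
  have hae : ∀ᵐ q : ℝ × ℝ ∂nicholsonMeasure ν κ, 0 < q.2 := by
    unfold nicholsonMeasure
    refine (withDensity_absolutelyContinuous _ _).ae_le ?_
    have := (Measure.quasiMeasurePreserving_snd (μ := volume.restrict (Set.Ioi (0 : ℝ)))
      (ν := volume.restrict (Set.Ioi (0 : ℝ)))).ae (ae_restrict_mem measurableSet_Ioi)
    exact this
  simp_rw [← lintegral_nicholsonMeasure]
  refine lintegral_tendsto_of_tendsto_of_monotone (fun n => by fun_prop) ?_ ?_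
  · filter_upwards [hae] with q hq i j hij
    refine ENNReal.ofReal_le_ofReal (Real.exp_le_exp.2 ?_)
    have h1 : 0 < 2 * κ * q.2 := by positivity
    nlinarith [hc hij]
  · filter_upwards with q
    have : Continuous fun c : ℝ => ENNReal.ofReal (Real.exp (c * (-2 * κ * q.2))) :=
      ENNReal.continuous_ofReal.comp (by fun_prop)
    exact (this.tendsto c₀).comp hlim

lemma nicholson_neg_one {ν κ : ℝ} (hν : 0 < ν) (hs : ¬ ∃ n : ℤ, (n : ℝ) = ν) (hκ : 0 < κ) :
    nicholson ν κ (-1) = ENNReal.ofReal ((κ ^ ν)⁻¹ *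
      (macdonaldCont ν κ (Real.pi * Complex.I) * macdonaldCont ν κ (-(Real.pi * Complex.I))).re) := by
  set φ : ℕ → ℝ := fun n => Real.pi - Real.pi * (1 / ((n : ℝ) + 1)) with hφ
  have hφlim : Tendsto φ atTop (𝓝 Real.pi) := by
    have := (tendsto_one_div_add_atTop_nhds_zero_nat (𝕜 := ℝ)).const_mul Real.pi
    simpa [hφ] using this.const_sub Real.pi
  have hφ0 : ∀ n, 0 ≤ φ n := by
    intro n
    have h1 : 1 / ((n : ℝ) + 1) ≤ 1 := by
      rw [div_le_one (by positivity)]; linarith [Nat.cast_nonneg (α := ℝ) n]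
    have := mul_le_mul_of_nonneg_left h1 Real.pi_pos.le
    simp only [hφ]; linarith
  have hφ1 : ∀ n, φ n < Real.pi := by
    intro n
    have : 0 < Real.pi * (1 / ((n : ℝ) + 1)) := by have := Real.pi_pos; positivity
    simp only [hφ]; linarith
  have hφm : Monotone φ := by
    intro i j hij
    have h1 : 1 / ((j : ℝ) + 1) ≤ 1 / ((i : ℝ) + 1) := by
      have : (i : ℝ) ≤ j := by exact_mod_cast hij
      gcongr
    have := mul_le_mul_of_nonneg_left h1 Real.pi_pos.le
    simp only [hφ]; linarith
  have hanti : Antitone fun n => Real.cos (φ n) := fun i j hij =>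
    Real.cos_le_cos_of_nonneg_of_le_pi (hφ0 i) (hφ1 j).le (hφm hij)
  have hclim : Tendsto (fun n => Real.cos (φ n)) atTop (𝓝 (-1)) := by
    rw [← Real.cos_pi]
    exact (Real.continuous_cos.tendsto _).comp hφlim
  have h1 := tendsto_nicholson ν hκ hanti hclim
  have heq : ∀ n, nicholson ν κ (Real.cos (φ n)) = ENNReal.ofReal ((κ ^ ν)⁻¹ *
      (macdonaldCont ν κ (φ n * Complex.I) * macdonaldCont ν κ (-(φ n * Complex.I))).re) := by
    intro n
    have habs : |φ n| < Real.pi := by rw [abs_of_nonneg (hφ0 n)]; exact hφ1 n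
    rw [← nicholson_cos hν hs hκ habs, Complex.ofReal_re]
    have hgt : -1 < Real.cos (φ n) := by
      rw [← Real.cos_pi]
      exact Real.cos_lt_cos_of_nonneg_of_le_pi (hφ0 n) le_rfl (hφ1 n)
    have hk : κ ^ ν ≠ 0 := by positivity
    rw [inv_mul_cancel_left₀ hk, ENNReal.ofReal_toReal (nicholson_lt_top ν hκ hgt).ne]
  simp_rw [heq] at h1
  refine tendsto_nhds_unique h1 ?_
  have hd := (differentiable_macdonaldCont ν κ).continuous
  have hcont : Continuous fun t : ℝ => ENNReal.ofReal ((κ ^ ν)⁻¹ *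
      (macdonaldCont ν κ (t * Complex.I) * macdonaldCont ν κ (-(t * Complex.I))).re) :=
    ENNReal.continuous_ofReal.comp (continuous_const.mul (Complex.continuous_re.comp
      ((hd.comp (by fun_prop : Continuous fun t : ℝ => (t * Complex.I : ℂ))).mul
        (hd.comp (by fun_prop : Continuous fun t : ℝ => (-(t * Complex.I) : ℂ))))))
  exact (hcont.tendsto _).comp hφlim

/-- Nicholson's formula for noninteger orders. -/
lemma nicholson_eq_aux {ν x : ℝ} (hν : 0 < ν) (hs : ¬ ∃ n : ℤ, (n : ℝ) = ν) (hx : 0 < x) :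
    nicholson ν ((x / 2) ^ 2) (-1) =
      ENNReal.ofReal (Real.pi ^ 2 * (besselJ ν x ^ 2 + besselYAux x ν ^ 2)) := by
  have hx2 : 0 < x / 2 := by positivity
  rw [nicholson_neg_one hν hs (by positivity)]
  congr 1
  have hsin : Real.sin (Real.pi * ν) ≠ 0 := by
    intro h
    obtain ⟨m, hm⟩ := Real.sin_eq_zero_iff.1 h
    rw [mul_comm] at hm
    exact hs ⟨m, mul_left_cancel₀ Real.pi_pos.ne' hm⟩
  set A := besselPhiReal (-ν) (-(x / 2) ^ 2) with hA
  set B := besselPhiReal ν (-(x / 2) ^ 2) with hB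
  set S := Real.pi / Real.sin (Real.pi * ν) with hS
  set u := (x / 2) ^ ν with hu
  have hu0 : 0 < u := by positivity
  have hk : ((x / 2) ^ 2) ^ ν = u ^ 2 := by
    rw [hu, ← Real.rpow_natCast, ← Real.rpow_natCast, ← Real.rpow_mul hx2.le, ← Real.rpow_mul hx2.le,
      mul_comm]
  have hJ : besselJ ν x = u * B := besselJ_eq ν hx
  have hJ' : besselJ (-ν) x = u⁻¹ * A := by
    rw [besselJ_eq (-ν) hx, Real.rpow_neg hx2.le]
  -- at `b = ± i π` the argument `κ exp b` of the entire functions is `-κ`, and only the factor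
  -- `exp (ν b)` distinguishes the two signs
  have hcont : ∀ t : ℝ, Complex.exp (t * Complex.I) = -1 →
      macdonaldCont ν ((x / 2) ^ 2) (t * Complex.I) =
        S * (A - (u ^ 2 : ℝ) * (Real.cos (ν * t) + Real.sin (ν * t) * Complex.I) * B) := by
    intro t ht
    unfold macdonaldCont
    have e1 : (((x / 2) ^ 2 : ℝ) : ℂ) * (-1) = ((-(x / 2) ^ 2 : ℝ) : ℂ) := by push_cast; ring
    have e2 : Complex.exp (ν * (t * Complex.I)) =
        Real.cos (ν * t) + Real.sin (ν * t) * Complex.I := by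
      rw [← mul_assoc, ← Complex.ofReal_mul, Complex.exp_mul_I, Complex.ofReal_cos,
        Complex.ofReal_sin]
    rw [ht, e1, e2, hk, ← ofReal_besselPhiReal, ← ofReal_besselPhiReal]
  have hp1 := hcont Real.pi Complex.exp_pi_mul_I
  have hneg : (-(Real.pi * Complex.I) : ℂ) = ((-Real.pi : ℝ) : ℂ) * Complex.I := by push_cast; ring
  have hp2 := hcont (-Real.pi) (by rw [← hneg, Complex.exp_neg, Complex.exp_pi_mul_I]; norm_num)
  rw [hneg, hp1, hp2, hk, hJ]
  have hYd : besselYAux x ν = (u * B * Real.cos (Real.pi * ν) - u⁻¹ * A) / Real.sin (Real.pi * ν) := by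
    unfold besselYAux
    rw [hJ, hJ', mul_comm ν]
  rw [hYd, mul_neg, Real.cos_neg, Real.sin_neg, mul_comm ν Real.pi]
  set cν := Real.cos (Real.pi * ν)
  set sν := Real.sin (Real.pi * ν)
  have hcs : sν ^ 2 + cν ^ 2 = 1 := Real.sin_sq_add_cos_sq _
  have hre : ((S : ℂ) * (A - (u ^ 2 : ℝ) * (cν + sν * Complex.I) * B) *
      (S * (A - (u ^ 2 : ℝ) * (cν + (-sν : ℝ) * Complex.I) * B))).re =
      S ^ 2 * ((A - u ^ 2 * cν * B) ^ 2 + (u ^ 2 * sν * B) ^ 2) := by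
    have : (S : ℂ) * (A - (u ^ 2 : ℝ) * (cν + sν * Complex.I) * B) *
      (S * (A - (u ^ 2 : ℝ) * (cν + (-sν : ℝ) * Complex.I) * B)) =
      ((S ^ 2 * ((A - u ^ 2 * cν * B) ^ 2 + (u ^ 2 * sν * B) ^ 2) : ℝ) : ℂ) := by
      push_cast
      have := Complex.I_sq
      linear_combination (-(S : ℂ) ^ 2 * u ^ 4 * sν ^ 2 * B ^ 2) * this
    rw [this, Complex.ofReal_re]
  rw [hre, hS, div_pow]
  field_simp
  ring

lemma differentiable_besselJ_order {x : ℝ} (hx : 0 < x) : Differentiable ℝ fun ν => besselJ ν x := by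
  have h : (fun ν => besselJ ν x) = fun ν => (x / 2) ^ ν * besselPhiReal ν (-(x / 2) ^ 2) := by
    ext ν; exact besselJ_eq ν hx
  rw [h]
  intro ν
  have h1 := (differentiable_besselPhi_order ((-(x / 2) ^ 2 : ℝ) : ℂ) ν).hasDerivAt.real_of_complex
  have h2 : (fun μ : ℝ => (besselPhi μ ((-(x / 2) ^ 2 : ℝ) : ℂ)).re) =
      fun μ => besselPhiReal μ (-(x / 2) ^ 2) := by
    ext μ; rw [← ofReal_besselPhiReal, Complex.ofReal_re]
  rw [h2] at h1
  have hx2 : 0 < x / 2 := by positivity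
  have h3 : DifferentiableAt ℝ (fun ν : ℝ => (x / 2) ^ ν) ν :=
    ((hasDerivAt_id ν).const_rpow hx2).differentiableAt
  exact h3.mul h1.differentiableAt

lemma besselPhiReal_neg_natCast (n : ℕ) (y : ℝ) :
    besselPhiReal (-n) y = y ^ n * besselPhiReal n y := by
  have hs : Summable fun k : ℕ => (Real.Gamma (-(n : ℝ) + k + 1))⁻¹ * (y ^ k / (k.factorial : ℝ)) := by
    have h := summable_besselPhi (-n : ℝ) y
    rw [← Complex.summable_ofReal]
    refine h.congr fun k => ?_
    have : (((-n : ℝ) : ℂ) + k + 1) = ((-(n : ℝ) + k + 1 : ℝ) : ℂ) := by push_cast; rfl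
    rw [this, Complex.Gamma_ofReal]
    push_cast
    rfl
  unfold besselPhiReal
  rw [← hs.sum_add_tsum_nat_add n, ← tsum_mul_left, Finset.sum_eq_zero, zero_add]
  · refine tsum_congr fun j => ?_
    have e1 : -(n : ℝ) + ((j + n : ℕ) : ℝ) + 1 = j + 1 := by push_cast; ring
    have e2 : (n : ℝ) + j + 1 = ((j + n : ℕ) : ℝ) + 1 := by push_cast; ring
    rw [e1, e2, Real.Gamma_nat_eq_factorial, Real.Gamma_nat_eq_factorial, pow_add]
    field_simp
  -- the first `n` terms vanish at the poles of the gamma function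
  · intro k hk
    have hk : k < n := by simpa using hk
    have : -(n : ℝ) + k + 1 = -((n - k - 1 : ℕ) : ℝ) := by
      have : n - k - 1 + (k + 1) = n := by omega
      have h2 : ((n - k - 1 : ℕ) : ℝ) + (k + 1) = n := by exact_mod_cast this
      linarith
    rw [this, Real.Gamma_neg_nat_eq_zero]
    simp

lemma besselJ_neg_natCast (n : ℕ) {x : ℝ} (hx : 0 < x) :
    besselJ (-n) x = (-1) ^ n * besselJ n x := by
  have hx2 : 0 < x / 2 := by positivity
  rw [besselJ_eq _ hx, besselJ_eq _ hx, besselPhiReal_neg_natCast, Real.rpow_neg hx2.le,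
    Real.rpow_natCast, neg_pow, ← pow_mul, mul_comm 2 n, pow_mul]
  field_simp

/-- The limit that defines the Bessel function of the second kind at a positive integer exists: it is
a limit of quotients of two functions with a common simple zero. -/
lemma tendsto_besselYAux {n : ℕ} {x : ℝ} (hx : 0 < x) :
    Tendsto (besselYAux x) (𝓝[≠] (n : ℝ)) (𝓝 (besselY n x)) := by
  have hY : besselY n x = limUnder (𝓝[≠] (n : ℝ)) (besselYAux x) := by
    unfold besselY
    rw [if_pos ⟨n, by simp⟩]
  rw [hY]
  refine tendsto_nhds_limUnder ?_
  set N : ℝ → ℝ := fun ν => besselJ ν x * Real.cos (ν * Real.pi) - besselJ (-ν) x with hN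
  set D : ℝ → ℝ := fun ν => Real.sin (ν * Real.pi) with hD
  have hcosn : Real.cos (n * Real.pi) = (-1) ^ n := Real.cos_nat_mul_pi n
  have hNd : DifferentiableAt ℝ N n := by
    have h1 := differentiable_besselJ_order hx
    have h2 : Differentiable ℝ fun ν => besselJ (-ν) x := h1.comp differentiable_neg
    have h3 : Differentiable ℝ fun ν : ℝ => Real.cos (ν * Real.pi) := by fun_prop
    exact ((h1.mul h3).sub h2) n
  have hDd : HasDerivAt D (Real.cos (n * Real.pi) * Real.pi) n := by
    have := ((hasDerivAt_id (n : ℝ)).mul_const Real.pi).sin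
    simpa using this
  have hN0 : N n = 0 := by
    simp only [hN]
    rw [hcosn, besselJ_neg_natCast n hx]; ring
  have hD0 : D n = 0 := Real.sin_nat_mul_pi n
  have t1 := hasDerivAt_iff_tendsto_slope.1 hNd.hasDerivAt
  have t2 := hasDerivAt_iff_tendsto_slope.1 hDd
  have hne : Real.cos (n * Real.pi) * Real.pi ≠ 0 := by
    rw [hcosn]
    exact mul_ne_zero (pow_ne_zero _ (by norm_num)) Real.pi_pos.ne'
  refine ⟨_, (t1.div t2 hne).congr' ?_⟩
  filter_upwards [self_mem_nhdsWithin] with ν hν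
  have hν : ν - n ≠ 0 := sub_ne_zero.2 hν
  simp only [Pi.div_apply, slope_def_field, hN0, hD0, sub_zero]
  rw [div_div_div_cancel_right₀ hν]
  rfl

lemma nicholson_order_continuous {κ ν ν₁ ν₂ : ℝ} (h1 : ν₁ < ν) (h2 : ν < ν₂)
    (hf1 : nicholson ν₁ κ (-1) < ∞) (hf2 : nicholson ν₂ κ (-1) < ∞) :
    Tendsto (fun ν => nicholson ν κ (-1)) (𝓝[≠] ν) (𝓝 (nicholson ν κ (-1))) := by
  set F : ℝ → ℝ × ℝ → ℝ≥0∞ := fun ν q => ENNReal.ofReal (q.1 ^ (ν - 1) * q.2⁻¹ *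
    Real.exp (-(κ * q.2 * (q.1 + q.1⁻¹ + 2 * (-1))) - q.2⁻¹)) with hF
  set M := ((volume.restrict (Set.Ioi (0 : ℝ))).prod (volume.restrict (Set.Ioi (0 : ℝ)))) with hM
  have hmeas : ∀ ν, Measurable (F ν) := fun ν => by simp only [hF]; fun_prop
  have hnich : ∀ ν, nicholson ν κ (-1) = ∫⁻ q, F ν q ∂M := by
    intro ν
    rw [hM, lintegral_prod _ (hmeas ν).aemeasurable]
    rfl
  have hae : ∀ᵐ q ∂M, 0 < q.1 ∧ 0 < q.2 := by
    have a1 := (Measure.quasiMeasurePreserving_fst (μ := volume.restrict (Set.Ioi (0 : ℝ)))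
      (ν := volume.restrict (Set.Ioi (0 : ℝ)))).ae (ae_restrict_mem measurableSet_Ioi)
    have a2 := (Measure.quasiMeasurePreserving_snd (μ := volume.restrict (Set.Ioi (0 : ℝ)))
      (ν := volume.restrict (Set.Ioi (0 : ℝ)))).ae (ae_restrict_mem measurableSet_Ioi)
    filter_upwards [a1, a2] with q b1 b2
    exact ⟨b1, b2⟩
  simp_rw [hnich] at hf1 hf2 ⊢
  refine tendsto_lintegral_filter_of_dominated_convergence (fun q => F ν₁ q + F ν₂ q)
    (Eventually.of_forall hmeas) ?_ ?_ ?_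
  · have : ∀ᶠ t in 𝓝[≠] ν, t ∈ Set.Ioo ν₁ ν₂ := nhdsWithin_le_nhds (Ioo_mem_nhds h1 h2)
    filter_upwards [this] with t ht
    filter_upwards [hae] with q hq
    obtain ⟨hq1, hq2⟩ := hq
    simp only [hF]
    rw [← ENNReal.ofReal_add (by positivity) (by positivity), ← add_mul, ← add_mul]
    refine ENNReal.ofReal_le_ofReal ?_
    -- which of the two powers dominates depends on whether `m ≥ 1`
    have hle : q.1 ^ (t - 1) ≤ q.1 ^ (ν₁ - 1) + q.1 ^ (ν₂ - 1) := by
      rcases le_total 1 q.1 with h | h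
      · have a := Real.rpow_le_rpow_of_exponent_le h (by linarith [ht.2] : t - 1 ≤ ν₂ - 1)
        have b : 0 < q.1 ^ (ν₁ - 1) := by positivity
        linarith
      · have a := Real.rpow_le_rpow_of_exponent_ge hq1 h (by linarith [ht.1] : ν₁ - 1 ≤ t - 1)
        have b : 0 < q.1 ^ (ν₂ - 1) := by positivity
        linarith
    gcongr
  · rw [lintegral_add_left (hmeas _)]
    exact (ENNReal.add_lt_top.2 ⟨hf1, hf2⟩).ne
  · filter_upwards [hae] with q hq
    obtain ⟨hq1, hq2⟩ := hq
    have hc : Continuous fun t : ℝ => F t q := by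
      have : Continuous fun t : ℝ => q.1 ^ (t - 1) :=
        Continuous.rpow continuous_const (by fun_prop) (fun _ => Or.inl hq1.ne')
      exact ENNReal.continuous_ofReal.comp (by fun_prop)
    exact (hc.tendsto ν).mono_left nhdsWithin_le_nhds

/-- Nicholson's formula for the modulus of the Hankel function of a positive order. -/
theorem nicholson_eq {ν x : ℝ} (hν : 0 < ν) (hx : 0 < x) :
    nicholson ν ((x / 2) ^ 2) (-1) =
      ENNReal.ofReal (Real.pi ^ 2 * (besselJ ν x ^ 2 + besselY ν x ^ 2)) := by
  by_cases hs : ∃ n : ℤ, (n : ℝ) = ν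
  · obtain ⟨m, hm⟩ := hs
    have hm0 : 0 < m := by
      rw [← hm] at hν; exact_mod_cast hν
    obtain ⟨n, rfl⟩ : ∃ n : ℕ, (n : ℤ) = m := ⟨m.toNat, Int.toNat_of_nonneg hm0.le⟩
    have hm : (n : ℝ) = ν := by exact_mod_cast hm
    have hn1 : 1 ≤ n := by omega
    have hn1' : (1 : ℝ) ≤ n := by exact_mod_cast hn1
    have hnonint : ∀ t : ℝ, (n : ℝ) - 1 < t → t < n + 1 → t ≠ n → ¬ ∃ k : ℤ, (k : ℝ) = t := by
      rintro t h1 h2 h3 ⟨k, rfl⟩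
      have a1 : (n : ℤ) - 1 < k := by exact_mod_cast h1
      have a2 : k < (n : ℤ) + 1 := by exact_mod_cast h2
      have : k = n := by omega
      exact h3 (by rw [this]; simp)
    subst hm
    have hc := nicholson_order_continuous (κ := (x / 2) ^ 2) (ν := n) (ν₁ := n - 1 / 2)
      (ν₂ := n + 1 / 2) (by linarith) (by linarith)
      (by
        rw [nicholson_eq_aux (by linarith)
          (hnonint _ (by linarith) (by linarith) (by linarith)) hx]
        exact ENNReal.ofReal_lt_top)
      (by
        rw [nicholson_eq_aux (by linarith)
          (hnonint _ (by linarith) (by linarith) (by linarith)) hx]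
        exact ENNReal.ofReal_lt_top)
    refine tendsto_nhds_unique hc ?_
    have hJ : Tendsto (fun t => besselJ t x) (𝓝[≠] (n : ℝ)) (𝓝 (besselJ n x)) :=
      ((differentiable_besselJ_order hx).continuous.tendsto _).mono_left nhdsWithin_le_nhds
    have hY := tendsto_besselYAux (n := n) hx
    have hlim := ENNReal.tendsto_ofReal (((hJ.pow 2).add (hY.pow 2)).const_mul (Real.pi ^ 2))
    refine hlim.congr' ?_
    have hnear : ∀ᶠ t in 𝓝[≠] (n : ℝ), t ∈ Set.Ioo ((n : ℝ) - 1) (n + 1) :=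
      nhdsWithin_le_nhds (Ioo_mem_nhds (by linarith) (by linarith))
    filter_upwards [self_mem_nhdsWithin, hnear] with t ht ht2
    exact (nicholson_eq_aux (by linarith [ht2.1]) (hnonint t ht2.1 ht2.2 ht) hx).symm
  · rw [nicholson_eq_aux hν hs hx]
    unfold besselY
    rw [if_neg hs]

lemma nicholson_ne_zero (ν κ c : ℝ) : nicholson ν κ c ≠ 0 := by
  intro h
  unfold nicholson at h
  rw [lintegral_eq_zero_iff' (by fun_prop)] at h
  have h1 : ∀ᵐ m ∂volume.restrict (Set.Ioi (0 : ℝ)), False := by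
    filter_upwards [h, ae_restrict_mem measurableSet_Ioi] with m hm hm0
    have hm0 : 0 < m := hm0
    simp only [Pi.zero_apply] at hm
    rw [lintegral_eq_zero_iff' (by fun_prop)] at hm
    have h2 : ∀ᵐ r ∂volume.restrict (Set.Ioi (0 : ℝ)), False := by
      filter_upwards [hm, ae_restrict_mem measurableSet_Ioi] with r hr hr0
      have hr0 : 0 < r := hr0
      simp only [Pi.zero_apply, ENNReal.ofReal_eq_zero] at hr
      exact absurd hr (not_le.2 (by positivity))
    rw [ae_iff] at h2
    simp at h2
  rw [ae_iff] at h1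
  simp at h1

/-! ### The unnormalised invariant density -/

/-- The integrand of the double integral of the density: `t` lies on the arc that leads up to `w`. -/
noncomputable def arcKernel (p l t w : ℝ) : ℝ≥0∞ :=
  if t < w ∧ 0 < t * w then
    ENNReal.ofReal (|w| ^ (-p - 1) * |t| ^ (p - 1) * Real.exp (l * (1 / w - w - 1 / t + t)))
  else 0

/-- The density on the imaginary axis for the sign `+`, without its normalising constant; here
`l = 1 / s`. -/
noncomputable def rawDensity (p l w : ℝ) : ℝ≥0∞ := ∫⁻ t, arcKernel p l t w

lemma measurable_arcKernel (p l : ℝ) : Measurable fun q : ℝ × ℝ => arcKernel p l q.1 q.2 := by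
  unfold arcKernel
  refine Measurable.ite ?_ (by fun_prop) measurable_const
  exact (measurableSet_lt measurable_fst measurable_snd).inter
    (measurableSet_lt measurable_const (measurable_fst.mul measurable_snd))

lemma measurable_rawDensity (p l : ℝ) : Measurable (rawDensity p l) := by
  unfold rawDensity
  exact (measurable_arcKernel p l).lintegral_prod_left'

lemma lintegral_comp_inv_real (f : ℝ → ℝ≥0∞) :
    ∫⁻ x, f x = ∫⁻ q, ENNReal.ofReal ((q ^ 2)⁻¹) * f q⁻¹ := by
  have h := lintegral_image_eq_lintegral_abs_deriv_mul (s := {0}ᶜ) (f := fun r : ℝ => r⁻¹)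
    (f' := fun r => -(r ^ 2)⁻¹) (measurableSet_singleton 0).compl
    (fun r hr => (hasDerivAt_inv hr).hasDerivWithinAt)
    (fun a _ b _ hab => inv_injective hab) f
  have him : (fun r : ℝ => r⁻¹) '' {0}ᶜ = {0}ᶜ := by
    ext x
    simp only [Set.mem_image, Set.mem_compl_iff, Set.mem_singleton_iff]
    exact ⟨by rintro ⟨y, hy, rfl⟩; exact inv_ne_zero hy, fun hx => ⟨x⁻¹, inv_ne_zero hx, inv_inv x⟩⟩
  rw [him, restrict_compl_singleton] at h
  rw [h]
  refine lintegral_congr fun q => ?_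
  rw [abs_neg, abs_of_nonneg (by positivity)]

lemma lintegral_Iio_eq_Ioi (f : ℝ → ℝ≥0∞) :
    ∫⁻ x in Set.Iio (0 : ℝ), f x = ∫⁻ x in Set.Ioi (0 : ℝ), f (-x) := by
  have h := lintegral_image_eq_lintegral_abs_deriv_mul (s := Set.Ioi (0 : ℝ)) (f := fun r : ℝ => -r)
    (f' := fun _ => -1) measurableSet_Ioi (fun r _ => (hasDerivAt_neg r).hasDerivWithinAt)
    (fun a _ b _ hab => neg_injective hab) f
  have him : (fun r : ℝ => -r) '' Set.Ioi 0 = Set.Iio 0 := by simp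
  rw [him] at h
  rw [h]
  simp

/-- The total mass of the unnormalised density is Nicholson's integral: the contributions of the two
half-lines combine to an integral over the quadrant `t, w > 0`, in which `t = w m`. -/
theorem lintegral_rawDensity (p : ℝ) {l : ℝ} (hl : 0 < l) :
    ∫⁻ w, rawDensity p l w = nicholson p (l ^ 2) (-1) := by
  have hmk := measurable_arcKernel p l
  have hsec : ∀ w, Measurable fun t => arcKernel p l t w := fun w =>
    hmk.comp (measurable_id.prodMk measurable_const)
  have hsplit : ∫⁻ w, rawDensity p l w =
      ∫⁻ w in Set.Ioi (0 : ℝ), (rawDensity p l w + rawDensity p l (-w)) := by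
    rw [← lintegral_add_compl _ (measurableSet_Ioi (a := (0 : ℝ))), Set.compl_Ioi,
      lintegral_add_left (measurable_rawDensity p l), ← lintegral_Iio_eq_Ioi (rawDensity p l),
      setLIntegral_congr Iio_ae_eq_Iic]
  rw [hsplit]
  have step1 : ∀ w ∈ Set.Ioi (0 : ℝ), rawDensity p l w + rawDensity p l (-w) =
      ∫⁻ m in Set.Ioi (0 : ℝ), ENNReal.ofReal (m ^ (p - 1) * w⁻¹ *
        Real.exp (-(l * |1 - m| * (w + 1 / (m * w))))) := by
    intro w hw
    have hw : 0 < w := hw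
    unfold rawDensity
    rw [← lintegral_neg_eq_self (fun t => arcKernel p l t (-w)), ← lintegral_add_left (hsec w)]
    have h1 : ∫⁻ t, arcKernel p l t w + arcKernel p l (-t) (-w) =
        ∫⁻ t in Set.Ioi (0 : ℝ), ENNReal.ofReal (w ^ (-p - 1) * t ^ (p - 1) *
          Real.exp (-(l * |w - t| * (1 + 1 / (t * w))))) := by
      rw [← lintegral_indicator measurableSet_Ioi]
      have hne : ∀ᵐ t : ℝ, t ≠ w := by simp [ae_iff]
      refine lintegral_congr_ae ?_
      filter_upwards [hne] with t ht
      unfold arcKernel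
      by_cases ht0 : 0 < t
      · rw [Set.indicator_of_mem (by exact ht0)]
        rcases lt_or_gt_of_ne ht with h | h
        · rw [if_pos ⟨h, by positivity⟩, if_neg (by rintro ⟨h', _⟩; linarith), add_zero,
            abs_of_pos hw, abs_of_pos ht0, abs_of_pos (by linarith)]
          congr 3
          field_simp
          ring
        · rw [if_neg (by rintro ⟨h', _⟩; linarith), if_pos ⟨by linarith, by nlinarith⟩, zero_add,
            abs_neg, abs_neg, abs_of_pos hw, abs_of_pos ht0, abs_of_neg (by linarith)]
          congr 3
          field_simp
          ring
      · rw [Set.indicator_of_notMem (by simpa using ht0)]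
        have h2 : ¬ 0 < t * w := by
          push Not at ht0 ⊢
          exact mul_nonpos_of_nonpos_of_nonneg ht0 hw.le
        rw [if_neg (fun h => h2 h.2), if_neg (fun h => h2 (by simpa using h.2)), add_zero]
    rw [h1, lintegral_Ioi_comp_mul hw]
    refine setLIntegral_congr_fun measurableSet_Ioi fun m hm => ?_
    have hm : 0 < m := hm
    rw [← ENNReal.ofReal_mul hw.le]
    congr 1
    have e1 : l * |w - w * m| * (1 + 1 / (w * m * w)) = l * |1 - m| * (w + 1 / (m * w)) := by
      have : w - w * m = w * (1 - m) := by ring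
      rw [this, abs_mul, abs_of_pos hw]
      field_simp
    have e2 : w ^ (-p - 1) * (w * m) ^ (p - 1) * w = m ^ (p - 1) * w⁻¹ := by
      rw [Real.mul_rpow hw.le hm.le]
      have : w ^ (-p - 1) * w ^ (p - 1) * w = w⁻¹ := by
        rw [← Real.rpow_add hw, ← Real.rpow_add_one hw.ne', ← Real.rpow_neg_one]
        congr 1; ring
      rw [← this]; ring
    rw [e1, ← e2]
    ring
  rw [setLIntegral_congr_fun measurableSet_Ioi step1, lintegral_lintegral_swap (by fun_prop)]
  unfold nicholson
  have hne : ∀ᵐ m ∂volume.restrict (Set.Ioi (0 : ℝ)), m ≠ 1 :=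
    ae_restrict_of_ae (by simp [ae_iff])
  refine lintegral_congr_ae ?_
  filter_upwards [ae_restrict_mem measurableSet_Ioi, hne] with m hm hm1
  have hm : 0 < m := hm
  have ha : 0 < |1 - m| := abs_pos.2 (sub_ne_zero.2 (Ne.symm hm1))
  -- this scaling of `w` turns the term in `1 / w` into `1 / r`
  rw [lintegral_Ioi_comp_mul (c := l * |1 - m| / m) (by positivity)]
  refine setLIntegral_congr_fun measurableSet_Ioi fun r hr => ?_
  have hr : 0 < r := hr
  rw [← ENNReal.ofReal_mul (by positivity)]
  congr 1
  have e1 : l * |1 - m| * (l * |1 - m| / m * r + 1 / (m * (l * |1 - m| / m * r))) =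
      l ^ 2 * r * (m + m⁻¹ + 2 * (-1)) + r⁻¹ := by
    have h2 : |1 - m| * |1 - m| = (1 - m) ^ 2 := by rw [← sq, sq_abs]
    have h3 : l * |1 - m| * (l * |1 - m| / m * r) = l ^ 2 * r * (m + m⁻¹ + 2 * (-1)) := by
      calc l * |1 - m| * (l * |1 - m| / m * r) = l ^ 2 * r * (|1 - m| * |1 - m|) / m := by ring
        _ = _ := by rw [h2]; field_simp; ring
    rw [mul_add, h3]
    congr 1
    field_simp
  rw [e1, neg_add, ← sub_eq_add_neg]
  field_simp

/-! ### Invariance of the density -/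

lemma lt_iff_inv {a b : ℝ} (ha : a ≠ 0) (hb : b ≠ 0) :
    a < b ↔ (0 < a⁻¹ ∧ 0 < b⁻¹ ∧ b⁻¹ < a⁻¹) ∨ (a⁻¹ < 0 ∧ b⁻¹ < 0 ∧ b⁻¹ < a⁻¹) ∨
      (a⁻¹ < 0 ∧ 0 < b⁻¹) := by
  rcases lt_or_gt_of_ne ha with ha | ha <;> rcases lt_or_gt_of_ne hb with hb | hb
  · have h1 := inv_lt_zero.2 ha
    have h2 := inv_lt_zero.2 hb
    have h3 := inv_lt_inv_of_neg hb ha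
    simp only [h1, h2, h3, not_lt.2 h1.le, not_lt.2 h2.le]; simp
  · have h1 := inv_lt_zero.2 ha
    have h2 := inv_pos.2 hb
    simp only [h1, h2, ha.trans hb, not_lt.2 h1.le]; simp
  · have h1 := inv_pos.2 ha
    have h2 := inv_lt_zero.2 hb
    simp only [h1, h2, not_lt.2 h1.le, not_lt.2 h2.le, not_lt.2 (hb.trans ha).le]; simp
  · have h1 := inv_pos.2 ha
    have h2 := inv_pos.2 hb
    have h3 := inv_lt_inv₀ hb ha
    simp only [h1, h2, h3, not_lt.2 h1.le, not_lt.2 h2.le]; simp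

/-- The substitution `1 / w = 1 / t + 1 / u - 1 / v` exchanges two configurations of points on the
projective line. -/
lemma arc_order_iff {t u v w : ℝ} (ht : t ≠ 0) (hu : u ≠ 0) (hv : v ≠ 0) (hw : w ≠ 0)
    (h : w⁻¹ = t⁻¹ + u⁻¹ - v⁻¹) :
    ((t < w ∧ 0 < t * w) ∧ w < u) ↔ ((v < u ∧ 0 < u * v) ∧ t < v) := by
  have e1 : (0 < t * w) ↔ (0 < t⁻¹ ∧ 0 < w⁻¹) ∨ (t⁻¹ < 0 ∧ w⁻¹ < 0) := by
    simp only [inv_pos, inv_lt_zero, mul_pos_iff]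
  have e2 : (0 < u * v) ↔ (0 < u⁻¹ ∧ 0 < v⁻¹) ∨ (u⁻¹ < 0 ∧ v⁻¹ < 0) := by
    simp only [inv_pos, inv_lt_zero, mul_pos_iff]
  rw [e1, e2, lt_iff_inv ht hw, lt_iff_inv hw hu, lt_iff_inv hv hu, lt_iff_inv ht hv]
  have ht' := inv_ne_zero ht
  have hu' := inv_ne_zero hu
  have hv' := inv_ne_zero hv
  have hw' := inv_ne_zero hw
  generalize t⁻¹ = a at *
  generalize u⁻¹ = b at *
  generalize v⁻¹ = c at *
  generalize w⁻¹ = d at *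
  subst h
  constructor
  · intro h
    grind
  · intro h
    grind

/-- The integrand that `arcKernel` turns into under inversion. -/
noncomputable def arcKernelInv (p l u v : ℝ) : ℝ≥0∞ :=
  if v < u ∧ 0 < u * v then
    ENNReal.ofReal (|u| ^ (p - 1) * |v| ^ (-p - 1) * Real.exp (l * (1 / u - u - 1 / v + v)))
  else 0

lemma measurable_arcKernelInv (p l u : ℝ) : Measurable (arcKernelInv p l u) := by
  unfold arcKernelInv
  refine Measurable.ite ?_ (by fun_prop) measurable_const
  exact (measurableSet_lt measurable_id measurable_const).inter
    (measurableSet_lt measurable_const (measurable_const.mul measurable_id))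

lemma measurable_gammaPDF (p l : ℝ) : Measurable (gammaPDF p l) :=
  (measurable_gammaPDFReal p l).ennreal_ofReal

/-- The substitution `1 / w = 1 / t + 1 / u - 1 / v` carries the gamma factor in `u - w` over to one in
`v - t`, because `(u - w) / (u w) = (v - t) / (v t)`. -/
lemma gammaPDF_mul_arcKernel {p l t u v w : ℝ} (hp : 0 < p) (hl : 0 < l) (ht : t ≠ 0) (hu : u ≠ 0)
    (hv : v ≠ 0) (hw : w ≠ 0) (hvt : v ≠ t) (h : w⁻¹ = t⁻¹ + u⁻¹ - v⁻¹) :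
    ENNReal.ofReal ((v ^ 2)⁻¹) * (ENNReal.ofReal (w ^ 2) *
      (gammaPDF p l (u - w) * arcKernel p l t w)) =
      gammaPDF p l (v - t) * arcKernelInv p l u v := by
  have hiff := arc_order_iff ht hu hv hw h
  have hwu : w ≠ u := by
    rintro rfl
    have : t⁻¹ = v⁻¹ := by linarith
    exact hvt (inv_injective this).symm
  by_cases hA : (t < w ∧ 0 < t * w) ∧ w < u
  · have hB := hiff.1 hA
    unfold arcKernel arcKernelInv
    rw [if_pos hA.1, if_pos hB.1, gammaPDF_of_nonneg (by linarith [hA.2]),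
      gammaPDF_of_nonneg (by linarith [hB.2])]
    have h1 : 0 < u - w := by linarith [hA.2]
    have h2 : 0 < v - t := by linarith [hB.2]
    have hG := Real.Gamma_pos_of_pos hp
    have aw := abs_pos.2 hw
    have au := abs_pos.2 hu
    have av := abs_pos.2 hv
    have at' := abs_pos.2 ht
    rw [← ENNReal.ofReal_mul (by positivity), ← ENNReal.ofReal_mul (by positivity),
      ← ENNReal.ofReal_mul (by positivity), ← ENNReal.ofReal_mul (by positivity)]
    congr 1
    have e0 : u - w = |u| * |w| * (v - t) / (|t| * |v|) := by
      have e : u - w = u * w * (v - t) / (t * v) := by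
        have : w⁻¹ - u⁻¹ = t⁻¹ - v⁻¹ := by linarith
        field_simp at this ⊢
        linarith
      rw [← abs_of_pos h1, e, abs_div, abs_mul, abs_mul, abs_mul, abs_of_pos h2]
    have e1 : (u - w) ^ (p - 1) =
        |u| ^ (p - 1) * |w| ^ (p - 1) * (v - t) ^ (p - 1) / (|t| ^ (p - 1) * |v| ^ (p - 1)) := by
      rw [e0, Real.div_rpow (by positivity) (by positivity), Real.mul_rpow (by positivity) h2.le,
        Real.mul_rpow au.le aw.le, Real.mul_rpow at'.le av.le]
    have e2 : |w| ^ (-p - 1) * |w| ^ (p - 1) * w ^ 2 = 1 := by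
      rw [← Real.rpow_add aw, ← sq_abs w, ← Real.rpow_natCast, ← Real.rpow_add aw]
      have : -p - 1 + (p - 1) + ((2 : ℕ) : ℝ) = 0 := by push_cast; ring
      rw [this, Real.rpow_zero]
    have e3 : |v| ^ (-p - 1) = (v ^ 2)⁻¹ / |v| ^ (p - 1) := by
      rw [eq_div_iff (by positivity), ← Real.rpow_add av, ← sq_abs v, ← Real.rpow_natCast,
        ← Real.rpow_neg av.le]
      congr 1; push_cast; ring
    have e4 : Real.exp (-(l * (u - w))) * Real.exp (l * (1 / w - w - 1 / t + t)) =
        Real.exp (-(l * (v - t))) * Real.exp (l * (1 / u - u - 1 / v + v)) := by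
      rw [← Real.exp_add, ← Real.exp_add]
      congr 1
      simp only [one_div]
      linear_combination l * h
    rw [e1, e3]
    have ptw : 0 < |t| ^ (p - 1) := by positivity
    have pvw : 0 < |v| ^ (p - 1) := by positivity
    calc _ = (l ^ p / Real.Gamma p) * (|u| ^ (p - 1) * (v - t) ^ (p - 1) *
          ((v ^ 2)⁻¹ / |v| ^ (p - 1))) * (|w| ^ (-p - 1) * |w| ^ (p - 1) * w ^ 2) *
          (Real.exp (-(l * (u - w))) * Real.exp (l * (1 / w - w - 1 / t + t))) := by
            field_simp
      _ = _ := by rw [e2, e4]; ring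
  · have hB := fun hB => hA (hiff.2 hB)
    have z1 : gammaPDF p l (u - w) * arcKernel p l t w = 0 := by
      by_cases h1 : t < w ∧ 0 < t * w
      · have : u - w < 0 := by
          have h2 : ¬ w < u := fun h2 => hA ⟨h1, h2⟩
          have := lt_of_le_of_ne (not_lt.1 h2) (Ne.symm hwu)
          linarith
        rw [gammaPDF_of_neg this, zero_mul]
      · unfold arcKernel; rw [if_neg h1, mul_zero]
    have z2 : gammaPDF p l (v - t) * arcKernelInv p l u v = 0 := by
      by_cases h1 : v < u ∧ 0 < u * v
      · have : v - t < 0 := by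
          have h2 : ¬ t < v := fun h2 => hB ⟨h1, h2⟩
          have := lt_of_le_of_ne (not_lt.1 h2) hvt
          linarith
        rw [gammaPDF_of_neg this, zero_mul]
      · unfold arcKernelInv; rw [if_neg h1, mul_zero]
    rw [z1, z2, mul_zero, mul_zero]

/-- Convolution with the gamma density acts on the density as the inversion `u ↦ -1 / u`. Under
`1 / w = 1 / t + 1 / u - 1 / v` the gamma factor of the convolution is moved to the variable `t`,
over which it integrates to one. -/
theorem lintegral_gammaPDF_mul_rawDensity {p l u : ℝ} (hp : 0 < p) (hl : 0 < l) (hu : u ≠ 0) :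
    ∫⁻ a, gammaPDF p l a * rawDensity p l (u - a) =
      ENNReal.ofReal ((u ^ 2)⁻¹) * rawDensity p l (-u⁻¹) := by
  have hg := measurable_gammaPDF p l
  have hk := measurable_arcKernel p l
  have hsec : ∀ w, Measurable fun t => arcKernel p l t w := fun w =>
    hk.comp (measurable_id.prodMk measurable_const)
  have hsec' : ∀ t, Measurable fun w => arcKernel p l t w := fun t =>
    hk.comp (measurable_const.prodMk measurable_id)
  have hki := measurable_arcKernelInv p l u
  have h1 : ∫⁻ a, gammaPDF p l a * rawDensity p l (u - a) =
      ∫⁻ w, ∫⁻ t, gammaPDF p l (u - w) * arcKernel p l t w := by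
    rw [← lintegral_sub_left_eq_self _ u]
    refine lintegral_congr fun w => ?_
    rw [sub_sub_cancel, lintegral_const_mul _ (hsec w)]
    rfl
  have hswap1 : AEMeasurable (Function.uncurry fun w t : ℝ =>
      gammaPDF p l (u - w) * arcKernel p l t w) (volume.prod volume) :=
    ((hg.comp (measurable_const.sub measurable_fst)).mul
      (hk.comp (measurable_snd.prodMk measurable_fst))).aemeasurable
  rw [h1, lintegral_lintegral_swap hswap1]
  have h2 : ∀ t : ℝ, t ≠ 0 → ∫⁻ w, gammaPDF p l (u - w) * arcKernel p l t w =
      ∫⁻ v, gammaPDF p l (v - t) * arcKernelInv p l u v := by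
    intro t ht
    -- the substitution `1 / w = 1 / t + 1 / u - 1 / v`: an inversion, a reflection, an inversion
    rw [lintegral_comp_inv_real, ← lintegral_sub_left_eq_self _ (t⁻¹ + u⁻¹), lintegral_comp_inv_real]
    have n1 : ∀ᵐ v : ℝ, v ≠ 0 := by simp [ae_iff]
    have n2 : ∀ᵐ v : ℝ, v ≠ t := by simp [ae_iff]
    have n3 : ∀ᵐ v : ℝ, v ≠ (t⁻¹ + u⁻¹)⁻¹ := by simp [ae_iff]
    refine lintegral_congr_ae ?_
    filter_upwards [n1, n2, n3] with v hv hvt hv3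
    have hq : t⁻¹ + u⁻¹ - v⁻¹ ≠ 0 := by
      intro h0
      apply hv3
      have : t⁻¹ + u⁻¹ = v⁻¹ := by linarith
      rw [this, inv_inv]
    rw [← gammaPDF_mul_arcKernel hp hl ht hu hv (inv_ne_zero hq) hvt (inv_inv _), inv_pow]
  have h3 : ∫⁻ t, ∫⁻ w, gammaPDF p l (u - w) * arcKernel p l t w =
      ∫⁻ t, ∫⁻ v, gammaPDF p l (v - t) * arcKernelInv p l u v := by
    have n1 : ∀ᵐ t : ℝ, t ≠ 0 := by simp [ae_iff]
    refine lintegral_congr_ae ?_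
    filter_upwards [n1] with t ht
    exact h2 t ht
  have hswap2 : AEMeasurable (Function.uncurry fun t v : ℝ =>
      gammaPDF p l (v - t) * arcKernelInv p l u v) (volume.prod volume) :=
    ((hg.comp (measurable_snd.sub measurable_fst)).mul (hki.comp measurable_snd)).aemeasurable
  rw [h3, lintegral_lintegral_swap hswap2]
  have h4 : ∀ v : ℝ, ∫⁻ t, gammaPDF p l (v - t) * arcKernelInv p l u v = arcKernelInv p l u v := by
    intro v
    have hm : Measurable fun t => gammaPDF p l (v - t) := hg.comp (measurable_const.sub measurable_id)
    rw [lintegral_mul_const _ hm, lintegral_sub_left_eq_self (gammaPDF p l) v,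
      lintegral_gammaPDF_eq_one hp hl, one_mul]
  simp_rw [h4]
  rw [lintegral_comp_inv_real, ← lintegral_neg_eq_self]
  unfold rawDensity
  rw [← lintegral_const_mul _ (hsec _)]
  have n1 : ∀ᵐ t : ℝ, t ≠ 0 := by simp [ae_iff]
  refine lintegral_congr_ae ?_
  filter_upwards [n1] with t ht
  have hcond : ((-t)⁻¹ < u ∧ 0 < u * (-t)⁻¹) ↔ (t < -u⁻¹ ∧ 0 < t * (-u⁻¹)) := by
    rw [inv_neg]
    rcases lt_or_gt_of_ne ht with h | h <;> rcases lt_or_gt_of_ne hu with h' | h'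
    · have a1 := inv_lt_zero.2 h
      have a2 := inv_lt_zero.2 h'
      constructor
      · rintro ⟨b1, b2⟩; nlinarith
      · rintro ⟨b1, b2⟩; nlinarith
    · have a1 := inv_lt_zero.2 h
      have a2 := inv_pos.2 h'
      refine and_congr ?_ ⟨fun _ => by nlinarith, fun _ => by nlinarith⟩
      rw [← inv_neg, ← inv_neg, inv_lt_comm₀ (by linarith) h', ← neg_lt_neg_iff, neg_neg, ← inv_neg]
    · have a1 := inv_pos.2 h
      have a2 := inv_lt_zero.2 h'
      refine and_congr ?_ ⟨fun _ => by nlinarith, fun _ => by nlinarith⟩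
      rw [(neg_inv : -u⁻¹ = (-u)⁻¹), lt_inv_comm₀ h (by linarith), ← neg_lt_neg_iff, neg_neg]
    · have a1 := inv_pos.2 h
      have a2 := inv_pos.2 h'
      constructor
      · rintro ⟨b1, b2⟩; nlinarith
      · rintro ⟨b1, b2⟩; nlinarith
  unfold arcKernelInv arcKernel
  by_cases hc : t < -u⁻¹ ∧ 0 < t * (-u⁻¹)
  · rw [if_pos hc, if_pos (hcond.2 hc)]
    have at' := abs_pos.2 ht
    have au := abs_pos.2 hu
    rw [← ENNReal.ofReal_mul (by positivity), ← ENNReal.ofReal_mul (by positivity)]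
    congr 1
    have key : ∀ x : ℝ, 0 < |x| → (x ^ 2)⁻¹ * |x|⁻¹ ^ (-p - 1) = |x| ^ (p - 1) := by
      intro x hx
      rw [Real.inv_rpow hx.le, ← Real.rpow_neg hx.le, ← sq_abs x, ← Real.rpow_natCast,
        ← Real.rpow_neg hx.le, ← Real.rpow_add hx]
      congr 1; push_cast; ring
    have k1 := key t at'
    have k2 := key u au
    have e1 : |(-t)⁻¹| = |t|⁻¹ := by rw [abs_inv, abs_neg]
    have e2 : |-u⁻¹| = |u|⁻¹ := by rw [abs_neg, abs_inv]
    have e3 : 1 / u - u - 1 / (-t)⁻¹ + (-t)⁻¹ = 1 / (-u⁻¹) - -u⁻¹ - 1 / t + t := by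
      field_simp
      ring
    rw [e1, e2, e3]
    have : (-t) ^ 2 = t ^ 2 := by ring
    rw [this]
    linear_combination (|u| ^ (p - 1) * Real.exp (l * (1 / (-u⁻¹) - -u⁻¹ - 1 / t + t))) * k1 -
      (|t| ^ (p - 1) * Real.exp (l * (1 / (-u⁻¹) - -u⁻¹ - 1 / t + t))) * k2
  · rw [if_neg hc, if_neg (fun h => hc (hcond.1 h)), mul_zero, mul_zero]

/-! ### Regularity and asymptotics of the density -/

lemma innerIntegrand_neg_sign (p s t : ℝ) : innerIntegrand p s (-1) t = innerIntegrand p s 1 (-t) := by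
  unfold innerIntegrand
  rw [abs_neg]
  congr 2
  rw [one_div_neg_eq_neg_one_div]
  ring

lemma integrationRange_neg_sign {y : ℝ} (hy : y ≠ 0) :
    integrationRange (-1) y = Neg.neg ⁻¹' integrationRange 1 (-y) := by
  unfold integrationRange
  rw [if_neg (by norm_num), if_pos one_pos]
  rcases lt_or_gt_of_ne hy with h | h
  · rw [if_neg (not_lt.2 h.le), if_pos (by linarith)]
    ext t; simp
  · rw [if_pos h, if_neg (by linarith)]
    ext t; simp

lemma axisDensity_neg_sign (p s y : ℝ) (hp : 0 < p) :
    axisDensity p s (-1) y = axisDensity p s 1 (-y) := by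
  unfold axisDensity
  by_cases hy : y = 0
  · subst hy
    simp [Real.zero_rpow (by linarith : p + 1 ≠ 0)]
  · rw [abs_neg]
    congr 1
    · congr 2
      rw [one_div_neg_eq_neg_one_div]; ring
    · rw [integrationRange_neg_sign hy]
      simp_rw [innerIntegrand_neg_sign]
      exact ((Measure.measurePreserving_neg volume).setIntegral_preimage_emb
        (MeasurableEquiv.neg ℝ).measurableEmbedding _ _)

lemma integrableOn_innerIntegrand_neg_sign {p s y : ℝ} (hy : y ≠ 0)
    (h : IntegrableOn (innerIntegrand p s 1) (integrationRange 1 (-y))) :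
    IntegrableOn (innerIntegrand p s (-1)) (integrationRange (-1) y) := by
  rw [integrationRange_neg_sign hy]
  have h1 : innerIntegrand p s (-1) = innerIntegrand p s 1 ∘ Neg.neg := by
    ext t; exact innerIntegrand_neg_sign p s t
  rw [h1]
  exact ((Measure.measurePreserving_neg volume).integrableOn_comp_preimage
    (MeasurableEquiv.neg ℝ).measurableEmbedding).2 h

lemma measurable_innerIntegrand (p s σ : ℝ) : Measurable (innerIntegrand p s σ) := by
  unfold innerIntegrand; fun_prop

lemma innerIntegrand_pos (p s σ : ℝ) {t : ℝ} (ht : t ≠ 0) : 0 < innerIntegrand p s σ t := by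
  unfold innerIntegrand
  have := abs_pos.2 ht
  positivity

lemma innerIntegrand_nonneg (p s σ t : ℝ) : 0 ≤ innerIntegrand p s σ t := by
  unfold innerIntegrand
  positivity

lemma innerIntegrand_one_eq (p s t : ℝ) : innerIntegrand p s 1 t =
    Real.exp (-(1 / s * (1 / t))) * (Real.exp (t / s) * |t| ^ (p - 1)) := by
  unfold innerIntegrand
  have h : Real.exp (-1 * (1 / s * (1 / t - t))) =
      Real.exp (-(1 / s * (1 / t))) * Real.exp (t / s) := by
    rw [← Real.exp_add]
    congr 1
    ring
  rw [h, mul_assoc]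

lemma integrationRange_one_pos {y : ℝ} (hy : 0 < y) : integrationRange 1 y = Set.Ioc 0 y := by
  simp [integrationRange, hy]

lemma integrationRange_one_neg {y : ℝ} (hy : y < 0) : integrationRange 1 y = Set.Iic y := by
  simp [integrationRange, not_lt.2 hy.le]

lemma integrableOn_innerIntegrand {p s y : ℝ} (hp : 0 < p) (hs : 0 < s) (hy : y ≠ 0) :
    IntegrableOn (innerIntegrand p s 1) (integrationRange 1 y) := by
  rcases lt_or_gt_of_ne hy with h | h
  · rw [integrationRange_one_neg h]
    have hG : IntegrableOn (fun x : ℝ => x ^ (p - 1) * Real.exp (-(1 / s * x))) (Set.Ioi 0) := by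
      have h1 := integrableOn_rpow_mul_exp_neg_mul_rpow (p := 1) (s := p - 1) (b := 1 / s)
        (by linarith) one_pos (by positivity)
      refine h1.congr_fun (fun x _ => ?_) measurableSet_Ioi
      simp
    have hG2 : IntegrableOn (fun x : ℝ => (-x) ^ (p - 1) * Real.exp (-(1 / s * (-x)))) (Set.Iio 0) := by
      have := ((Measure.measurePreserving_neg volume).integrableOn_comp_preimage
        (MeasurableEquiv.neg ℝ).measurableEmbedding).2 hG
      simpa [Function.comp_def] using this
    have hG3 := (hG2.mono_set (Set.Iic_subset_Iio.2 h)).const_mul (Real.exp (1 / s * (1 / (-y))))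
    refine Integrable.mono' hG3 (measurable_innerIntegrand p s 1).aestronglyMeasurable ?_
    filter_upwards [ae_restrict_mem measurableSet_Iic] with t ht
    have ht : t ≤ y := ht
    rw [Real.norm_of_nonneg (innerIntegrand_nonneg _ _ _ _), innerIntegrand_one_eq,
      abs_of_neg (by linarith)]
    have e1 : -(1 / s * (1 / t)) ≤ 1 / s * (1 / (-y)) := by
      have : 1 / (-t) ≤ 1 / (-y) := one_div_le_one_div_of_le (by linarith) (by linarith)
      have h2 : -(1 / s * (1 / t)) = 1 / s * (1 / (-t)) := by rw [one_div_neg_eq_neg_one_div]; ring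
      rw [h2]
      gcongr
    have e2 : -(1 / s * -t) = t / s := by ring
    have e3 : 0 ≤ (-t) ^ (p - 1) := Real.rpow_nonneg (by linarith) _
    rw [e2, mul_comm ((-t) ^ (p - 1))]
    gcongr
  · rw [integrationRange_one_pos h]
    have h1 : IntegrableOn (fun x : ℝ => x ^ (p - 1)) (Set.Ioc 0 y) := by
      have := intervalIntegral.intervalIntegrable_rpow' (a := 0) (b := y) (by linarith : -1 < p - 1)
      rwa [intervalIntegrable_iff_integrableOn_Ioc_of_le h.le] at this
    have h2 := h1.const_mul (Real.exp (y / s))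
    refine Integrable.mono' h2 (measurable_innerIntegrand p s 1).aestronglyMeasurable ?_
    filter_upwards [ae_restrict_mem measurableSet_Ioc] with t ht
    have ht0 : 0 < t := ht.1
    rw [Real.norm_of_nonneg (innerIntegrand_nonneg _ _ _ _), innerIntegrand_one_eq, abs_of_pos ht0]
    have e1 : Real.exp (-(1 / s * (1 / t))) ≤ 1 := by
      rw [Real.exp_le_one_iff]
      have : 0 < 1 / s * (1 / t) := by positivity
      linarith
    have e2 : Real.exp (t / s) ≤ Real.exp (y / s) := by
      gcongr
      exact ht.2
    calc _ ≤ 1 * (Real.exp (t / s) * t ^ (p - 1)) := by gcongr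
      _ ≤ _ := by rw [one_mul]; gcongr

/-- The inner integral of the density, for the sign `+`. -/
noncomputable def innerIntegral (p s y : ℝ) : ℝ :=
  ∫ t in integrationRange 1 y, innerIntegrand p s 1 t

lemma innerIntegral_pos {p s y : ℝ} (hp : 0 < p) (hs : 0 < s) (hy : y ≠ 0) :
    0 < innerIntegral p s y := by
  unfold innerIntegral
  rw [setIntegral_pos_iff_support_of_nonneg_ae
    (Eventually.of_forall fun t => innerIntegrand_nonneg _ _ _ _)
    (integrableOn_innerIntegrand hp hs hy)]
  rcases lt_or_gt_of_ne hy with h | h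
  · rw [integrationRange_one_neg h]
    have : Function.support (innerIntegrand p s 1) ∩ Set.Iic y = Set.Iic y := by
      refine Set.inter_eq_right.2 fun t ht => ?_
      have ht : t ≤ y := ht
      exact (innerIntegrand_pos p s 1 (by linarith : t < 0).ne).ne'
    rw [this]; simp
  · rw [integrationRange_one_pos h]
    have : Function.support (innerIntegrand p s 1) ∩ Set.Ioc 0 y = Set.Ioc 0 y :=
      Set.inter_eq_right.2 fun t ht => (innerIntegrand_pos p s 1 ht.1.ne').ne'
    rw [this]; simpa using h

lemma continuousAt_innerIntegrand (p s σ : ℝ) {y : ℝ} (hy : y ≠ 0) :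
    ContinuousAt (innerIntegrand p s σ) y := by
  unfold innerIntegrand
  have h1 : ContinuousAt (fun t : ℝ => |t| ^ (p - 1)) y :=
    continuous_abs.continuousAt.rpow_const (Or.inl (abs_pos.2 hy).ne')
  have h2 : ContinuousAt (fun t : ℝ => 1 / t) y := continuousAt_const.div continuousAt_id hy
  fun_prop

lemma hasDerivAt_innerIntegral {p s y : ℝ} (hp : 0 < p) (hs : 0 < s) (hy : y ≠ 0) :
    HasDerivAt (innerIntegral p s) (innerIntegrand p s 1 y) y := by
  have hm : StronglyMeasurableAtFilter (innerIntegrand p s 1) (𝓝 y) volume :=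
    (measurable_innerIntegrand p s 1).stronglyMeasurable.stronglyMeasurableAtFilter
  have hc := continuousAt_innerIntegrand p s 1 hy
  rcases lt_or_gt_of_ne hy with h | h
  · have h1 := (intervalIntegral.integral_hasDerivAt_right
      (IntervalIntegrable.refl (f := innerIntegrand p s 1) (a := y)) hm hc).const_add
      (innerIntegral p s y)
    refine h1.congr_of_eventuallyEq ?_
    filter_upwards [Iio_mem_nhds h] with z hz
    have hz : z < 0 := hz
    have i1 := integrableOn_innerIntegrand hp hs hz.ne
    have i2 := integrableOn_innerIntegrand hp hs hy
    unfold innerIntegral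
    rw [integrationRange_one_neg hz] at i1 ⊢
    rw [integrationRange_one_neg h] at i2 ⊢
    rw [← intervalIntegral.integral_Iic_sub_Iic i2 i1]
    ring
  · have i2 := integrableOn_innerIntegrand hp hs hy
    rw [integrationRange_one_pos h] at i2
    have h1 := intervalIntegral.integral_hasDerivAt_right (a := 0)
      ((intervalIntegrable_iff_integrableOn_Ioc_of_le h.le).2 i2) hm hc
    refine h1.congr_of_eventuallyEq ?_
    filter_upwards [Ioi_mem_nhds h] with z hz
    have hz : 0 < z := hz
    unfold innerIntegral
    rw [integrationRange_one_pos hz, intervalIntegral.integral_of_le hz.le]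

lemma hasDerivAt_abs_rpow_of_ne (q : ℝ) {y : ℝ} (hy : y ≠ 0) :
    HasDerivAt (fun t : ℝ => |t| ^ q) (|y| ^ q * (q / y)) y := by
  have h := (hasDerivAt_abs hy).rpow_const (p := q) (Or.inl (abs_pos.2 hy).ne')
  refine h.congr_deriv ?_
  rw [Real.rpow_sub_one (abs_pos.2 hy).ne']
  rcases lt_or_gt_of_ne hy with h | h
  · rw [abs_of_neg h, sign_neg h]
    field_simp
    simp
  · rw [abs_of_pos h, sign_pos h]
    field_simp
    simp

lemma hasDerivAt_innerIntegrand (p s : ℝ) {y : ℝ} (hy : y ≠ 0) :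
    HasDerivAt (innerIntegrand p s 1)
      (innerIntegrand p s 1 y * ((p - 1) / y + 1 / s * (1 / y ^ 2 + 1))) y := by
  have h1 : HasDerivAt (fun t : ℝ => -1 * (1 / s * (1 / t - t))) (1 / s * (1 / y ^ 2 + 1)) y := by
    have := (((hasDerivAt_inv hy).sub (hasDerivAt_id y)).const_mul (1 / s)).const_mul (-1)
    simp only [one_div] at this ⊢
    refine this.congr_deriv ?_
    ring
  have h2 := h1.exp.mul (hasDerivAt_abs_rpow_of_ne (p - 1) hy)
  refine h2.congr_deriv ?_
  unfold innerIntegrand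
  ring

lemma hasDerivAt_sq_mul_innerIntegrand (p s : ℝ) {y : ℝ} (hy : y ≠ 0) :
    HasDerivAt (fun y => y ^ 2 * innerIntegrand p s 1 y)
      (innerIntegrand p s 1 y * ((p + 1) * y + 1 / s * (1 + y ^ 2))) y := by
  have h := (hasDerivAt_pow 2 y).mul (hasDerivAt_innerIntegrand p s hy)
  refine h.congr_deriv ?_
  field_simp
  ring

lemma axisDensity_one_eq (p s : ℝ) {y : ℝ} (hy : y ≠ 0) :
    axisDensity p s 1 y =
      normConst p s * (innerIntegral p s y / (y ^ 2 * innerIntegrand p s 1 y)) := by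
  unfold axisDensity innerIntegral innerIntegrand
  have hy' := abs_pos.2 hy
  have e1 : |y| ^ (p + 1) = y ^ 2 * |y| ^ (p - 1) := by
    rw [← sq_abs y, ← Real.rpow_natCast, ← Real.rpow_add hy']
    congr 1; push_cast; ring
  have e2 : Real.exp (1 * (1 / s * (1 / y - y))) =
      (Real.exp (-1 * (1 / s * (1 / y - y))))⁻¹ := by
    rw [← Real.exp_neg]; congr 1; ring
  rw [e1, e2]
  have := Real.exp_pos (-1 * (1 / s * (1 / y - y)))
  have : 0 < |y| ^ (p - 1) := by positivity
  have : 0 < y ^ 2 := by positivity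
  rw [one_div, div_eq_mul_inv _ (y ^ 2 * _), mul_inv, mul_inv, mul_inv]
  ring

/-- L'Hôpital's rule for a denominator that tends to infinity at the right end of an interval `S`. -/
lemma lhopital_infty {l : Filter ℝ} {S : Set ℝ} (hS : Convex ℝ S) (hopen : IsOpen S)
    (hl : l.HasBasis (fun y => y ∈ S) fun y => S ∩ Set.Ioi y) {f g f' g' : ℝ → ℝ} {L : ℝ}
    (hf : ∀ y ∈ S, HasDerivAt f (f' y) y) (hg : ∀ y ∈ S, HasDerivAt g (g' y) y)
    (hpos : ∀ᶠ y in l, 0 < g' y) (hlim : Tendsto (fun y => f' y / g' y) l (𝓝 L))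
    (hinf : Tendsto g l atTop) : Tendsto (fun y => f y / g y) l (𝓝 L) := by
  -- beyond some point, `f - (L + ε) g` decreases and `f - (L - ε) g` increases
  have key : ∀ ε > 0, ∃ K : ℝ, ∀ᶠ y in l, |f y - L * g y| ≤ ε * g y + K := by
    intro ε hε
    have h1 : ∀ᶠ y in l, |f' y / g' y - L| < ε := by
      have := hlim.eventually (Metric.ball_mem_nhds L hε)
      simpa [Real.dist_eq] using this
    obtain ⟨y₀, hy₀, hsub⟩ := hl.mem_iff.1 (hpos.and h1)
    have hconv : Convex ℝ (S ∩ Set.Ioi y₀) := hS.inter (convex_Ioi y₀)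
    have hint : interior (S ∩ Set.Ioi y₀) = S ∩ Set.Ioi y₀ :=
      (hopen.inter isOpen_Ioi).interior_eq
    have hneS : ∀ y ∈ S ∩ Set.Ioi y₀, ∀ c : ℝ,
        HasDerivAt (fun y => f y - c * g y) (f' y - c * g' y) y := fun y hy c =>
      (hf y hy.1).sub ((hg y hy.1).const_mul c)
    have hbd : ∀ y ∈ S ∩ Set.Ioi y₀, (L - ε) * g' y ≤ f' y ∧ f' y ≤ (L + ε) * g' y := by
      intro y hy
      obtain ⟨a1, a2⟩ := hsub hy
      have a3 := abs_lt.1 a2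
      have e : f' y = f' y / g' y * g' y := by field_simp
      constructor
      · rw [e]; exact mul_le_mul_of_nonneg_right (by linarith) a1.le
      · rw [e]; exact mul_le_mul_of_nonneg_right (by linarith) a1.le
    have hanti : AntitoneOn (fun y => f y - (L + ε) * g y) (S ∩ Set.Ioi y₀) := by
      refine antitoneOn_of_deriv_nonpos hconv
        (fun y hy => (hneS y hy _).continuousAt.continuousWithinAt)
        (fun y hy => (hneS y (hint ▸ hy) _).differentiableAt.differentiableWithinAt) fun y hy => ?_
      rw [hint] at hy
      rw [(hneS y hy _).deriv]
      linarith [(hbd y hy).2]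
    have hmono : MonotoneOn (fun y => f y - (L - ε) * g y) (S ∩ Set.Ioi y₀) := by
      refine monotoneOn_of_deriv_nonneg hconv
        (fun y hy => (hneS y hy _).continuousAt.continuousWithinAt)
        (fun y hy => (hneS y (hint ▸ hy) _).differentiableAt.differentiableWithinAt) fun y hy => ?_
      rw [hint] at hy
      rw [(hneS y hy _).deriv]
      linarith [(hbd y hy).1]
    by_cases hne : (S ∩ Set.Ioi y₀).Nonempty
    · obtain ⟨y₁, hy₁⟩ := hne
      refine ⟨|f y₁ - (L + ε) * g y₁| + |f y₁ - (L - ε) * g y₁|, ?_⟩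
      filter_upwards [hl.mem_of_mem hy₁.1] with y hy
      have hy' : y ∈ S ∩ Set.Ioi y₀ := ⟨hy.1, Set.mem_Ioi.2 (lt_trans (Set.mem_Ioi.1 hy₁.2) hy.2)⟩
      have b1 := hanti hy₁ hy' (le_of_lt hy.2)
      have b2 := hmono hy₁ hy' (le_of_lt hy.2)
      simp only at b1 b2
      have c1 := le_abs_self (f y₁ - (L + ε) * g y₁)
      have c2 := neg_abs_le (f y₁ - (L - ε) * g y₁)
      have c3 := abs_nonneg (f y₁ - (L + ε) * g y₁)
      have c4 := abs_nonneg (f y₁ - (L - ε) * g y₁)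
      rw [abs_le]
      constructor <;> nlinarith
    · rw [Set.not_nonempty_iff_eq_empty] at hne
      refine ⟨0, ?_⟩
      have := hl.mem_of_mem hy₀
      rw [hne] at this
      filter_upwards [this] with y hy
      exact hy.elim
  rw [Metric.tendsto_nhds]
  intro ε hε
  obtain ⟨K, hK⟩ := key (ε / 2) (by positivity)
  filter_upwards [hK, hinf.eventually_gt_atTop (max 0 (2 * K / ε))] with y hy1 hy2
  have hg0 : 0 < g y := lt_of_le_of_lt (le_max_left _ _) hy2
  have hgK : 2 * K / ε < g y := lt_of_le_of_lt (le_max_right _ _) hy2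
  rw [div_lt_iff₀ hε] at hgK
  rw [Real.dist_eq]
  have e : f y / g y - L = (f y - L * g y) / g y := by field_simp
  rw [e, abs_div, abs_of_pos hg0, div_lt_iff₀ hg0]
  linarith

/-- The limit of the logarithmic derivative of `innerIntegrand p s 1`. -/
lemma tendsto_log_deriv_atTop (p : ℝ) {s : ℝ} :
    Tendsto (fun y : ℝ => (p - 1) / y + 1 / s * (1 / y ^ 2 + 1)) atTop (𝓝 (1 / s)) := by
  have h1 : Tendsto (fun y : ℝ => (p - 1) / y) atTop (𝓝 0) := tendsto_const_nhds.div_atTop tendsto_id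
  have h2 : Tendsto (fun y : ℝ => 1 / y ^ 2) atTop (𝓝 0) :=
    tendsto_const_nhds.div_atTop (tendsto_pow_atTop two_ne_zero)
  simpa using h1.add ((h2.add_const 1).const_mul (1 / s))

lemma tendsto_log_deriv_atBot (p : ℝ) {s : ℝ} :
    Tendsto (fun y : ℝ => (p - 1) / y + 1 / s * (1 / y ^ 2 + 1)) atBot (𝓝 (1 / s)) := by
  have h1 : Tendsto (fun y : ℝ => (p - 1) / y) atBot (𝓝 0) := tendsto_const_nhds.div_atBot tendsto_id
  have h2 : Tendsto (fun y : ℝ => 1 / y ^ 2) atBot (𝓝 0) := by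
    have := (tendsto_const_nhds (x := (1 : ℝ))).div_atTop ((tendsto_pow_atTop two_ne_zero).comp tendsto_neg_atBot_atTop)
    refine this.congr fun y => ?_
    simp
  simpa using h1.add ((h2.add_const 1).const_mul (1 / s))

/-- The limit of the ratio of the derivative of `y ^ 2 * innerIntegrand p s 1 y` to
`innerIntegrand p s 1 y` at the origin. -/
lemma tendsto_log_deriv_zero (p : ℝ) {s : ℝ} :
    Tendsto (fun y : ℝ => (p + 1) * y + 1 / s * (1 + y ^ 2)) (𝓝 0) (𝓝 (1 / s)) := by
  have : Continuous fun y : ℝ => (p + 1) * y + 1 / s * (1 + y ^ 2) := by fun_prop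
  simpa using this.tendsto 0

lemma tendsto_inv_cancel {l : Filter ℝ} {f g : ℝ → ℝ} {s : ℝ} (hs : 0 < s)
    (hf : ∀ᶠ y in l, 0 < f y) (hg : Tendsto g l (𝓝 (1 / s))) :
    Tendsto (fun y => f y / (f y * g y)) l (𝓝 s) := by
  have h := hg.inv₀ (by positivity)
  rw [one_div, inv_inv] at h
  refine h.congr' ?_
  filter_upwards [hf] with y hy
  field_simp

lemma eventually_deriv_pos {l : Filter ℝ} {f g : ℝ → ℝ} {s : ℝ} (hs : 0 < s)
    (hf : ∀ᶠ y in l, 0 < f y) (hg : Tendsto g l (𝓝 (1 / s))) :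
    ∀ᶠ y in l, 0 < f y * g y := by
  have h : (0 : ℝ) < 1 / s := by positivity
  filter_upwards [hf, hg.eventually (lt_mem_nhds h)] with y h1 h2
  exact mul_pos h1 h2

/-- The asymptotics of the inner integral follow from L'Hôpital's rule, as its derivative is the
integrand; at `+∞` and at `0` from the left the quotient is of the form `∞ / ∞`. -/
lemma tendsto_innerIntegral_atTop {p s : ℝ} (hp : 0 < p) (hs : 0 < s) :
    Tendsto (fun y => innerIntegral p s y / innerIntegrand p s 1 y) atTop (𝓝 s) := by
  have hpos : ∀ᶠ y : ℝ in atTop, 0 < innerIntegrand p s 1 y := by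
    filter_upwards [eventually_gt_atTop 0] with y hy using innerIntegrand_pos p s 1 hy.ne'
  refine lhopital_infty (S := Set.Ioi 0) (convex_Ioi 0) isOpen_Ioi ?_
    (fun y hy => hasDerivAt_innerIntegral hp hs (ne_of_gt hy))
    (fun y hy => hasDerivAt_innerIntegrand p s (ne_of_gt hy))
    (eventually_deriv_pos hs hpos (tendsto_log_deriv_atTop p))
    (tendsto_inv_cancel hs hpos (tendsto_log_deriv_atTop p)) ?_
  · refine (atTop_basis_Ioi' (0 : ℝ)).to_hasBasis (fun y hy => ⟨y, hy, Set.inter_subset_right⟩)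
      fun y hy => ⟨y, hy, fun z hz => ⟨Set.mem_Ioi.2 (lt_trans (Set.mem_Ioi.1 hy) hz), hz⟩⟩
  · have h1 := tendsto_exp_mul_div_rpow_atTop (1 - p) (1 / s) (by positivity)
    have h2 : Tendsto (fun y : ℝ => Real.exp (-(1 / s * (1 / y)))) atTop (𝓝 1) := by
      have h3 : Tendsto (fun y : ℝ => 1 / y) atTop (𝓝 0) := tendsto_const_nhds.div_atTop tendsto_id
      have := (Real.continuous_exp.tendsto _).comp (h3.const_mul (1 / s)).neg
      simpa [Function.comp_def] using this
    refine (h2.pos_mul_atTop one_pos h1).congr' ?_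
    filter_upwards [eventually_gt_atTop 0] with y hy
    rw [innerIntegrand_one_eq, abs_of_pos hy]
    have : 1 - p = -(p - 1) := by ring
    rw [this, Real.rpow_neg hy.le, div_inv_eq_mul]
    ring_nf

/-- At `-∞` and at `0` from the right the quotient is of the form `0 / 0`. -/
lemma tendsto_innerIntegral_atBot {p s : ℝ} (hp : 0 < p) (hs : 0 < s) :
    Tendsto (fun y => innerIntegral p s y / innerIntegrand p s 1 y) atBot (𝓝 s) := by
  have hneg : ∀ᶠ y : ℝ in atBot, y < 0 := eventually_lt_atBot 0
  have hpos : ∀ᶠ y : ℝ in atBot, 0 < innerIntegrand p s 1 y := by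
    filter_upwards [hneg] with y hy using innerIntegrand_pos p s 1 hy.ne
  refine HasDerivAt.lhopital_zero_atBot
    (by filter_upwards [hneg] with y hy using hasDerivAt_innerIntegral hp hs hy.ne)
    (by filter_upwards [hneg] with y hy using hasDerivAt_innerIntegrand p s hy.ne)
    ((eventually_deriv_pos hs hpos (tendsto_log_deriv_atBot p)).mono fun y hy => hy.ne') ?_ ?_
    (tendsto_inv_cancel hs hpos (tendsto_log_deriv_atBot p))
  · have hi := integrableOn_innerIntegrand hp hs (y := -1) (by norm_num)
    rw [integrationRange_one_neg (by norm_num)] at hi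
    have h1 := intervalIntegral_tendsto_integral_Iic (-1) hi tendsto_id
    have h2 := h1.const_sub (∫ t in Set.Iic (-1), innerIntegrand p s 1 t)
    rw [sub_self] at h2
    refine h2.congr' ?_
    filter_upwards [eventually_le_atBot (-1)] with y hy
    have hi2 := integrableOn_innerIntegrand hp hs (y := y) (by linarith : y < 0).ne
    rw [integrationRange_one_neg (by linarith)] at hi2
    have h3 := intervalIntegral.integral_Iic_sub_Iic hi2 hi
    unfold innerIntegral
    rw [integrationRange_one_neg (by linarith)]
    simp only [id]
    linarith
  · have h1 := (tendsto_rpow_mul_exp_neg_mul_atTop_nhds_zero (p - 1) (1 / s) (by positivity)).comp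
      tendsto_neg_atBot_atTop
    have h2 : Tendsto (fun y : ℝ => Real.exp (-(1 / s * (1 / y)))) atBot (𝓝 1) := by
      have h3 : Tendsto (fun y : ℝ => 1 / y) atBot (𝓝 0) := tendsto_const_nhds.div_atBot tendsto_id
      have := (Real.continuous_exp.tendsto _).comp (h3.const_mul (1 / s)).neg
      simpa [Function.comp_def] using this
    have h4 := h2.mul h1
    rw [mul_zero] at h4
    refine h4.congr' ?_
    filter_upwards [hneg] with y hy
    rw [innerIntegrand_one_eq, abs_of_neg hy]
    simp only [Function.comp_apply]
    rw [mul_comm ((-y) ^ (p - 1))]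
    ring_nf

lemma tendsto_innerIntegral_nhdsGT {p s : ℝ} (hp : 0 < p) (hs : 0 < s) :
    Tendsto (fun y => innerIntegral p s y / (y ^ 2 * innerIntegrand p s 1 y)) (𝓝[>] 0) (𝓝 s) := by
  have hp0 : ∀ᶠ y : ℝ in 𝓝[>] 0, 0 < y := self_mem_nhdsWithin
  have hpos : ∀ᶠ y : ℝ in 𝓝[>] 0, 0 < innerIntegrand p s 1 y := by
    filter_upwards [hp0] with y hy using innerIntegrand_pos p s 1 hy.ne'
  have hlog := (tendsto_log_deriv_zero p (s := s)).mono_left (nhdsWithin_le_nhds (s := Set.Ioi 0))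
  refine HasDerivAt.lhopital_zero_nhdsGT
    (by filter_upwards [hp0] with y hy using hasDerivAt_innerIntegral hp hs hy.ne')
    (by filter_upwards [hp0] with y hy using hasDerivAt_sq_mul_innerIntegrand p s hy.ne')
    ((eventually_deriv_pos hs hpos hlog).mono fun y hy => hy.ne') ?_ ?_
    (tendsto_inv_cancel hs hpos hlog)
  · have hi := integrableOn_innerIntegrand hp hs (y := 1) (by norm_num)
    rw [integrationRange_one_pos one_pos, ← integrableOn_Icc_iff_integrableOn_Ioc,
      ← Set.uIcc_of_le zero_le_one] at hi
    have h1 := intervalIntegral.continuousOn_primitive_interval hi 0 (by simp)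
    have h2 : Tendsto (fun y => ∫ t in (0 : ℝ)..y, innerIntegrand p s 1 t) (𝓝[>] 0) (𝓝 0) := by
      have h3 := h1.tendsto
      rw [intervalIntegral.integral_same] at h3
      refine h3.mono_left ?_
      rw [← nhdsWithin_Ioc_eq_nhdsGT (zero_lt_one (α := ℝ))]
      refine nhdsWithin_mono _ ?_
      rw [Set.uIcc_of_le zero_le_one]
      exact Set.Ioc_subset_Icc_self
    refine h2.congr' ?_
    filter_upwards [hp0] with y hy
    unfold innerIntegral
    rw [integrationRange_one_pos hy, intervalIntegral.integral_of_le hy.le]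
  · have h1 : Tendsto (fun y : ℝ => Real.exp (y / s) * y ^ (p + 1)) (𝓝[>] 0) (𝓝 0) := by
      have : Continuous fun y : ℝ => Real.exp (y / s) * y ^ (p + 1) :=
        (by fun_prop : Continuous fun y : ℝ => Real.exp (y / s)).mul
          (Real.continuous_rpow_const (by linarith))
      have h2 := this.tendsto 0
      rw [Real.zero_rpow (by linarith), mul_zero] at h2
      exact h2.mono_left nhdsWithin_le_nhds
    refine squeeze_zero' ?_ ?_ h1
    · filter_upwards with y
      exact mul_nonneg (sq_nonneg y) (innerIntegrand_nonneg _ _ _ _)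
    · filter_upwards [hp0] with y hy
      rw [innerIntegrand_one_eq, abs_of_pos hy]
      have e1 : Real.exp (-(1 / s * (1 / y))) ≤ 1 := by
        rw [Real.exp_le_one_iff]
        have : 0 < 1 / s * (1 / y) := by positivity
        linarith
      have e2 : y ^ (p + 1) = y ^ 2 * y ^ (p - 1) := by
        rw [← Real.rpow_natCast, ← Real.rpow_add hy]
        congr 1; push_cast; ring
      rw [e2]
      calc _ ≤ y ^ 2 * (1 * (Real.exp (y / s) * y ^ (p - 1))) := by gcongr
        _ = _ := by ring

lemma tendsto_innerIntegral_nhdsLT {p s : ℝ} (hp : 0 < p) (hs : 0 < s) :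
    Tendsto (fun y => innerIntegral p s y / (y ^ 2 * innerIntegrand p s 1 y)) (𝓝[<] 0) (𝓝 s) := by
  have hn0 : ∀ᶠ y : ℝ in 𝓝[<] 0, y < 0 := self_mem_nhdsWithin
  have hpos : ∀ᶠ y : ℝ in 𝓝[<] 0, 0 < innerIntegrand p s 1 y := by
    filter_upwards [hn0] with y hy using innerIntegrand_pos p s 1 hy.ne
  have hlog := (tendsto_log_deriv_zero p (s := s)).mono_left (nhdsWithin_le_nhds (s := Set.Iio 0))
  refine lhopital_infty (S := Set.Iio 0) (convex_Iio 0) isOpen_Iio ?_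
    (fun y hy => hasDerivAt_innerIntegral hp hs (ne_of_lt hy))
    (fun y hy => hasDerivAt_sq_mul_innerIntegrand p s (ne_of_lt hy))
    (eventually_deriv_pos hs hpos hlog)
    (tendsto_inv_cancel hs hpos hlog) ?_
  · refine (nhdsLT_basis (0 : ℝ)).to_hasBasis
      (fun y hy => ⟨y, hy, fun z hz => ⟨hz.2, hz.1⟩⟩) fun y hy => ⟨y, hy, fun z hz => ⟨hz.2, hz.1⟩⟩
  · have h1 := tendsto_exp_mul_div_rpow_atTop (p + 1) (1 / s) (by positivity)
    have hinv : Tendsto (fun y : ℝ => (-y)⁻¹) (𝓝[<] 0) atTop := by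
      refine tendsto_inv_nhdsGT_zero.comp ?_
      refine tendsto_nhdsWithin_iff.2 ⟨?_, ?_⟩
      · have : Tendsto (fun y : ℝ => -y) (𝓝 0) (𝓝 0) := by simpa using (continuous_neg.tendsto (0 : ℝ))
        exact this.mono_left nhdsWithin_le_nhds
      · filter_upwards [hn0] with y hy
        simpa using hy
    have h2 : Tendsto (fun y : ℝ => Real.exp (y / s)) (𝓝[<] 0) (𝓝 1) := by
      have : Continuous fun y : ℝ => Real.exp (y / s) := by fun_prop
      have h3 := this.tendsto 0
      simp only [zero_div, Real.exp_zero] at h3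
      exact h3.mono_left nhdsWithin_le_nhds
    refine (h2.pos_mul_atTop one_pos (h1.comp hinv)).congr' ?_
    filter_upwards [hn0] with y hy
    have hy' : 0 < -y := by linarith
    rw [innerIntegrand_one_eq, abs_of_neg hy]
    simp only [Function.comp_apply]
    have e2 : (-y) ^ (p + 1) = y ^ 2 * (-y) ^ (p - 1) := by
      have : y ^ 2 = (-y) ^ 2 := by ring
      rw [this, ← Real.rpow_natCast, ← Real.rpow_add hy']
      congr 1; push_cast; ring
    rw [Real.inv_rpow hy'.le, div_inv_eq_mul, e2]
    have e3 : 1 / s * (-y)⁻¹ = -(1 / s * (1 / y)) := by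
      rw [inv_neg, one_div y]; ring
    rw [e3]
    ring

/-! ### The normalised density -/

lemma bessel_modulus_pos {p s : ℝ} (hp : 0 < p) (hs : 0 < s) :
    0 < Real.pi ^ 2 * (besselJ p (2 / s) ^ 2 + besselY p (2 / s) ^ 2) := by
  have h := nicholson_eq hp (x := 2 / s) (by positivity)
  have h2 := nicholson_ne_zero p ((2 / s / 2) ^ 2) (-1)
  rw [h] at h2
  simpa using h2

lemma normConst_pos {p s : ℝ} (hp : 0 < p) (hs : 0 < s) : 0 < normConst p s := by
  unfold normConst
  exact one_div_pos.2 (bessel_modulus_pos hp hs)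

lemma axisDensity_one_pos {p s : ℝ} (hp : 0 < p) (hs : 0 < s) {y : ℝ} (hy : y ≠ 0) :
    0 < axisDensity p s 1 y := by
  rw [axisDensity_one_eq p s hy]
  have h1 := normConst_pos hp hs
  have h2 := innerIntegral_pos hp hs hy
  have h3 := innerIntegrand_pos p s 1 hy
  positivity

lemma axisDensity_one_zero {p s : ℝ} (hp : 0 < p) : axisDensity p s 1 0 = 0 := by
  unfold axisDensity
  simp [Real.zero_rpow (by linarith : p + 1 ≠ 0)]

lemma axisDensity_one_nonneg {p s : ℝ} (hp : 0 < p) (hs : 0 < s) (y : ℝ) :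
    0 ≤ axisDensity p s 1 y := by
  by_cases hy : y = 0
  · subst hy; rw [axisDensity_one_zero hp]
  · exact (axisDensity_one_pos hp hs hy).le

lemma ofReal_axisDensity_one {p s : ℝ} (hp : 0 < p) (hs : 0 < s) {y : ℝ} (hy : y ≠ 0) :
    ENNReal.ofReal (axisDensity p s 1 y) =
      ENNReal.ofReal (normConst p s) * rawDensity p (1 / s) y := by
  have hpre : axisDensity p s 1 y = normConst p s *
      ∫ t in integrationRange 1 y,
        (1 / |y| ^ (p + 1)) * Real.exp (1 * (1 / s * (1 / y - y))) * innerIntegrand p s 1 t := by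
    unfold axisDensity
    rw [integral_const_mul]
    ring
  have hy' := abs_pos.2 hy
  rw [hpre, ENNReal.ofReal_mul (normConst_pos hp hs).le]
  congr 1
  rw [ofReal_integral_eq_lintegral_ofReal
    ((integrableOn_innerIntegrand hp hs hy).const_mul _)
    (Eventually.of_forall fun t => by
      have := innerIntegrand_nonneg p s 1 t
      simp only [Pi.zero_apply]; positivity)]
  unfold rawDensity
  have hmeas : MeasurableSet (integrationRange 1 y) := by
    rcases lt_or_gt_of_ne hy with h | h
    · rw [integrationRange_one_neg h]; exact measurableSet_Iic
    · rw [integrationRange_one_pos h]; exact measurableSet_Ioc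
  rw [← lintegral_indicator hmeas]
  have n1 : ∀ᵐ t : ℝ, t ≠ y := by simp [ae_iff]
  refine lintegral_congr_ae ?_
  filter_upwards [n1] with t ht
  have hiff : t ∈ integrationRange 1 y ↔ t < y ∧ 0 < t * y := by
    rcases lt_or_gt_of_ne hy with h | h
    · rw [integrationRange_one_neg h, Set.mem_Iic]
      refine ⟨fun h1 => ⟨lt_of_le_of_ne h1 ht, mul_pos_of_neg_of_neg (by linarith) h⟩,
        fun h1 => h1.1.le⟩
    · rw [integrationRange_one_pos h, Set.mem_Ioc]
      exact ⟨fun h1 => ⟨lt_of_le_of_ne h1.2 ht, mul_pos h1.1 h⟩,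
        fun h1 => ⟨pos_of_mul_pos_left h1.2 h.le, h1.1.le⟩⟩
  unfold arcKernel
  by_cases hc : t < y ∧ 0 < t * y
  · rw [Set.indicator_of_mem (hiff.2 hc), if_pos hc]
    congr 1
    unfold innerIntegrand
    have e1 : -p - 1 = -(p + 1) := by ring
    rw [e1, Real.rpow_neg hy'.le, one_div (|y| ^ (p + 1))]
    have e2 : Real.exp (1 / s * (1 / y - y - 1 / t + t)) =
        Real.exp (1 * (1 / s * (1 / y - y))) * Real.exp (-1 * (1 / s * (1 / t - t))) := by
      rw [← Real.exp_add]; congr 1; ring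
    rw [e2]; ring
  · rw [Set.indicator_of_notMem (fun h => hc (hiff.1 h)), if_neg hc]

lemma measurable_axisDensity_one {p s : ℝ} (hp : 0 < p) (hs : 0 < s) :
    Measurable (axisDensity p s 1) := by
  have h : axisDensity p s 1 = fun y => if y = 0 then 0 else
      (ENNReal.ofReal (normConst p s) * rawDensity p (1 / s) y).toReal := by
    ext y
    by_cases hy : y = 0
    · rw [if_pos hy, hy, axisDensity_one_zero hp]
    · rw [if_neg hy, ← ofReal_axisDensity_one hp hs hy,
        ENNReal.toReal_ofReal (axisDensity_one_nonneg hp hs y)]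
  rw [h]
  exact Measurable.ite (measurableSet_singleton 0) measurable_const
    ((measurable_rawDensity p (1 / s)).const_mul _).ennreal_toReal

theorem lintegral_axisDensity_one {p s : ℝ} (hp : 0 < p) (hs : 0 < s) :
    ∫⁻ y, ENNReal.ofReal (axisDensity p s 1 y) = 1 := by
  have n1 : ∀ᵐ y : ℝ, y ≠ 0 := by simp [ae_iff]
  have h1 : ∫⁻ y, ENNReal.ofReal (axisDensity p s 1 y) =
      ∫⁻ y, ENNReal.ofReal (normConst p s) * rawDensity p (1 / s) y := by
    refine lintegral_congr_ae ?_
    filter_upwards [n1] with y hy using ofReal_axisDensity_one hp hs hy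
  rw [h1, lintegral_const_mul _ (measurable_rawDensity p _), lintegral_rawDensity p (by positivity)]
  have e : (1 / s) ^ 2 = (2 / s / 2) ^ 2 := by ring
  have hpos := bessel_modulus_pos hp hs
  rw [e, nicholson_eq hp (by positivity), ← ENNReal.ofReal_mul (normConst_pos hp hs).le]
  unfold normConst
  rw [one_div, inv_mul_cancel₀ hpos.ne', ENNReal.ofReal_one]

lemma lintegral_gammaMeasure {p l : ℝ} {φ : ℝ → ℝ≥0∞} (hφ : Measurable φ) :
    ∫⁻ a, φ a ∂gammaMeasure p l = ∫⁻ a, gammaPDF p l a * φ a := by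
  unfold gammaMeasure
  rw [lintegral_withDensity_eq_lintegral_mul _ (measurable_gammaPDF p l) hφ]
  rfl

/-- Invariance of the density under `y ↦ -1 / (y + a)`, before integration against a function. -/
theorem lintegral_axisDensity_sub {p s u : ℝ} (hp : 0 < p) (hs : 0 < s) (hu : u ≠ 0) :
    ∫⁻ a, ENNReal.ofReal (axisDensity p s 1 (u - a)) ∂gammaMeasure p (1 / s) =
      ENNReal.ofReal ((u ^ 2)⁻¹) * ENNReal.ofReal (axisDensity p s 1 (-u⁻¹)) := by
  have hm := measurable_axisDensity_one hp hs
  have hm' : Measurable fun a => ENNReal.ofReal (axisDensity p s 1 (u - a)) :=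
    (hm.comp (measurable_const.sub measurable_id)).ennreal_ofReal
  have hr : Measurable fun a => gammaPDF p (1 / s) a * rawDensity p (1 / s) (u - a) :=
    (measurable_gammaPDF p _).mul
      ((measurable_rawDensity p _).comp (measurable_const.sub measurable_id))
  rw [lintegral_gammaMeasure hm']
  have n1 : ∀ᵐ a : ℝ, a ≠ u := by simp [ae_iff]
  have h1 : ∫⁻ a, gammaPDF p (1 / s) a * ENNReal.ofReal (axisDensity p s 1 (u - a)) =
      ∫⁻ a, ENNReal.ofReal (normConst p s) * (gammaPDF p (1 / s) a * rawDensity p (1 / s) (u - a)) := by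
    refine lintegral_congr_ae ?_
    filter_upwards [n1] with a ha
    rw [ofReal_axisDensity_one hp hs (sub_ne_zero.2 (Ne.symm ha))]
    ring
  rw [h1, lintegral_const_mul _ hr,
    lintegral_gammaPDF_mul_rawDensity hp (by positivity) hu,
    ofReal_axisDensity_one hp hs (neg_ne_zero.2 (inv_ne_zero hu))]
  ring

lemma tendsto_sq_mul_axisDensity_atTop {p s : ℝ} (hp : 0 < p) (hs : 0 < s) :
    Tendsto (fun y => y ^ 2 * axisDensity p s 1 y) atTop (𝓝 (normConst p s * s)) := by
  refine ((tendsto_innerIntegral_atTop hp hs).const_mul (normConst p s)).congr' ?_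
  filter_upwards [eventually_gt_atTop 0] with y hy
  rw [axisDensity_one_eq p s hy.ne']
  have := innerIntegrand_pos p s 1 hy.ne'
  field_simp

lemma tendsto_sq_mul_axisDensity_atBot {p s : ℝ} (hp : 0 < p) (hs : 0 < s) :
    Tendsto (fun y => y ^ 2 * axisDensity p s 1 y) atBot (𝓝 (normConst p s * s)) := by
  refine ((tendsto_innerIntegral_atBot hp hs).const_mul (normConst p s)).congr' ?_
  filter_upwards [eventually_lt_atBot 0] with y hy
  rw [axisDensity_one_eq p s hy.ne]
  have := innerIntegrand_pos p s 1 hy.ne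
  have hy2 : y ≠ 0 := hy.ne
  field_simp

lemma tendsto_axisDensity_zero {p s : ℝ} (hp : 0 < p) (hs : 0 < s) :
    Tendsto (axisDensity p s 1) (𝓝[≠] 0) (𝓝 (normConst p s * s)) := by
  rw [← nhdsLT_sup_nhdsGT]
  refine Tendsto.sup ?_ ?_
  · refine ((tendsto_innerIntegral_nhdsLT hp hs).const_mul (normConst p s)).congr' ?_
    filter_upwards [self_mem_nhdsWithin] with y hy
    exact (axisDensity_one_eq p s (ne_of_lt hy)).symm
  · refine ((tendsto_innerIntegral_nhdsGT hp hs).const_mul (normConst p s)).congr' ?_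
    filter_upwards [self_mem_nhdsWithin] with y hy
    exact (axisDensity_one_eq p s (ne_of_gt hy)).symm

lemma continuousAt_axisDensity {p s : ℝ} (hp : 0 < p) (hs : 0 < s) {y : ℝ} (hy : y ≠ 0) :
    ContinuousAt (axisDensity p s 1) y := by
  have h1 := (hasDerivAt_innerIntegral hp hs hy).continuousAt
  have h2 := (hasDerivAt_sq_mul_innerIntegrand p s hy).continuousAt
  have h3 : y ^ 2 * innerIntegrand p s 1 y ≠ 0 :=
    mul_ne_zero (pow_ne_zero 2 hy) (innerIntegrand_pos p s 1 hy).ne'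
  have h : ContinuousAt (fun y => normConst p s *
      (innerIntegral p s y / (y ^ 2 * innerIntegrand p s 1 y))) y :=
    continuousAt_const.mul (h1.div h2 h3)
  refine h.congr_of_eventuallyEq ?_
  filter_upwards [isOpen_ne.mem_nhds hy] with z hz
  exact axisDensity_one_eq p s hz

/-- The density is comparable to the Cauchy density. -/
lemma exists_axisDensity_bounds {p s : ℝ} (hp : 0 < p) (hs : 0 < s) :
    ∃ c C : ℝ, 0 < c ∧ 0 < C ∧ ∀ y : ℝ, y ≠ 0 →
      c ≤ (1 + y ^ 2) * axisDensity p s 1 y ∧ (1 + y ^ 2) * axisDensity p s 1 y ≤ C := by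
  set L := normConst p s * s with hL
  have hL0 : 0 < L := mul_pos (normConst_pos hp hs) hs
  -- with its limit at the origin filled in, the quotient is continuous and positive on the line and
  -- has a positive limit at infinity
  set h : ℝ → ℝ := Function.update (fun y => (1 + y ^ 2) * axisDensity p s 1 y) 0 L with hh
  have hval : ∀ y, y ≠ 0 → h y = (1 + y ^ 2) * axisDensity p s 1 y := fun y hy => by
    simp [hh, hy]
  have hcont : Continuous h := by
    rw [continuous_iff_continuousAt]
    intro y
    by_cases hy : y = 0
    · subst hy
      rw [hh, continuousAt_update_same]
      have h1 : Tendsto (fun y : ℝ => 1 + y ^ 2) (𝓝[≠] 0) (𝓝 1) := by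
        have : Continuous fun y : ℝ => 1 + y ^ 2 := by fun_prop
        have h2 := this.tendsto 0
        simp only [ne_eq, OfNat.ofNat_ne_zero, not_false_eq_true, zero_pow, add_zero] at h2
        exact h2.mono_left nhdsWithin_le_nhds
      simpa using h1.mul (tendsto_axisDensity_zero hp hs)
    · have h1 : ContinuousAt (fun y : ℝ => (1 + y ^ 2) * axisDensity p s 1 y) y :=
        (by fun_prop : Continuous fun y : ℝ => 1 + y ^ 2).continuousAt.mul
          (continuousAt_axisDensity hp hs hy)
      refine h1.congr_of_eventuallyEq ?_
      filter_upwards [isOpen_ne.mem_nhds hy] with z hz using hval z hz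
  have hpos : ∀ y, 0 < h y := by
    intro y
    by_cases hy : y = 0
    · subst hy; simpa [hh] using hL0
    · rw [hval y hy]
      have := axisDensity_one_pos hp hs hy
      positivity
  have haux : ∀ l : Filter ℝ, (∀ᶠ y in l, y ≠ 0) → Tendsto (fun y : ℝ => (y ^ 2)⁻¹) l (𝓝 0) →
      Tendsto (fun y => y ^ 2 * axisDensity p s 1 y) l (𝓝 L) → Tendsto h l (𝓝 L) := by
    intro l hne hinv hsq
    have h1 := (hinv.add_const 1).mul hsq
    rw [zero_add, one_mul] at h1
    refine h1.congr' ?_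
    filter_upwards [hne] with y hy
    rw [hval y hy]
    field_simp
  have htop : Tendsto h atTop (𝓝 L) :=
    haux atTop (eventually_ne_atTop 0) ((tendsto_pow_atTop two_ne_zero).inv_tendsto_atTop)
      (tendsto_sq_mul_axisDensity_atTop hp hs)
  have hbot : Tendsto h atBot (𝓝 L) := by
    refine haux atBot (eventually_ne_atBot 0) ?_ (tendsto_sq_mul_axisDensity_atBot hp hs)
    have h1 := ((tendsto_pow_atTop (α := ℝ) two_ne_zero).inv_tendsto_atTop).comp
      tendsto_neg_atBot_atTop
    refine h1.congr fun y => ?_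
    simp
  have hco : Tendsto h (cocompact ℝ) (𝓝 L) := by
    rw [cocompact_eq_atBot_atTop]; exact hbot.sup htop
  have hev : ∀ᶠ y in cocompact ℝ, h y ∈ Set.Ioo (L / 2) (2 * L) :=
    hco.eventually (Ioo_mem_nhds (by linarith) (by linarith))
  obtain ⟨K, hK, hKs⟩ := mem_cocompact.1 hev
  obtain ⟨M, hM⟩ := hK.exists_bound_of_continuousOn hcont.continuousOn
  obtain ⟨M', hM'⟩ := hK.exists_bound_of_continuousOn
    (hcont.inv₀ fun y => (hpos y).ne').continuousOn
  refine ⟨min (L / 2) (1 / (|M'| + 1)), max (2 * L) M, lt_min (by linarith) (by positivity),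
    lt_max_of_lt_left (by linarith), fun y hy => ?_⟩
  rw [← hval y hy]
  by_cases hyK : y ∈ K
  · refine ⟨(min_le_right _ _).trans ?_, ((le_abs_self _).trans (hM y hyK)).trans (le_max_right _ _)⟩
    have h1 := hM' y hyK
    rw [Pi.inv_apply, norm_inv, Real.norm_of_nonneg (hpos y).le] at h1
    rw [one_div]
    refine inv_le_of_inv_le₀ (hpos y) (h1.trans ?_)
    linarith [le_abs_self M']
  · have h1 := hKs hyK
    exact ⟨(min_le_left _ _).trans h1.1.le, h1.2.le.trans (le_max_left _ _)⟩

/-! ### A strictly contracted function of the matrix products -/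

/-- The action of `!![0, -1; 1, a]`, which is that of the random matrices in suitable coordinates. -/
def realStep (a : ℝ) (x : ℝ × ℝ) : ℝ × ℝ := (-x.2, x.1 + a * x.2)

lemma measurable_realStep : Measurable fun q : ℝ × (ℝ × ℝ) => realStep q.1 q.2 := by
  unfold realStep; fun_prop

lemma realStep_ne_zero {a : ℝ} {x : ℝ × ℝ} (hx : x ≠ 0) : realStep a x ≠ 0 := by
  intro h
  have h1 : -x.2 = 0 := congrArg Prod.fst h
  have h2 : x.1 + a * x.2 = 0 := congrArg Prod.snd h
  have h3 : x.2 = 0 := by linarith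
  rw [h3] at h2
  exact hx (Prod.ext (by simpa using h2) h3)

/-- An invariant density, as a function that is homogeneous of degree `-2` on the plane, decreases
on average under the random matrices and is comparable to `‖x‖⁻²`. -/
lemma exists_homogeneous_density {p s : ℝ} (hp : 0 < p) (hs : 0 < s) :
    ∃ (F : ℝ × ℝ → ℝ) (c C : ℝ), Measurable F ∧ 0 < c ∧ 0 < C ∧
      (∀ x : ℝ × ℝ, x ≠ 0 → c ≤ (x.1 ^ 2 + x.2 ^ 2) * F x ∧ (x.1 ^ 2 + x.2 ^ 2) * F x ≤ C) ∧
      (∀ x : ℝ × ℝ, x ≠ 0 →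
        ∫⁻ a, ENNReal.ofReal (F (realStep a x)) ∂gammaMeasure p (1 / s) ≤ ENNReal.ofReal (F x)) := by
  obtain ⟨c, C, hc, hC, hb⟩ := exists_axisDensity_bounds hp hs
  have hl : 0 < 1 / s := by positivity
  have hprob := isProbabilityMeasure_gammaMeasure hp hl
  have hm := measurable_axisDensity_one hp hs
  have hac : gammaMeasure p (1 / s) ≪ volume := withDensity_absolutelyContinuous _ _
  have hne : ∀ b : ℝ, ∀ᵐ a ∂gammaMeasure p (1 / s), a ≠ b := fun b =>
    hac.ae_le (compl_mem_ae_iff.2 (measure_singleton b))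
  -- the value at the origin and at infinity that makes the mean property hold there too
  set K := ∫⁻ a, ENNReal.ofReal (axisDensity p s 1 (-a)) ∂gammaMeasure p (1 / s) with hK
  have hdle : ∀ y, axisDensity p s 1 y ≤ C := by
    intro y
    by_cases hy : y = 0
    · rw [hy, axisDensity_one_zero hp]; exact hC.le
    · have h1 := (hb y hy).2
      have h2 := axisDensity_one_pos hp hs hy
      nlinarith [sq_nonneg y]
  have hKle : K ≤ ENNReal.ofReal C := by
    calc K ≤ ∫⁻ _, ENNReal.ofReal C ∂gammaMeasure p (1 / s) :=
          lintegral_mono fun a => ENNReal.ofReal_le_ofReal (hdle _)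
      _ = _ := by rw [lintegral_const, measure_univ, mul_one]
  have hKtop : K ≠ ∞ := (hKle.trans_lt ENNReal.ofReal_lt_top).ne
  have hK0 : K ≠ 0 := by
    intro h0
    have hm' : Measurable fun a => ENNReal.ofReal (axisDensity p s 1 (-a)) :=
      (hm.comp measurable_neg).ennreal_ofReal
    rw [hK, lintegral_eq_zero_iff hm'] at h0
    have h2 : ∀ᵐ a ∂gammaMeasure p (1 / s), False := by
      filter_upwards [h0, hne 0] with a ha ha0
      simp only [Pi.zero_apply, ENNReal.ofReal_eq_zero] at ha
      exact absurd ha (not_le.2 (axisDensity_one_pos hp hs (neg_ne_zero.2 ha0)))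
    rw [ae_iff] at h2
    simp only [not_false_eq_true, Set.ofPred_true, measure_univ] at h2
    exact one_ne_zero h2
  set k := K.toReal with hk
  have hkK : ENNReal.ofReal k = K := ENNReal.ofReal_toReal hKtop
  have hk0 : 0 < k := ENNReal.toReal_pos hK0 hKtop
  set f : ℝ → ℝ := fun y => if y = 0 then k else axisDensity p s 1 y with hf
  have hfm : Measurable f := Measurable.ite (measurableSet_singleton 0) measurable_const hm
  have hfb : ∀ y, min c k ≤ (1 + y ^ 2) * f y ∧ (1 + y ^ 2) * f y ≤ max C k := by
    intro y
    by_cases hy : y = 0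
    · simp [hf, hy]
    · simp only [hf, if_neg hy]
      exact ⟨(min_le_left _ _).trans (hb y hy).1, (hb y hy).2.trans (le_max_left _ _)⟩
  set F : ℝ × ℝ → ℝ := fun x => if x.1 = 0 then k / x.2 ^ 2 else f (x.2 / x.1) / x.1 ^ 2 with hF
  refine ⟨F, min c k, max C k, ?_, lt_min hc hk0, lt_max_of_lt_left hC, ?_, ?_⟩
  · refine Measurable.ite (measurable_fst (measurableSet_singleton 0)) (by fun_prop) ?_
    exact (hfm.comp (measurable_snd.div measurable_fst)).div (measurable_fst.pow_const 2)
  · rintro ⟨x1, x2⟩ hx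
    by_cases h1 : x1 = 0
    · have h2 : x2 ≠ 0 := by rintro rfl; exact hx (by rw [h1]; rfl)
      have : (x1 ^ 2 + x2 ^ 2) * F (x1, x2) = k := by
        simp only [hF, h1, if_true]; field_simp; ring
      simp only [this]
      exact ⟨min_le_right _ _, le_max_right _ _⟩
    · have : (x1 ^ 2 + x2 ^ 2) * F (x1, x2) = (1 + (x2 / x1) ^ 2) * f (x2 / x1) := by
        simp only [hF, if_neg h1]; field_simp
      simp only [this]
      exact hfb _
  · rintro ⟨x1, x2⟩ hx
    simp only [realStep]
    by_cases h2 : x2 = 0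
    · have h1 : x1 ≠ 0 := by rintro rfl; exact hx (by rw [h2]; rfl)
      simp only [hF, h2, h1, hf, neg_zero, mul_zero, add_zero, if_true, if_false, zero_div]
      rw [lintegral_const, measure_univ, mul_one]
    · have e1 : ∀ a : ℝ, F (-x2, x1 + a * x2) = (x2 ^ 2)⁻¹ * f (-(x1 / x2) - a) := by
        intro a
        simp only [hF, neg_eq_zero, if_neg h2]
        have : (x1 + a * x2) / -x2 = -(x1 / x2) - a := by field_simp; ring
        rw [this]
        field_simp
      have n1 : ∀ᵐ a ∂gammaMeasure p (1 / s), a ≠ -(x1 / x2) := hne _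
      have e2 : ∫⁻ a, ENNReal.ofReal (F (-x2, x1 + a * x2)) ∂gammaMeasure p (1 / s) =
          ENNReal.ofReal ((x2 ^ 2)⁻¹) *
            ∫⁻ a, ENNReal.ofReal (axisDensity p s 1 (-(x1 / x2) - a)) ∂gammaMeasure p (1 / s) := by
        rw [← lintegral_const_mul' _ _ ENNReal.ofReal_ne_top]
        refine lintegral_congr_ae ?_
        filter_upwards [n1] with a ha
        have : -(x1 / x2) - a ≠ 0 := sub_ne_zero.2 (Ne.symm ha)
        simp only [e1]
        rw [ENNReal.ofReal_mul (by positivity)]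
        simp only [hf, if_neg this]
      rw [e2]
      by_cases h1 : x1 = 0
      · simp only [h1, zero_div, neg_zero, zero_sub]
        rw [← hK, ← hkK, ← ENNReal.ofReal_mul (by positivity)]
        refine le_of_eq ?_
        congr 1
        simp only [hF, if_true]
        field_simp
      · have hu : -(x1 / x2) ≠ 0 := neg_ne_zero.2 (div_ne_zero h1 h2)
        rw [lintegral_axisDensity_sub hp hs hu, ← ENNReal.ofReal_mul (by positivity),
          ← ENNReal.ofReal_mul (by positivity)]
        refine le_of_eq ?_
        congr 1
        have e3 : -(-(x1 / x2))⁻¹ = x2 / x1 := by field_simp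
        have e4 : x2 / x1 ≠ 0 := div_ne_zero h2 h1
        simp only [hF, if_neg h1, hf, if_neg e4, e3]
        field_simp

/-- Averaging of a function over one step of a random walk with increments distributed as `μ`. -/
noncomputable def avgOp {X : Type*} (μ : Measure ℝ) (g : ℝ → X → X) (φ : X → ℝ≥0∞) (x : X) : ℝ≥0∞ :=
  ∫⁻ a, φ (g a x) ∂μ

lemma measurable_avgOp {X : Type*} [MeasurableSpace X] {μ : Measure ℝ} [SFinite μ]
    {g : ℝ → X → X} (hg : Measurable fun q : ℝ × X => g q.1 q.2) {φ : X → ℝ≥0∞}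
    (hφ : Measurable φ) : Measurable (avgOp μ g φ) :=
  (hφ.comp (hg.comp measurable_swap)).lintegral_prod_right'

lemma measurable_iterate_avgOp {X : Type*} [MeasurableSpace X] {μ : Measure ℝ} [SFinite μ]
    {g : ℝ → X → X} (hg : Measurable fun q : ℝ × X => g q.1 q.2) {φ : X → ℝ≥0∞}
    (hφ : Measurable φ) (n : ℕ) : Measurable ((avgOp μ g)^[n] φ) := by
  induction n with
  | zero => exact hφ
  | succ n ih => rw [Function.iterate_succ_apply']; exact measurable_avgOp hg ih

lemma iterate_avgOp_comp {X Y : Type*} {μ : Measure ℝ} {g : ℝ → X → X} {h : ℝ → Y → Y}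
    {R : X → Y} (hR : ∀ a x, R (g a x) = h a (R x)) (φ : Y → ℝ≥0∞) (n : ℕ) :
    (avgOp μ g)^[n] (φ ∘ R) = (avgOp μ h)^[n] φ ∘ R := by
  induction n with
  | zero => rfl
  | succ n ih =>
    rw [Function.iterate_succ_apply', Function.iterate_succ_apply', ih]
    funext x
    simp only [avgOp, Function.comp_apply, hR]

lemma iterate_avgOp_mono {X : Type*} {μ : Measure ℝ} {g : ℝ → X → X} {S : Set X}
    (hS : ∀ a, ∀ x ∈ S, g a x ∈ S) {φ ψ : X → ℝ≥0∞} (h : ∀ x ∈ S, φ x ≤ ψ x) (n : ℕ) :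
    ∀ x ∈ S, (avgOp μ g)^[n] φ x ≤ (avgOp μ g)^[n] ψ x := by
  induction n with
  | zero => exact h
  | succ n ih =>
    intro x hx
    rw [Function.iterate_succ_apply', Function.iterate_succ_apply']
    exact lintegral_mono fun a => ih _ (hS a x hx)

lemma iterate_avgOp_const_mul {X : Type*} {μ : Measure ℝ} {g : ℝ → X → X} {r : ℝ≥0∞}
    (hr : r ≠ ∞) (φ : X → ℝ≥0∞) (n : ℕ) :
    (avgOp μ g)^[n] (fun x => r * φ x) = fun x => r * (avgOp μ g)^[n] φ x := by
  induction n with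
  | zero => rfl
  | succ n ih =>
    rw [Function.iterate_succ_apply', Function.iterate_succ_apply', ih]
    funext x
    exact lintegral_const_mul' _ _ hr

/-- A function whose two-fold average is at most `ρ < 1` times itself has summable averages. -/
lemma tsum_iterate_avgOp_lt_top {X : Type*} {μ : Measure ℝ} {g : ℝ → X → X} {S : Set X}
    (hS : ∀ a, ∀ x ∈ S, g a x ∈ S) {w : X → ℝ≥0∞} (hw : ∀ x, w x ≠ ∞) {ρ : ℝ≥0∞} (hρ : ρ < 1)
    (h1 : ∀ x ∈ S, avgOp μ g w x ≤ w x)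
    (h2 : ∀ x ∈ S, avgOp μ g (avgOp μ g w) x ≤ ρ * w x) {x : X} (hx : x ∈ S) :
    ∑' n, (avgOp μ g)^[n] w x < ∞ := by
  have hρ' : ρ ≠ ∞ := (hρ.trans ENNReal.one_lt_top).ne
  have heven : ∀ n, ∀ y ∈ S, (avgOp μ g)^[2 * n] w y ≤ ρ ^ n * w y := by
    intro n
    induction n with
    | zero => intro y _; simp
    | succ n ih =>
      intro y hy
      have e : 2 * (n + 1) = 2 * n + 2 := by ring
      rw [e, Function.iterate_add_apply]
      refine (iterate_avgOp_mono hS (ψ := fun x => ρ * w x) h2 (2 * n) y hy).trans ?_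
      rw [iterate_avgOp_const_mul hρ', pow_succ, mul_comm (ρ ^ n), mul_assoc]
      exact mul_le_mul' le_rfl (ih y hy)
  have hodd : ∀ n, ∀ y ∈ S, (avgOp μ g)^[2 * n + 1] w y ≤ ρ ^ n * w y := by
    intro n y hy
    rw [Function.iterate_add_apply]
    exact (iterate_avgOp_mono hS h1 (2 * n) y hy).trans (heven n y hy)
  have hsplit : ∑' n, (avgOp μ g)^[n] w x =
      ∑' n, (avgOp μ g)^[2 * n] w x + ∑' n, (avgOp μ g)^[2 * n + 1] w x :=
    (tsum_even_add_odd (f := fun n => (avgOp μ g)^[n] w x)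
      ENNReal.summable ENNReal.summable).symm
  have hgeom : ∑' n, ρ ^ n * w x < ∞ := by
    rw [ENNReal.tsum_mul_right, ENNReal.tsum_geometric]
    refine ENNReal.mul_lt_top ?_ (hw x).lt_top
    rw [ENNReal.inv_lt_top]
    exact tsub_pos_of_lt hρ
  rw [hsplit]
  exact ENNReal.add_lt_top.2
    ⟨(ENNReal.tsum_le_tsum fun n => heven n x hx).trans_lt hgeom,
      (ENNReal.tsum_le_tsum fun n => hodd n x hx).trans_lt hgeom⟩

/-- A quantitative strict Cauchy–Schwarz inequality: the mean of a random variable that is at least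
`ℓ` on `A` and at most `ℓ / 2` on `B` is strictly less than its quadratic mean. -/
lemma lintegral_le_sqrt_sub {μ : Measure ℝ} [IsProbabilityMeasure μ] {ξ : ℝ → ℝ}
    (hξ : Measurable ξ) (h0 : ∀ a, 0 ≤ ξ a) {S ℓ θ : ℝ} (hS : 0 ≤ S) (hℓ : 0 ≤ ℓ)
    (hint : ∫⁻ a, ENNReal.ofReal (ξ a ^ 2) ∂μ ≤ ENNReal.ofReal S) {A B : Set ℝ}
    (hA : MeasurableSet A) (hB : MeasurableSet B) (hAθ : θ ≤ μ.real A) (hBθ : θ ≤ μ.real B)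
    (hξA : ∀ a ∈ A, ℓ ≤ ξ a) (hξB : ∀ a ∈ B, ξ a ≤ ℓ / 2) :
    ∫⁻ a, ENNReal.ofReal (ξ a) ∂μ ≤ ENNReal.ofReal √(S - ℓ ^ 2 * θ / 16) := by
  have hsq : Integrable (fun a => ξ a ^ 2) μ := by
    refine ⟨(hξ.pow_const 2).aestronglyMeasurable, ?_⟩
    rw [hasFiniteIntegral_iff_ofReal (Eventually.of_forall fun a => sq_nonneg _)]
    exact hint.trans_lt ENNReal.ofReal_lt_top
  have hi : Integrable ξ μ :=
    ((memLp_two_iff_integrable_sq hξ.aestronglyMeasurable).2 hsq).integrable one_le_two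
  have hS' : ∫ a, ξ a ^ 2 ∂μ ≤ S := by
    rw [← ENNReal.ofReal_le_ofReal_iff hS,
      ofReal_integral_eq_lintegral_ofReal hsq (Eventually.of_forall fun a => sq_nonneg _)]
    exact hint
  rw [← ofReal_integral_eq_lintegral_ofReal hi (Eventually.of_forall h0)]
  refine ENNReal.ofReal_le_ofReal (Real.le_sqrt_of_sq_le ?_)
  set m := ∫ a, ξ a ∂μ with hm
  have hvar : ∫ a, (ξ a - m) ^ 2 ∂μ = ∫ a, ξ a ^ 2 ∂μ - m ^ 2 := by
    have e : ∀ a, (ξ a - m) ^ 2 = ξ a ^ 2 - 2 * m * ξ a + m ^ 2 := fun a => by ring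
    have hi' : Integrable (fun a => 2 * m * ξ a) μ := hi.const_mul _
    have hsi : Integrable (fun a => ξ a ^ 2 - 2 * m * ξ a) μ := hsq.sub hi'
    simp only [e]
    rw [integral_add hsi (integrable_const _), integral_sub hsq hi', integral_const_mul, ← hm]
    simp
    ring
  have hvi : Integrable (fun a => (ξ a - m) ^ 2) μ := by
    have e : (fun a => (ξ a - m) ^ 2) = fun a => ξ a ^ 2 - 2 * m * ξ a + m ^ 2 := by
      funext a; ring
    rw [e]
    exact (hsq.sub (hi.const_mul _)).add (integrable_const _)
  have key : ∀ D : Set ℝ, MeasurableSet D → θ ≤ μ.real D →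
      (∀ a ∈ D, ℓ ^ 2 / 16 ≤ (ξ a - m) ^ 2) → ℓ ^ 2 * θ / 16 ≤ ∫ a, (ξ a - m) ^ 2 ∂μ := by
    intro D hD hDθ hle
    calc ℓ ^ 2 * θ / 16 ≤ ℓ ^ 2 / 16 * μ.real D := by nlinarith [sq_nonneg ℓ]
      _ = ∫ a in D, ℓ ^ 2 / 16 ∂μ := by rw [setIntegral_const, smul_eq_mul, mul_comm]
      _ ≤ ∫ a in D, (ξ a - m) ^ 2 ∂μ :=
          setIntegral_mono_on (integrable_const _).integrableOn hvi.integrableOn hD hle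
      _ ≤ _ := setIntegral_le_integral hvi (Eventually.of_forall fun a => sq_nonneg _)
  -- according to the position of the mean, the deviation from it is at least `ℓ / 4` on `A` or on `B`
  have hfin : ℓ ^ 2 * θ / 16 ≤ ∫ a, (ξ a - m) ^ 2 ∂μ := by
    rcases le_total m (3 * ℓ / 4) with h | h
    · refine key A hA hAθ fun a ha => ?_
      have := hξA a ha
      nlinarith
    · refine key B hB hBθ fun a ha => ?_
      have := hξB a ha
      nlinarith
  linarith

/-- Let `W` be comparable to `(|x₁| + |x₂|)⁻¹`, and let the average of `W ^ 2` over one step be at most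
`W ^ 2`. Then `W` is contracted strictly by two averagings, so that the averages of
`(|x₁| + |x₂|)⁻¹` are summable. -/
theorem tsum_iterate_avgOp_inv_norm_lt_top {μ : Measure ℝ} [IsProbabilityMeasure μ]
    (hμ1 : μ (Set.Icc 0 1) ≠ 0) (hμ2 : ∀ R, μ (Set.Ici R) ≠ 0)
    {W : ℝ × ℝ → ℝ} (hW : Measurable W) {c C : ℝ} (hc : 0 < c)
    (hW0 : ∀ x, 0 ≤ W x)
    (hb : ∀ x : ℝ × ℝ, x ≠ 0 → c ≤ (|x.1| + |x.2|) * W x ∧ (|x.1| + |x.2|) * W x ≤ C)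
    (hmean : ∀ x : ℝ × ℝ, x ≠ 0 →
      ∫⁻ a, ENNReal.ofReal (W (realStep a x) ^ 2) ∂μ ≤ ENNReal.ofReal (W x ^ 2))
    {x : ℝ × ℝ} (hx : x ≠ 0) :
    ∑' n, (avgOp μ realStep)^[n] (fun y => ENNReal.ofReal (|y.1| + |y.2|)⁻¹) x < ∞ := by
  have hN : ∀ x : ℝ × ℝ, x ≠ 0 → 0 < |x.1| + |x.2| := by
    intro x hx
    by_contra h
    have h1 := abs_nonneg x.1
    have h2 := abs_nonneg x.2
    refine hx (Prod.ext ?_ ?_)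
    · exact abs_eq_zero.1 (by linarith)
    · exact abs_eq_zero.1 (by linarith)
  have hcC : c ≤ C := by
    have := hb (1, 0) (by simp)
    linarith [this.1, this.2]
  have hC : 0 < C := hc.trans_le hcC
  -- a step with `a ≥ R` lengthens the vector by a factor `4 C / c`, which makes `W` at most half of
  -- what it is after a step with `a ≤ 1`
  set R : ℝ := 5 * (1 + 4 * C / c) with hR
  set θ : ℝ := min (μ.real (Set.Icc 0 1)) (μ.real (Set.Ici R)) with hθ
  have hθ0 : 0 < θ := lt_min
    (ENNReal.toReal_pos hμ1 (measure_ne_top _ _)) (ENNReal.toReal_pos (hμ2 R) (measure_ne_top _ _))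
  have hθ1 : θ ≤ 1 := (min_le_left _ _).trans measureReal_le_one
  set η : ℝ := c ^ 2 * θ / (64 * C ^ 2) with hη
  have hη0 : 0 < η := by positivity
  have hη1 : η < 1 := by
    rw [hη, div_lt_one (by positivity)]
    nlinarith [mul_le_mul hcC hcC hc.le hC.le, sq_nonneg c, sq_nonneg C, pow_pos hC 2]
  set ρ₀ : ℝ := √(1 - η) with hρ₀
  have hρ₀0 : 0 ≤ ρ₀ := Real.sqrt_nonneg _
  have hρ₀1 : ρ₀ < 1 := by
    rw [hρ₀, Real.sqrt_lt' one_pos]; linarith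
  set w : ℝ × ℝ → ℝ≥0∞ := fun x => ENNReal.ofReal (W x) with hw
  have hmx : ∀ x : ℝ × ℝ, Measurable fun a => W (realStep a x) := fun x =>
    hW.comp (measurable_realStep.comp measurable_prodMk_right)
  -- averaging does not increase the function
  have step1 : ∀ x : ℝ × ℝ, x ≠ 0 → avgOp μ realStep w x ≤ w x := by
    intro x hx
    have := lintegral_le_sqrt_sub (hmx x) (fun a => hW0 _) (sq_nonneg (W x)) le_rfl (hmean x hx)
      MeasurableSet.empty MeasurableSet.empty (θ := 0) (by simp) (by simp)
      (fun a ha => ha.elim) (fun a ha => ha.elim)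
    rw [mul_zero, zero_div, sub_zero, Real.sqrt_sq (hW0 x)] at this
    exact this
  -- away from the first axis it decreases it strictly
  have step2 : ∀ x : ℝ × ℝ, x ≠ 0 → (|x.1| + |x.2|) / 5 ≤ |x.2| →
      avgOp μ realStep w x ≤ ENNReal.ofReal ρ₀ * w x := by
    intro x hx hx2
    have hNx := hN x hx
    set N := |x.1| + |x.2| with hNdef
    have hℓA : ∀ a ∈ Set.Icc (0 : ℝ) 1, c / (2 * N) ≤ W (realStep a x) := by
      intro a ha
      have hy := realStep_ne_zero (a := a) hx
      have hNy := hN _ hy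
      have h1 := (hb _ hy).1
      have h2 : |(realStep a x).1| + |(realStep a x).2| ≤ 2 * N := by
        simp only [realStep, abs_neg]
        have h3 : |x.1 + a * x.2| ≤ |x.1| + |x.2| := by
          refine (abs_add_le _ _).trans ?_
          rw [abs_mul, abs_of_nonneg ha.1]
          nlinarith [ha.2, abs_nonneg x.2]
        have := abs_nonneg x.1
        linarith
      rw [div_le_iff₀ (by positivity)]
      nlinarith [hW0 (realStep a x)]
    have hℓB : ∀ a ∈ Set.Ici R, W (realStep a x) ≤ c / (2 * N) / 2 := by
      intro a ha
      have hy := realStep_ne_zero (a := a) hx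
      have h1 := (hb _ hy).2
      have ha' : R ≤ a := ha
      have hR0 : 0 < R := by positivity
      have h2 : N * (4 * C / c) ≤ |(realStep a x).1| + |(realStep a x).2| := by
        simp only [realStep, abs_neg]
        have h3 : a * |x.2| - |x.1| ≤ |x.1 + a * x.2| := by
          have := abs_sub_abs_le_abs_sub (a * x.2) (-x.1)
          rw [abs_mul, abs_of_pos (by linarith : 0 < a), abs_neg, sub_neg_eq_add,
            add_comm (a * x.2)] at this
          exact this
        have h4 : R * (N / 5) ≤ a * |x.2| := mul_le_mul ha' hx2 (by positivity) (by linarith)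
        have h5 : R * (N / 5) = N + N * (4 * C / c) := by rw [hR]; ring
        have := abs_nonneg x.2
        linarith
      have h6 : N * (4 * C / c) * W (realStep a x) ≤ C :=
        (mul_le_mul_of_nonneg_right h2 (hW0 _)).trans h1
      have h7 : N * (4 * C / c) * W (realStep a x) = C * (4 * N / c * W (realStep a x)) := by
        field_simp
      rw [h7] at h6
      have h8 : 4 * N / c * W (realStep a x) ≤ 1 := by
        by_contra h; push Not at h; nlinarith
      rw [div_div, le_div_iff₀ (by positivity)]
      rw [div_mul_eq_mul_div, div_le_one hc] at h8
      linarith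
    have h := lintegral_le_sqrt_sub (hmx x) (fun a => hW0 _) (sq_nonneg (W x))
      (by positivity : 0 ≤ c / (2 * N)) (hmean x hx) measurableSet_Icc measurableSet_Ici
      (min_le_left _ _ : θ ≤ _) (min_le_right _ _) hℓA hℓB
    refine h.trans ?_
    rw [hw, ← ENNReal.ofReal_mul hρ₀0]
    refine ENNReal.ofReal_le_ofReal ?_
    have h9 : W x ≤ C / N := by rw [le_div_iff₀ hNx, mul_comm]; exact (hb x hx).2
    have h10 : ρ₀ * W x = √((1 - η) * W x ^ 2) := by
      rw [Real.sqrt_mul (by linarith), Real.sqrt_sq (hW0 x)]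
    rw [h10]
    refine Real.sqrt_le_sqrt ?_
    have h11 : η * W x ^ 2 ≤ η * (C / N) ^ 2 := by
      have := hW0 x
      gcongr
    have h12 : η * (C / N) ^ 2 = (c / (2 * N)) ^ 2 * θ / 16 := by
      rw [hη]; field_simp; norm_num
    linarith
  -- near the first axis a step of bounded size leads away from it
  set θ₁ : ℝ := μ.real (Set.Icc 0 1) with hθ₁
  have hθ₁0 : 0 < θ₁ := ENNReal.toReal_pos hμ1 (measure_ne_top _ _)
  set δ : ℝ := (1 - ρ₀) * θ₁ * (c / (2 * C)) with hδ
  have hδ0 : 0 < δ := by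
    have : 0 < 1 - ρ₀ := by linarith
    positivity
  have hδ1 : δ < 1 := by
    have h1 : θ₁ ≤ 1 := measureReal_le_one
    have h2 : c / (2 * C) ≤ 1 / 2 := by
      rw [div_le_div_iff₀ (by positivity) (by positivity)]; linarith
    have h3 : (1 - ρ₀) * θ₁ ≤ 1 := by nlinarith
    have h4 : 0 ≤ c / (2 * C) := by positivity
    nlinarith
  have step3 : ∀ x : ℝ × ℝ, x ≠ 0 → |x.2| < (|x.1| + |x.2|) / 5 →
      avgOp μ realStep (avgOp μ realStep w) x ≤ ENNReal.ofReal (1 - δ) * w x := by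
    intro x hx hx2
    have hNx := hN x hx
    set N := |x.1| + |x.2| with hNdef
    have hgood : ∀ a ∈ Set.Icc (0 : ℝ) 1,
        (|(realStep a x).1| + |(realStep a x).2|) / 5 ≤ |(realStep a x).2| ∧
        |(realStep a x).1| + |(realStep a x).2| ≤ 2 * N := by
      intro a ha
      simp only [realStep, abs_neg]
      have h0 : |a * x.2| ≤ |x.2| := by
        rw [abs_mul, abs_of_nonneg ha.1]; nlinarith [ha.2, abs_nonneg x.2]
      have h1 : |x.1 + a * x.2| ≤ |x.1| + |x.2| := (abs_add_le _ _).trans (by linarith)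
      have h2 : |x.1| - |x.2| ≤ |x.1 + a * x.2| := by
        have := abs_sub_abs_le_abs_sub x.1 (-(a * x.2))
        rw [abs_neg, sub_neg_eq_add] at this
        linarith
      have := abs_nonneg x.1
      constructor <;> linarith
    set v : ℝ≥0∞ := ENNReal.ofReal ((1 - ρ₀) * (c / (2 * N))) with hv
    have hpt : ∀ a, avgOp μ realStep w (realStep a x) + (Set.Icc (0 : ℝ) 1).indicator (fun _ => v) a
        ≤ w (realStep a x) := by
      intro a
      have hy := realStep_ne_zero (a := a) hx
      by_cases ha : a ∈ Set.Icc (0 : ℝ) 1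
      · rw [Set.indicator_of_mem ha]
        obtain ⟨h1, h2⟩ := hgood a ha
        have h3 : c / (2 * N) ≤ W (realStep a x) := by
          have := (hb _ hy).1
          rw [div_le_iff₀ (by positivity)]
          nlinarith [hW0 (realStep a x)]
        calc _ ≤ ENNReal.ofReal ρ₀ * w (realStep a x) +
              ENNReal.ofReal ((1 - ρ₀) * W (realStep a x)) := by
              refine add_le_add (step2 _ hy h1) (ENNReal.ofReal_le_ofReal ?_)
              exact mul_le_mul_of_nonneg_left h3 (by linarith)
          _ = w (realStep a x) := by
              have h4 : 0 ≤ (1 - ρ₀) * W (realStep a x) :=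
                mul_nonneg (by linarith) (hW0 _)
              rw [hw, ← ENNReal.ofReal_mul hρ₀0,
                ← ENNReal.ofReal_add (mul_nonneg hρ₀0 (hW0 _)) h4]
              congr 1; ring
      · rw [Set.indicator_of_notMem ha, add_zero]
        exact step1 _ hy
    have hint := lintegral_mono (μ := μ) hpt
    rw [lintegral_add_right _ (measurable_const.indicator measurableSet_Icc),
      lintegral_indicator_const measurableSet_Icc] at hint
    have hle : avgOp μ realStep (avgOp μ realStep w) x + v * μ (Set.Icc 0 1) ≤ w x :=
      hint.trans (step1 x hx)
    have hvδ : ENNReal.ofReal (δ * W x) ≤ v * μ (Set.Icc 0 1) := by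
      have e : μ (Set.Icc 0 1) = ENNReal.ofReal θ₁ := by
        rw [hθ₁, measureReal_def, ENNReal.ofReal_toReal (measure_ne_top _ _)]
      have hρ' : 0 ≤ 1 - ρ₀ := by linarith
      rw [e, hv, ← ENNReal.ofReal_mul (by positivity)]
      refine ENNReal.ofReal_le_ofReal ?_
      have h9 : W x ≤ C / N := by rw [le_div_iff₀ hNx, mul_comm]; exact (hb x hx).2
      calc δ * W x ≤ δ * (C / N) := mul_le_mul_of_nonneg_left h9 hδ0.le
        _ = (1 - ρ₀) * (c / (2 * N)) * θ₁ := by rw [hδ]; field_simp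
    refine (ENNReal.le_sub_of_add_le_right ENNReal.ofReal_ne_top
      ((add_le_add_right hvδ _).trans hle)).trans ?_
    rw [hw, ← ENNReal.ofReal_sub _ (mul_nonneg hδ0.le (hW0 x)),
      ← ENNReal.ofReal_mul (by linarith)]
    exact ENNReal.ofReal_le_ofReal (by linarith)
  set ρ : ℝ := max ρ₀ (1 - δ) with hρ
  have hρ1 : ENNReal.ofReal ρ < 1 := by
    rw [ENNReal.ofReal_lt_one]
    exact max_lt hρ₀1 (by linarith)
  have step4 : ∀ x ∈ ({0}ᶜ : Set (ℝ × ℝ)),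
      avgOp μ realStep (avgOp μ realStep w) x ≤ ENNReal.ofReal ρ * w x := by
    intro x hx
    have hx : x ≠ 0 := hx
    rcases le_or_gt ((|x.1| + |x.2|) / 5) |x.2| with h | h
    · have h1 : avgOp μ realStep (avgOp μ realStep w) x ≤ avgOp μ realStep w x :=
        lintegral_mono fun a => step1 _ (realStep_ne_zero hx)
      refine (h1.trans (step2 x hx h)).trans ?_
      gcongr
      exact le_max_left _ _
    · refine (step3 x hx h).trans ?_
      gcongr
      exact le_max_right _ _
  have hinv : ∀ a, ∀ x ∈ ({0}ᶜ : Set (ℝ × ℝ)), realStep a x ∈ ({0}ᶜ : Set (ℝ × ℝ)) :=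
    fun a x hx => realStep_ne_zero hx
  have hsum := tsum_iterate_avgOp_lt_top hinv (w := w) (fun x => ENNReal.ofReal_ne_top) hρ1
    step1 step4 (x := x) hx
  have hcmp : ∀ x ∈ ({0}ᶜ : Set (ℝ × ℝ)),
      ENNReal.ofReal (|x.1| + |x.2|)⁻¹ ≤ ENNReal.ofReal c⁻¹ * w x := by
    intro x hx
    have hNx := hN x hx
    rw [hw, ← ENNReal.ofReal_mul (by positivity)]
    refine ENNReal.ofReal_le_ofReal ?_
    have := (hb x hx).1
    rw [inv_mul_eq_div, le_div_iff₀ hc, inv_mul_le_iff₀ hNx]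
    exact this
  calc _ ≤ ∑' n, ENNReal.ofReal c⁻¹ * (avgOp μ realStep)^[n] w x := by
        refine ENNReal.tsum_le_tsum fun n => ?_
        have := iterate_avgOp_mono (μ := μ) hinv hcmp n x hx
        rwa [iterate_avgOp_const_mul ENNReal.ofReal_ne_top] at this
    _ < ∞ := by
        rw [ENNReal.tsum_mul_left]
        exact ENNReal.mul_lt_top ENNReal.ofReal_lt_top hsum

lemma gammaMeasure_Icc_ne_zero {p l x y : ℝ} (hp : 0 < p) (hl : 0 < l) (hx : 0 ≤ x) (hxy : x < y) :
    gammaMeasure p l (Set.Icc x y) ≠ 0 := by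
  unfold gammaMeasure
  intro h
  rw [withDensity_apply _ measurableSet_Icc,
    lintegral_eq_zero_iff (measurable_gammaPDF p l), Filter.EventuallyEq,
    ae_restrict_iff' measurableSet_Icc] at h
  have hv : volume (Set.Ioo x y) = 0 := by
    refine measure_mono_null ?_ (ae_iff.1 h)
    intro a ha hn
    have h1 := gammaPDFReal_pos hp hl (hx.trans_lt ha.1)
    have h2 := hn ⟨ha.1.le, ha.2.le⟩
    rw [Pi.zero_apply, gammaPDF, ENNReal.ofReal_eq_zero] at h2
    exact absurd h1 (not_lt.2 h2)
  rw [Real.volume_Ioo, ENNReal.ofReal_eq_zero] at hv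
  linarith

/-- The averages of the inverse norm along the random products are summable. -/
theorem tsum_iterate_avgOp_gamma_lt_top {p s : ℝ} (hp : 0 < p) (hs : 0 < s)
    {x : ℝ × ℝ} (hx : x ≠ 0) :
    ∑' n, (avgOp (gammaMeasure p (1 / s)) realStep)^[n]
      (fun y => ENNReal.ofReal (|y.1| + |y.2|)⁻¹) x < ∞ := by
  have hl : 0 < 1 / s := by positivity
  have hprob := isProbabilityMeasure_gammaMeasure hp hl
  obtain ⟨F, c, C, hF, hc, hC, hb, hmean⟩ := exists_homogeneous_density hp hs
  have hF0 : ∀ x, x ≠ 0 → 0 ≤ F x := by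
    intro x hx
    by_contra h
    push Not at h
    nlinarith [(hb x hx).1, sq_nonneg x.1, sq_nonneg x.2]
  refine tsum_iterate_avgOp_inv_norm_lt_top (W := fun x => √(F x)) (c := √c) (C := √(2 * C))
    (gammaMeasure_Icc_ne_zero hp hl le_rfl one_pos) ?_ hF.sqrt (Real.sqrt_pos.2 hc)
    (fun x => Real.sqrt_nonneg _) ?_ ?_ hx
  · intro R h
    refine gammaMeasure_Icc_ne_zero hp hl (le_max_right R 0) (lt_add_one _)
      (measure_mono_null ?_ h)
    exact fun a ha => (le_max_left R 0).trans ha.1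
  · intro x hx
    have h0 := hF0 x hx
    have hN : 0 ≤ |x.1| + |x.2| := by positivity
    have e1 := sq_abs x.1
    have e2 := sq_abs x.2
    have e : (|x.1| + |x.2|) * √(F x) = √((|x.1| + |x.2|) ^ 2 * F x) := by
      rw [Real.sqrt_mul (by positivity), Real.sqrt_sq hN]
    rw [e]
    refine ⟨Real.sqrt_le_sqrt ((hb x hx).1.trans ?_), Real.sqrt_le_sqrt ?_⟩
    · refine mul_le_mul_of_nonneg_right ?_ h0
      nlinarith [abs_nonneg x.1, abs_nonneg x.2]
    · have h1 : (|x.1| + |x.2|) ^ 2 ≤ 2 * (x.1 ^ 2 + x.2 ^ 2) := by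
        nlinarith [sq_nonneg (|x.1| - |x.2|)]
      nlinarith [(hb x hx).2]
  · intro x hx
    rw [Real.sq_sqrt (hF0 x hx)]
    refine (le_of_eq (lintegral_congr fun a => ?_)).trans (hmean x hx)
    rw [Real.sq_sqrt (hF0 _ (realStep_ne_zero hx))]

/-! ### A chart of the projective line in homogeneous coordinates -/

/-- The squared Euclidean norm on `ℂ²`. -/
def sqNorm (x : ℂ × ℂ) : ℝ := Complex.normSq x.1 + Complex.normSq x.2

/-- The determinant of a pair of vectors in `ℂ²`. -/
def wedge (x y : ℂ × ℂ) : ℂ := x.1 * y.2 - x.2 * y.1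

/-- Up to an affine map, the point of the Riemann sphere with homogeneous coordinates `x`, by
stereographic projection. -/
noncomputable def sphereChart (x : ℂ × ℂ) : ℂ × ℝ :=
  (x.1 * (starRingEnd ℂ) x.2 / (sqNorm x : ℂ), Complex.normSq x.2 / sqNorm x)

lemma sqNorm_nonneg (x : ℂ × ℂ) : 0 ≤ sqNorm x :=
  add_nonneg (Complex.normSq_nonneg _) (Complex.normSq_nonneg _)

lemma sqNorm_pos {x : ℂ × ℂ} (hx : x ≠ 0) : 0 < sqNorm x := by
  refine (sqNorm_nonneg x).lt_of_ne fun h => hx ?_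
  have h1 := Complex.normSq_nonneg x.1
  have h2 := Complex.normSq_nonneg x.2
  unfold sqNorm at h
  exact Prod.ext (Complex.normSq_eq_zero.1 (by linarith)) (Complex.normSq_eq_zero.1 (by linarith))

lemma measurable_sqNorm : Measurable sqNorm := by
  have : Continuous sqNorm := by
    unfold sqNorm
    exact (Complex.continuous_normSq.comp continuous_fst).add
      (Complex.continuous_normSq.comp continuous_snd)
  exact this.measurable

lemma measurable_sphereChart : Measurable sphereChart := by
  unfold sphereChart
  refine Measurable.prodMk ?_ ?_
  · refine Measurable.div ?_ (Complex.measurable_ofReal.comp measurable_sqNorm)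
    exact measurable_fst.mul (Complex.continuous_conj.measurable.comp measurable_snd)
  · exact (Complex.continuous_normSq.measurable.comp measurable_snd).div measurable_sqNorm

lemma sphereChart_smul {c : ℂ} (hc : c ≠ 0) (x : ℂ × ℂ) : sphereChart (c • x) = sphereChart x := by
  have hn : Complex.normSq c ≠ 0 := by simpa using hc
  have hs : sqNorm (c • x) = Complex.normSq c * sqNorm x := by
    simp only [sqNorm, Prod.smul_fst, Prod.smul_snd, smul_eq_mul, Complex.normSq_mul]; ring
  have hcc : (Complex.normSq c : ℂ) = (starRingEnd ℂ) c * c := Complex.normSq_eq_conj_mul_self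
  have hc' : (starRingEnd ℂ) c ≠ 0 := by simpa using hc
  refine Prod.ext ?_ ?_
  · simp only [sphereChart, hs, Prod.smul_fst, Prod.smul_snd, smul_eq_mul, map_mul]
    push_cast
    rw [hcc]
    have : c * x.1 * ((starRingEnd ℂ) c * (starRingEnd ℂ) x.2) =
        ((starRingEnd ℂ) c * c) * (x.1 * (starRingEnd ℂ) x.2) := by ring
    rw [this, mul_div_mul_left _ _ (mul_ne_zero hc' hc)]
  · simp only [sphereChart, hs, Prod.smul_snd, smul_eq_mul, Complex.normSq_mul]
    rw [mul_div_mul_left _ _ hn]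

/-- In the chart, two points are as close as the angle between the corresponding vectors. -/
lemma dist_sphereChart_le {x y : ℂ × ℂ} (hx : x ≠ 0) (hy : y ≠ 0) :
    dist (sphereChart x) (sphereChart y) ≤
      ‖wedge x y‖ * ((√(sqNorm x))⁻¹ * (√(sqNorm y))⁻¹) := by
  obtain ⟨p, q⟩ := x
  obtain ⟨p', q'⟩ := y
  set N := sqNorm (p, q) with hN
  set N' := sqNorm (p', q') with hN'
  have hN0 : 0 < N := sqNorm_pos hx
  have hN0' : 0 < N' := sqNorm_pos hy
  set w := wedge (p, q) (p', q') with hw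
  have eN : N = ‖p‖ ^ 2 + ‖q‖ ^ 2 := by
    simp only [hN, sqNorm, Complex.normSq_eq_norm_sq]
  have eN' : N' = ‖p'‖ ^ 2 + ‖q'‖ ^ 2 := by
    simp only [hN', sqNorm, Complex.normSq_eq_norm_sq]
  have hcs : ‖p‖ * ‖p'‖ + ‖q‖ * ‖q'‖ ≤ √N * √N' := by
    rw [← Real.sqrt_mul hN0.le]
    refine Real.le_sqrt_of_sq_le ?_
    rw [eN, eN']
    nlinarith [sq_nonneg (‖p‖ * ‖q'‖ - ‖q‖ * ‖p'‖)]
  have hcs' : ‖q‖ * ‖p'‖ + ‖q'‖ * ‖p‖ ≤ √N * √N' := by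
    rw [← Real.sqrt_mul hN0.le]
    refine Real.le_sqrt_of_sq_le ?_
    rw [eN, eN']
    nlinarith [sq_nonneg (‖p‖ * ‖p'‖ - ‖q‖ * ‖q'‖)]
  have hbound : √N * √N' * ‖w‖ / (N * N') = ‖w‖ * ((√N)⁻¹ * (√N')⁻¹) := by
    have h1 := Real.sqrt_pos.2 hN0
    have h2 := Real.sqrt_pos.2 hN0'
    have h3 := Real.mul_self_sqrt hN0.le
    have h4 := Real.mul_self_sqrt hN0'.le
    rw [← h3, ← h4]
    simp only [Real.sqrt_mul_self h1.le, Real.sqrt_mul_self h2.le]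
    field_simp
  rw [← hbound, Prod.dist_eq]
  refine max_le ?_ ?_
  · have hNc : (N : ℂ) = p * (starRingEnd ℂ) p + q * (starRingEnd ℂ) q := by
      rw [hN, sqNorm]; push_cast; rw [Complex.mul_conj, Complex.mul_conj]
    have hNc' : (N' : ℂ) = p' * (starRingEnd ℂ) p' + q' * (starRingEnd ℂ) q' := by
      rw [hN', sqNorm]; push_cast; rw [Complex.mul_conj, Complex.mul_conj]
    have hn : (N : ℂ) ≠ 0 := by exact_mod_cast hN0.ne'
    have hn' : (N' : ℂ) ≠ 0 := by exact_mod_cast hN0'.ne'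
    have e : p * (starRingEnd ℂ) q / (N : ℂ) - p' * (starRingEnd ℂ) q' / (N' : ℂ) =
        (p * p' * (starRingEnd ℂ) (q * p' - q' * p) +
          (starRingEnd ℂ) q * (starRingEnd ℂ) q' * (p * q' - p' * q)) / (N * N') := by
      rw [div_sub_div _ _ hn hn']
      congr 1
      rw [hNc, hNc']
      simp only [map_sub, map_mul]
      ring
    simp only [sphereChart]
    rw [dist_eq_norm, e, norm_div, norm_mul, Complex.norm_of_nonneg hN0.le,
      Complex.norm_of_nonneg hN0'.le]
    refine div_le_div_of_nonneg_right ?_ (by positivity)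
    have h1 : ‖q * p' - q' * p‖ = ‖w‖ := by
      rw [hw, wedge, ← norm_neg]; congr 1; ring
    have h2 : ‖p * q' - p' * q‖ = ‖w‖ := by
      rw [hw, wedge]; congr 1; ring
    calc _ ≤ ‖p‖ * ‖p'‖ * ‖w‖ + ‖q‖ * ‖q'‖ * ‖w‖ := by
          refine (norm_add_le _ _).trans_eq ?_
          simp only [norm_mul, RCLike.norm_conj, h1, h2]
      _ = (‖p‖ * ‖p'‖ + ‖q‖ * ‖q'‖) * ‖w‖ := by ring
      _ ≤ _ := mul_le_mul_of_nonneg_right hcs (norm_nonneg _)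
  · have e : Complex.normSq q / N - Complex.normSq q' / N' =
        ((‖q‖ * ‖p'‖ + ‖q'‖ * ‖p‖) * (‖q * p'‖ - ‖q' * p‖)) / (N * N') := by
      rw [div_sub_div _ _ hN0.ne' hN0'.ne']
      congr 1
      rw [eN, eN', Complex.normSq_eq_norm_sq, Complex.normSq_eq_norm_sq, norm_mul, norm_mul]
      ring
    simp only [sphereChart]
    rw [Real.dist_eq, e, abs_div, abs_of_pos (mul_pos hN0 hN0'), abs_mul,
      abs_of_nonneg (by positivity : 0 ≤ ‖q‖ * ‖p'‖ + ‖q'‖ * ‖p‖)]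
    refine div_le_div_of_nonneg_right ?_ (by positivity)
    refine mul_le_mul hcs' ?_ (abs_nonneg _) (by positivity)
    refine (abs_norm_sub_norm_le _ _).trans_eq ?_
    rw [hw, wedge, ← norm_neg]; congr 1; ring

/-! ### Products of the random matrices -/

/-- The action on `ℂ²` of `!![0, -ε; -ε, a]`, where `ε = iσ`. If `ε² = -1` this matrix has
determinant `1` and is `ε⁻¹` times `!![0, 1; 1, a ε]`. -/
noncomputable def rayStep (σ a : ℝ) (x : ℂ × ℂ) : ℂ × ℂ :=
  (-(Complex.I * σ) * x.2, -(Complex.I * σ) * x.1 + a * x.2)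

lemma measurable_rayStep (σ : ℝ) : Measurable fun q : ℝ × (ℂ × ℂ) => rayStep σ q.1 q.2 := by
  unfold rayStep
  fun_prop

lemma rayStep_smul (σ a : ℝ) (c : ℂ) (x : ℂ × ℂ) : rayStep σ a (c • x) = c • rayStep σ a x := by
  refine Prod.ext ?_ ?_ <;>
  · simp only [rayStep, Prod.smul_fst, Prod.smul_snd, smul_eq_mul]; ring

lemma rayStep_add (σ a : ℝ) (x y : ℂ × ℂ) :
    rayStep σ a (x + y) = rayStep σ a x + rayStep σ a y := by
  refine Prod.ext ?_ ?_ <;>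
  · simp only [rayStep, Prod.fst_add, Prod.snd_add]; ring

lemma I_mul_ofReal_mul_self {σ : ℝ} (hσ : σ * σ = 1) :
    (Complex.I * σ) * (Complex.I * σ) = -1 := by
  have : ((σ : ℂ)) * σ = 1 := by exact_mod_cast hσ
  linear_combination Complex.I * Complex.I * this + Complex.I_mul_I

lemma wedge_rayStep {σ : ℝ} (hσ : σ * σ = 1) (a : ℝ) (x y : ℂ × ℂ) :
    wedge (rayStep σ a x) (rayStep σ a y) = wedge x y := by
  have h := I_mul_ofReal_mul_self hσ
  simp only [wedge, rayStep]
  linear_combination (x.2 * y.1 - x.1 * y.2) * h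

lemma rayStep_ne_zero {σ : ℝ} (hσ : σ * σ = 1) (a : ℝ) {x : ℂ × ℂ} (hx : x ≠ 0) :
    rayStep σ a x ≠ 0 := by
  intro h
  have hε : -(Complex.I * σ) ≠ 0 := by
    intro h0
    have h1 := I_mul_ofReal_mul_self hσ
    rw [neg_eq_zero.1 h0] at h1
    norm_num at h1
  have h1 : -(Complex.I * σ) * x.2 = 0 := congrArg Prod.fst h
  have h2 : -(Complex.I * σ) * x.1 + a * x.2 = 0 := congrArg Prod.snd h
  have h3 : x.2 = 0 := (mul_eq_zero.1 h1).resolve_left hε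
  rw [h3, mul_zero, add_zero] at h2
  exact hx (Prod.ext ((mul_eq_zero.1 h2).resolve_left hε) h3)

/-- The averages of the inverse norm along the products are summable: the real and the imaginary
part of suitably rotated coordinates turn `rayStep` into `realStep`. -/
theorem tsum_iterate_avgOp_rayStep_lt_top {p s σ : ℝ} (hp : 0 < p) (hs : 0 < s) (hσ : σ * σ = 1)
    {x : ℂ × ℂ} (hx : x ≠ 0) :
    ∑' n, (avgOp (gammaMeasure p (1 / s)) (rayStep σ))^[n]
      (fun y => ENNReal.ofReal (√(sqNorm y))⁻¹) x < ∞ := by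
  have hσa : |σ| = 1 := by
    have : |σ| * |σ| = 1 := by rw [← abs_mul, hσ, abs_one]
    nlinarith [abs_nonneg σ]
  have main : ∀ R : ℂ × ℂ → ℝ × ℝ, (∀ a y, R (rayStep σ a y) = realStep a (R y)) →
      (∀ y, |(R y).1| ≤ ‖y.1‖ ∧ |(R y).2| ≤ ‖y.2‖) → R x ≠ 0 →
      ∑' n, (avgOp (gammaMeasure p (1 / s)) (rayStep σ))^[n]
        (fun y => ENNReal.ofReal (√(sqNorm y))⁻¹) x < ∞ := by
    intro R hR hle hRx
    set ψ : ℝ × ℝ → ℝ≥0∞ := fun y => ENNReal.ofReal (|y.1| + |y.2|)⁻¹ with hψ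
    have hS : ∀ a, ∀ y ∈ {y | R y ≠ 0}, rayStep σ a y ∈ {y | R y ≠ 0} := by
      intro a y hy
      change R (rayStep σ a y) ≠ 0
      rw [hR]
      exact realStep_ne_zero hy
    have hcmp : ∀ y ∈ {y | R y ≠ 0}, ENNReal.ofReal (√(sqNorm y))⁻¹ ≤
        ENNReal.ofReal √2 * (ψ ∘ R) y := by
      intro y hy
      have hpos : 0 < |(R y).1| + |(R y).2| := by
        by_contra h
        have h1 := abs_nonneg (R y).1
        have h2 := abs_nonneg (R y).2
        exact hy (Prod.ext (abs_eq_zero.1 (by linarith)) (abs_eq_zero.1 (by linarith)))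
      simp only [hψ, Function.comp_apply]
      rw [← ENNReal.ofReal_mul (Real.sqrt_nonneg _)]
      refine ENNReal.ofReal_le_ofReal ?_
      have h1 : |(R y).1| + |(R y).2| ≤ √2 * √(sqNorm y) := by
        rw [← Real.sqrt_mul (by norm_num)]
        refine Real.le_sqrt_of_sq_le ?_
        have e : sqNorm y = ‖y.1‖ ^ 2 + ‖y.2‖ ^ 2 := by
          simp only [sqNorm, Complex.normSq_eq_norm_sq]
        have h3 : |(R y).1| + |(R y).2| ≤ ‖y.1‖ + ‖y.2‖ := add_le_add (hle y).1 (hle y).2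
        rw [e]
        nlinarith [sq_nonneg (‖y.1‖ - ‖y.2‖), norm_nonneg y.1, norm_nonneg y.2]
      have h2 : 0 < √2 * √(sqNorm y) := hpos.trans_le h1
      have h4 : 0 < √(sqNorm y) := pos_of_mul_pos_right h2 (Real.sqrt_nonneg _)
      rw [← div_eq_mul_inv, le_div_iff₀ hpos, inv_mul_le_iff₀ h4, mul_comm]
      exact h1
    calc _ ≤ ∑' n, ENNReal.ofReal √2 * (avgOp (gammaMeasure p (1 / s)) realStep)^[n] ψ (R x) := by
          refine ENNReal.tsum_le_tsum fun n => ?_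
          have h1 := iterate_avgOp_mono (μ := gammaMeasure p (1 / s)) hS hcmp n x hRx
          rw [iterate_avgOp_const_mul ENNReal.ofReal_ne_top, iterate_avgOp_comp hR] at h1
          exact h1
      _ < ∞ := by
          rw [ENNReal.tsum_mul_left]
          exact ENNReal.mul_lt_top ENNReal.ofReal_lt_top
            (tsum_iterate_avgOp_gamma_lt_top hp hs hRx)
  -- one of the two pairs of real coordinates of `x` does not vanish
  by_cases h1 : ((σ * x.1.im, x.2.re) : ℝ × ℝ) ≠ 0
  · refine main (fun y => (σ * y.1.im, y.2.re)) (fun a y => ?_) (fun y => ?_) h1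
    · refine Prod.ext ?_ ?_
      · simp only [rayStep, realStep, Complex.mul_im, Complex.neg_im, Complex.neg_re,
          Complex.mul_re, Complex.I_re, Complex.I_im, Complex.ofReal_re, Complex.ofReal_im]
        linear_combination -y.2.re * hσ
      · simp [rayStep, realStep]
    · rw [abs_mul, hσa, one_mul]
      exact ⟨Complex.abs_im_le_norm _, Complex.abs_re_le_norm _⟩
  · refine main (fun y => (-σ * y.1.re, y.2.im)) (fun a y => ?_) (fun y => ?_) ?_
    · refine Prod.ext ?_ ?_
      · simp only [rayStep, realStep, Complex.mul_im, Complex.neg_im, Complex.neg_re,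
          Complex.mul_re, Complex.I_re, Complex.I_im, Complex.ofReal_re, Complex.ofReal_im]
        linear_combination -y.2.im * hσ
      · simp [rayStep, realStep]
    · rw [abs_mul, abs_neg, hσa, one_mul]
      exact ⟨Complex.abs_re_le_norm _, Complex.abs_im_le_norm _⟩
    · intro h2
      push Not at h1
      have hσ0 : σ ≠ 0 := by rintro rfl; norm_num at hσ
      have e1 : σ * x.1.im = 0 := congrArg Prod.fst h1
      have e2 : x.2.re = 0 := congrArg Prod.snd h1
      have e3 : -σ * x.1.re = 0 := congrArg Prod.fst h2
      have e4 : x.2.im = 0 := congrArg Prod.snd h2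
      refine hx (Prod.ext (Complex.ext ?_ ?_) (Complex.ext e2 e4))
      · exact (mul_eq_zero.1 e3).resolve_left (neg_ne_zero.2 hσ0)
      · exact (mul_eq_zero.1 e1).resolve_left hσ0

/-- The product of the first `n` matrices, applied to a vector; the matrices are multiplied on the
right, as in a continued fraction. -/
noncomputable def rayProd (σ : ℝ) (b : ℕ → ℝ) : ℕ → ℂ × ℂ → ℂ × ℂ
  | 0, x => x
  | n + 1, x => rayProd σ b n (rayStep σ (b n) x)

lemma rayProd_smul (σ : ℝ) (b : ℕ → ℝ) (n : ℕ) (c : ℂ) (x : ℂ × ℂ) :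
    rayProd σ b n (c • x) = c • rayProd σ b n x := by
  induction n generalizing x with
  | zero => rfl
  | succ n ih => simp only [rayProd]; rw [rayStep_smul, ih]

lemma rayProd_add (σ : ℝ) (b : ℕ → ℝ) (n : ℕ) (x y : ℂ × ℂ) :
    rayProd σ b n (x + y) = rayProd σ b n x + rayProd σ b n y := by
  induction n generalizing x y with
  | zero => rfl
  | succ n ih => simp only [rayProd]; rw [rayStep_add, ih]

lemma wedge_rayProd {σ : ℝ} (hσ : σ * σ = 1) (b : ℕ → ℝ) (n : ℕ) (x y : ℂ × ℂ) :
    wedge (rayProd σ b n x) (rayProd σ b n y) = wedge x y := by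
  induction n generalizing x y with
  | zero => rfl
  | succ n ih => simp only [rayProd]; rw [ih, wedge_rayStep hσ]

lemma rayProd_ne_zero {σ : ℝ} (hσ : σ * σ = 1) (b : ℕ → ℝ) (n : ℕ) {x : ℂ × ℂ} (hx : x ≠ 0) :
    rayProd σ b n x ≠ 0 := by
  induction n generalizing x with
  | zero => exact hx
  | succ n ih => exact ih (rayStep_ne_zero hσ _ hx)

lemma rayProd_congr {σ : ℝ} {b b' : ℕ → ℝ} {n : ℕ} (h : ∀ i < n, b i = b' i) (x : ℂ × ℂ) :
    rayProd σ b n x = rayProd σ b' n x := by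
  induction n generalizing x with
  | zero => rfl
  | succ n ih =>
    simp only [rayProd]
    rw [h n (Nat.lt_succ_self n), ih fun i hi => h i (Nat.lt_succ_of_lt hi)]

lemma measurable_rayProd (σ : ℝ) (n : ℕ) :
    Measurable fun q : (ℕ → ℝ) × (ℂ × ℂ) => rayProd σ q.1 n q.2 := by
  induction n with
  | zero => exact measurable_snd
  | succ n ih =>
    have h1 : Measurable fun q : (ℕ → ℝ) × (ℂ × ℂ) => (q.1 n, q.2) :=
      ((measurable_pi_apply n).comp measurable_fst).prodMk measurable_snd
    have h2 : Measurable fun q : (ℕ → ℝ) × (ℂ × ℂ) => rayStep σ (q.1 n) q.2 :=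
      (measurable_rayStep σ).comp h1
    exact ih.comp (measurable_fst.prodMk h2)

section RandomProducts

variable {Ω : Type*} [MeasurableSpace Ω] {P : Measure Ω} [IsProbabilityMeasure P]
  {a : ℕ → Ω → ℝ} {μ : Measure ℝ} [IsProbabilityMeasure μ]

/-- The expectation of a function of the random product is an iterated average. -/
lemma lintegral_rayProd (hmeas : ∀ n, Measurable (a n)) (hindep : iIndepFun a P)
    (hlaw : ∀ n, P.map (a n) = μ) (σ : ℝ) {φ : ℂ × ℂ → ℝ≥0∞} (hφ : Measurable φ) (n : ℕ)
    (x : ℂ × ℂ) :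
    ∫⁻ ω, φ (rayProd σ (fun k => a k ω) n x) ∂P = (avgOp μ (rayStep σ))^[n] φ x := by
  induction n generalizing x with
  | zero => simp [rayProd]
  | succ n ih =>
    rw [Function.iterate_succ_apply']
    -- the first `n` coefficients as a random vector, and their extension by zero to a sequence
    set X : Ω → (Finset.range n → ℝ) := fun ω i => a i ω with hX
    have hXm : Measurable X := measurable_pi_lambda _ fun i => hmeas i
    set E : (Finset.range n → ℝ) → ℕ → ℝ := fun t i =>
      if h : i ∈ Finset.range n then t ⟨i, h⟩ else 0 with hE
    have hEm : Measurable E := by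
      refine measurable_pi_lambda _ fun i => ?_
      by_cases h : i ∈ Finset.range n
      · simp only [hE, h, dif_pos]; exact measurable_pi_apply _
      · simp only [hE, h, dif_neg, not_false_eq_true]; exact measurable_const
    have hEX : ∀ ω y, rayProd σ (E (X ω)) n y = rayProd σ (fun k => a k ω) n y := by
      intro ω y
      refine rayProd_congr (fun i hi => ?_) y
      simp [hE, hX, hi]
    have hind : IndepFun X (a n) P := by
      have h := hindep.indepFun_finset (Finset.range n) {n} (by simp) hmeas
      exact h.comp (φ := id) (ψ := fun t : (({n} : Finset ℕ) → ℝ) => t ⟨n, by simp⟩)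
        measurable_id (measurable_pi_apply _)
    have hprod : P.map (fun ω => (X ω, a n ω)) = (P.map X).prod μ := by
      rw [(indepFun_iff_map_prod_eq_prod_map_map hXm.aemeasurable (hmeas n).aemeasurable).1 hind,
        hlaw]
    have hXp : IsProbabilityMeasure (P.map X) := Measure.isProbabilityMeasure_map hXm.aemeasurable
    have hΨ : Measurable fun q : (Finset.range n → ℝ) × ℝ =>
        φ (rayProd σ (E q.1) n (rayStep σ q.2 x)) :=
      hφ.comp ((measurable_rayProd σ n).comp ((hEm.comp measurable_fst).prodMk
        ((measurable_rayStep σ).comp (measurable_snd.prodMk measurable_const))))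
    calc ∫⁻ ω, φ (rayProd σ (fun k => a k ω) (n + 1) x) ∂P
        = ∫⁻ ω, φ (rayProd σ (E (X ω)) n (rayStep σ (a n ω) x)) ∂P := by
          simp only [hEX, rayProd]
      _ = ∫⁻ q, φ (rayProd σ (E q.1) n (rayStep σ q.2 x)) ∂((P.map X).prod μ) := by
          rw [← hprod, lintegral_map hΨ (hXm.prodMk (hmeas n))]
      _ = ∫⁻ c, ∫⁻ t, φ (rayProd σ (E t) n (rayStep σ c x)) ∂(P.map X) ∂μ :=
          lintegral_prod_symm' _ hΨ
      _ = ∫⁻ c, (avgOp μ (rayStep σ))^[n] φ (rayStep σ c x) ∂μ := by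
          refine lintegral_congr fun c => ?_
          have hΨc : Measurable fun t => φ (rayProd σ (E t) n (rayStep σ c x)) :=
            hΨ.comp measurable_prodMk_right
          rw [lintegral_map hΨc hXm, ← ih]
          simp only [hEX]

/-- Almost surely the inverse norms of the random products are summable. -/
lemma ae_summable_inv_rayProd {p s : ℝ} (hp : 0 < p) (hs : 0 < s)
    (hmeas : ∀ n, Measurable (a n)) (hindep : iIndepFun a P)
    (hlaw : ∀ n, P.map (a n) = gammaMeasure p (1 / s)) {σ : ℝ} (hσ : σ * σ = 1) {x : ℂ × ℂ}
    (hx : x ≠ 0) :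
    ∀ᵐ ω ∂P, Summable fun n => (√(sqNorm (rayProd σ (fun k => a k ω) n x)))⁻¹ := by
  have hprob : IsProbabilityMeasure (gammaMeasure p (1 / s)) :=
    isProbabilityMeasure_gammaMeasure hp (by positivity)
  have hφ : Measurable fun y => ENNReal.ofReal (√(sqNorm y))⁻¹ :=
    measurable_sqNorm.sqrt.inv.ennreal_ofReal
  have hm : ∀ n, Measurable fun ω =>
      ENNReal.ofReal (√(sqNorm (rayProd σ (fun k => a k ω) n x)))⁻¹ := fun n =>
    hφ.comp ((measurable_rayProd σ n).comp
      ((measurable_pi_lambda _ hmeas).prodMk measurable_const))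
  have hsum : ∫⁻ ω, ∑' n, ENNReal.ofReal (√(sqNorm (rayProd σ (fun k => a k ω) n x)))⁻¹ ∂P ≠ ∞ := by
    rw [lintegral_tsum fun n => (hm n).aemeasurable]
    simp only [lintegral_rayProd hmeas hindep hlaw σ hφ]
    exact (tsum_iterate_avgOp_rayStep_lt_top hp hs hσ hx).ne
  filter_upwards [ae_lt_top (Measurable.tsum hm) hsum] with ω hω
  refine (ENNReal.summable_toReal hω.ne).congr fun n => ?_
  rw [ENNReal.toReal_ofReal (by positivity)]

/-- The random products applied to a vector converge almost surely in the projective line, and the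
limit does not depend on the vector. -/
theorem exists_limit_rayProd {p s : ℝ} (hp : 0 < p) (hs : 0 < s)
    (hmeas : ∀ n, Measurable (a n)) (hindep : iIndepFun a P)
    (hlaw : ∀ n, P.map (a n) = gammaMeasure p (1 / s)) {σ : ℝ} (hσ : σ * σ = 1) :
    ∃ ζ : Ω → ℂ × ℝ, Measurable ζ ∧ ∀ x : ℂ × ℂ, x ≠ 0 → ∀ᵐ ω ∂P,
      Tendsto (fun n => sphereChart (rayProd σ (fun k => a k ω) n x)) atTop (𝓝 (ζ ω)) := by
  have he : ((0, 1) : ℂ × ℂ) ≠ 0 := by simp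
  have hI : ‖-(Complex.I * (σ : ℂ))‖ = 1 := by
    have h := congrArg norm (I_mul_ofReal_mul_self hσ)
    rw [norm_mul, norm_neg, norm_one] at h
    rw [norm_neg]
    nlinarith [norm_nonneg (Complex.I * (σ : ℂ))]
  have hsum := ae_summable_inv_rayProd hp hs hmeas hindep hlaw hσ he
  have hconv : ∀ᵐ ω ∂P, ∃ z, Tendsto
      (fun n => sphereChart (rayProd σ (fun k => a k ω) n (0, 1))) atTop (𝓝 z) := by
    filter_upwards [hsum] with ω hω
    set b : ℕ → ℝ := fun k => a k ω
    set u : ℕ → ℝ := fun n => (√(sqNorm (rayProd σ b n (0, 1))))⁻¹ with hu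
    have hu0 : ∀ n, 0 ≤ u n := fun n => by positivity
    refine cauchySeq_tendsto_of_complete (cauchySeq_of_summable_dist ?_)
    -- consecutive vectors have a determinant of modulus one
    refine Summable.of_nonneg_of_le (fun n => dist_nonneg) (fun n => ?_) (hω.mul_right (∑' k, u k))
    have h1 := dist_sphereChart_le (rayProd_ne_zero hσ b n he) (rayProd_ne_zero hσ b (n + 1) he)
    have h2 : wedge (rayProd σ b n (0, 1)) (rayProd σ b (n + 1) (0, 1)) =
        -(-(Complex.I * σ)) := by
      simp only [rayProd]
      rw [wedge_rayProd hσ]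
      simp [wedge, rayStep]
    rw [h2, norm_neg, hI, one_mul] at h1
    exact h1.trans (mul_le_mul_of_nonneg_left (hω.le_tsum _ fun k _ => hu0 k) (hu0 n))
  have hm : ∀ n, AEMeasurable
      (fun ω => sphereChart (rayProd σ (fun k => a k ω) n (0, 1))) P := fun n =>
    (measurable_sphereChart.comp ((measurable_rayProd σ n).comp
      ((measurable_pi_lambda _ hmeas).prodMk measurable_const))).aemeasurable
  obtain ⟨ζ, hζ, hlim⟩ := measurable_limit_of_tendsto_metrizable_ae hm hconv
  refine ⟨ζ, hζ, fun x hx => ?_⟩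
  filter_upwards [hlim, hsum, ae_summable_inv_rayProd hp hs hmeas hindep hlaw hσ hx]
    with ω h1 h2 h3
  set b : ℕ → ℝ := fun k => a k ω
  refine tendsto_iff_dist_tendsto_zero.2 ?_
  have h4 := (h3.tendsto_atTop_zero.mul h2.tendsto_atTop_zero).const_mul ‖wedge x (0, 1)‖
  have h5 := h4.add (tendsto_iff_dist_tendsto_zero.1 h1)
  simp only [mul_zero, add_zero] at h5
  refine squeeze_zero (fun n => dist_nonneg) (fun n => ?_) h5
  refine (dist_triangle _ (sphereChart (rayProd σ b n (0, 1))) _).trans ?_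
  refine add_le_add_left ?_ _
  have h6 := dist_sphereChart_le (rayProd_ne_zero hσ b n hx) (rayProd_ne_zero hσ b n he)
  rwa [wedge_rayProd hσ] at h6

end RandomProducts

/-! ### Invariant measures on the projective line -/

/-- Homogeneous coordinates of a point of `ℂ ∪ {∞}`. -/
def homCoord (z : OnePoint ℂ) : ℂ × ℂ := z.elim (1, 0) fun w => (w, 1)

/-- The inverse of the chart `sphereChart ∘ homCoord`. -/
noncomputable def ofSphereChart (q : ℂ × ℝ) : OnePoint ℂ :=
  if q.2 = 0 then OnePoint.infty else ((q.1 / (q.2 : ℂ) : ℂ) : OnePoint ℂ)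

@[simp] lemma homCoord_infty : homCoord OnePoint.infty = (1, 0) := rfl

@[simp] lemma homCoord_coe (w : ℂ) : homCoord (w : OnePoint ℂ) = (w, 1) := rfl

lemma homCoord_ne_zero (z : OnePoint ℂ) : homCoord z ≠ 0 := by
  induction z using OnePoint.rec <;> simp

lemma measurable_coe_onePoint : Measurable ((↑) : ℂ → OnePoint ℂ) :=
  OnePoint.continuous_coe.measurable

lemma measurable_homCoord : Measurable homCoord := by
  intro S hS
  have he : MeasurableEmbedding ((↑) : ℂ → OnePoint ℂ) :=
    OnePoint.isOpenEmbedding_coe.measurableEmbedding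
  have h1 : MeasurableSet ((↑) '' ((fun w : ℂ => ((w, 1) : ℂ × ℂ)) ⁻¹' S) : Set (OnePoint ℂ)) :=
    he.measurableSet_image.2 (measurable_prodMk_right hS)
  have h2 : MeasurableSet ({OnePoint.infty} : Set (OnePoint ℂ)) := measurableSet_singleton _
  by_cases h : ((1, 0) : ℂ × ℂ) ∈ S
  · convert h1.union h2 using 1
    ext z
    induction z using OnePoint.rec <;> simp [h]
  · convert h1 using 1
    ext z
    induction z using OnePoint.rec <;> simp [h]

lemma measurable_ofSphereChart : Measurable ofSphereChart := by
  refine Measurable.ite (measurable_snd (measurableSet_singleton 0)) measurable_const ?_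
  exact measurable_coe_onePoint.comp
    (measurable_fst.div (Complex.measurable_ofReal.comp measurable_snd))

lemma ofSphereChart_sphereChart_homCoord (z : OnePoint ℂ) :
    ofSphereChart (sphereChart (homCoord z)) = z := by
  induction z using OnePoint.rec with
  | infty => simp [ofSphereChart, sphereChart]
  | coe w =>
    have h : sqNorm (w, 1) ≠ 0 := (sqNorm_pos (by simp)).ne'
    have hc : (sqNorm (w, 1) : ℂ) ≠ 0 := by exact_mod_cast h
    simp only [homCoord_coe, ofSphereChart, sphereChart, map_one, one_div, inv_eq_zero, h, if_false,
      mul_one, Complex.ofReal_inv]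
    congr 1
    field_simp

/-- In homogeneous coordinates the projective action is linear. -/
lemma exists_rayStep_homCoord {α σ : ℝ} (hσ : σ * σ = 1)
    (hα : Complex.exp (Complex.I * α) = Complex.I * σ) (a : ℝ) (z : OnePoint ℂ) :
    ∃ c : ℂ, c ≠ 0 ∧ rayStep σ a (homCoord z) = c • homCoord (cfMatrix α a • z) := by
  have hI := I_mul_ofReal_mul_self hσ
  have hI0 : Complex.I * (σ : ℂ) ≠ 0 := by
    intro h; rw [h] at hI; norm_num at hI
  have e00 : (cfMatrix α a) 0 0 = 0 := rfl
  have e01 : (cfMatrix α a) 0 1 = 1 := rfl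
  have e10 : (cfMatrix α a) 1 0 = 1 := rfl
  have e11 : (cfMatrix α a) 1 1 = (a : ℂ) * (Complex.I * σ) := by
    rw [← hα]; rfl
  induction z using OnePoint.rec with
  | infty =>
    rw [OnePoint.smul_infty_eq_ite, e00, e10, if_neg one_ne_zero]
    exact ⟨-(Complex.I * σ), neg_ne_zero.2 hI0, by simp [rayStep]⟩
  | coe w =>
    rw [OnePoint.smul_some_eq_ite, e00, e01, e10, e11]
    by_cases h : 1 * w + (a : ℂ) * (Complex.I * σ) = 0
    · rw [if_pos h]
      refine ⟨-(Complex.I * σ), neg_ne_zero.2 hI0, Prod.ext ?_ ?_⟩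
      · simp [rayStep]
      · simp only [rayStep, homCoord_coe, homCoord_infty, Prod.smul_snd, smul_eq_mul, mul_zero]
        linear_combination (-(Complex.I * σ)) * h + (a : ℂ) * hI
    · rw [if_neg h]
      set d := 1 * w + (a : ℂ) * (Complex.I * σ) with hd
      refine ⟨-(Complex.I * σ) * d, mul_ne_zero (neg_ne_zero.2 hI0) h, Prod.ext ?_ ?_⟩
      · simp only [rayStep, homCoord_coe, Prod.smul_fst, smul_eq_mul]
        field_simp
        ring
      · simp only [rayStep, homCoord_coe, Prod.smul_snd, smul_eq_mul, mul_one]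
        rw [hd]
        linear_combination (a : ℂ) * hI

lemma sphereChart_homCoord_smul {α σ : ℝ} (hσ : σ * σ = 1)
    (hα : Complex.exp (Complex.I * α) = Complex.I * σ) (a : ℝ) (z : OnePoint ℂ) :
    sphereChart (homCoord (cfMatrix α a • z)) = sphereChart (rayStep σ a (homCoord z)) := by
  obtain ⟨c, hc, h⟩ := exists_rayStep_homCoord hσ hα a z
  rw [h, sphereChart_smul hc]

lemma measurable_cfMatrix_smul {α σ : ℝ} (hσ : σ * σ = 1)
    (hα : Complex.exp (Complex.I * α) = Complex.I * σ) :
    Measurable fun q : ℝ × OnePoint ℂ => cfMatrix α q.1 • q.2 := by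
  have h : (fun q : ℝ × OnePoint ℂ => cfMatrix α q.1 • q.2) =
      fun q => ofSphereChart (sphereChart (rayStep σ q.1 (homCoord q.2))) := by
    funext q
    rw [← sphereChart_homCoord_smul hσ hα, ofSphereChart_sphereChart_homCoord]
  rw [h]
  have h1 : Measurable fun q : ℝ × OnePoint ℂ => rayStep σ q.1 (homCoord q.2) :=
    (measurable_rayStep σ).comp (measurable_fst.prodMk (measurable_homCoord.comp measurable_snd))
  exact measurable_ofSphereChart.comp (measurable_sphereChart.comp h1)

lemma isInvariantMeasure_iff {α σ : ℝ} (hσ : σ * σ = 1)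
    (hα : Complex.exp (Complex.I * α) = Complex.I * σ) {μ : Measure ℝ} [SFinite μ]
    {ν : Measure (OnePoint ℂ)} [SFinite ν] :
    IsInvariantMeasure α μ ν ↔
      (μ.prod ν).map (fun q : ℝ × OnePoint ℂ => cfMatrix α q.1 • q.2) = ν := by
  have hm := measurable_cfMatrix_smul hσ hα
  have key : ∀ B : Set (OnePoint ℂ), MeasurableSet B →
      (μ.prod ν).map (fun q : ℝ × OnePoint ℂ => cfMatrix α q.1 • q.2) B =
        ∫⁻ a, ν ((fun z : OnePoint ℂ => cfMatrix α a • z) ⁻¹' B) ∂μ := by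
    intro B hB
    rw [Measure.map_apply hm hB, Measure.prod_apply (hm hB)]
    rfl
  constructor
  · intro h
    refine Measure.ext fun B hB => ?_
    rw [key B hB, h B hB]
  · intro h B hB
    rw [← key B hB, h]

/-- The averages of a function on the projective line are functions on the projective line. -/
lemma iterate_avgOp_rayStep_smul {μ : Measure ℝ} (σ : ℝ) {φ : ℂ × ℂ → ℝ≥0∞}
    (hφ : ∀ (c : ℂ) (x : ℂ × ℂ), c ≠ 0 → φ (c • x) = φ x) (n : ℕ) (c : ℂ) (x : ℂ × ℂ)
    (hc : c ≠ 0) : (avgOp μ (rayStep σ))^[n] φ (c • x) = (avgOp μ (rayStep σ))^[n] φ x := by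
  induction n generalizing x with
  | zero => exact hφ c x hc
  | succ n ih =>
    rw [Function.iterate_succ_apply']
    unfold avgOp at ih ⊢
    simp only [rayStep_smul, ih]

section Uniqueness

variable {Ω : Type*} [MeasurableSpace Ω] {P : Measure Ω} [IsProbabilityMeasure P]
  {a : ℕ → Ω → ℝ} {μ : Measure ℝ} [IsProbabilityMeasure μ]

/-- An invariant measure does not change when it is transported by a random product. -/
lemma lintegral_iterate_avgOp_homCoord {α σ : ℝ} (hσ : σ * σ = 1)
    (hα : Complex.exp (Complex.I * α) = Complex.I * σ) {ν : Measure (OnePoint ℂ)}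
    [IsProbabilityMeasure ν] (hν : IsInvariantMeasure α μ ν) {φ : ℂ × ℂ → ℝ≥0∞}
    (hφm : Measurable φ) (hφ : ∀ (c : ℂ) (x : ℂ × ℂ), c ≠ 0 → φ (c • x) = φ x) (n : ℕ) :
    ∫⁻ z, (avgOp μ (rayStep σ))^[n] φ (homCoord z) ∂ν = ∫⁻ z, φ (homCoord z) ∂ν := by
  induction n with
  | zero => rfl
  | succ n ih =>
    set ψ := (avgOp μ (rayStep σ))^[n] φ with hψ
    have hψm : Measurable ψ := measurable_iterate_avgOp (measurable_rayStep σ) hφm n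
    have hm := measurable_cfMatrix_smul hσ hα
    have hm' : Measurable fun z => ψ (homCoord z) := hψm.comp measurable_homCoord
    rw [← ih, Function.iterate_succ_apply', ← hψ]
    have h1 : ∀ a z, ψ (rayStep σ a (homCoord z)) = ψ (homCoord (cfMatrix α a • z)) := by
      intro a z
      obtain ⟨c, hc, h⟩ := exists_rayStep_homCoord hσ hα a z
      rw [h, hψ, iterate_avgOp_rayStep_smul σ hφ n c _ hc]
    simp only [avgOp, h1]
    conv_rhs => rw [← (isInvariantMeasure_iff hσ hα).1 hν, lintegral_map hm' hm]
    exact (lintegral_prod_symm' _ (hm'.comp hm)).symm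

/-- Every invariant measure is the law of the limit of the random products. -/
theorem map_sphereChart_homCoord_eq {α σ : ℝ} (hσ : σ * σ = 1)
    (hα : Complex.exp (Complex.I * α) = Complex.I * σ)
    (hmeas : ∀ n, Measurable (a n)) (hindep : iIndepFun a P) (hlaw : ∀ n, P.map (a n) = μ)
    {ζ : Ω → ℂ × ℝ} (hζ : Measurable ζ)
    (hlim : ∀ x : ℂ × ℂ, x ≠ 0 → ∀ᵐ ω ∂P,
      Tendsto (fun n => sphereChart (rayProd σ (fun k => a k ω) n x)) atTop (𝓝 (ζ ω)))
    {ν : Measure (OnePoint ℂ)} [IsProbabilityMeasure ν] (hν : IsInvariantMeasure α μ ν) :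
    ν.map (fun z => sphereChart (homCoord z)) = P.map ζ := by
  have hch : Measurable fun z => sphereChart (homCoord z) :=
    measurable_sphereChart.comp measurable_homCoord
  have := Measure.isProbabilityMeasure_map (μ := ν) hch.aemeasurable
  have := Measure.isProbabilityMeasure_map (μ := P) hζ.aemeasurable
  refine ext_of_forall_lintegral_eq_of_IsFiniteMeasure fun f => ?_
  have hfm : Measurable fun q => (f q : ℝ≥0∞) := f.continuous.measurable.coe_nnreal_ennreal
  rw [lintegral_map hfm hch, lintegral_map hfm hζ]
  set φ : ℂ × ℂ → ℝ≥0∞ := fun x => (f (sphereChart x) : ℝ≥0∞) with hφ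
  have hφm : Measurable φ := hfm.comp measurable_sphereChart
  have hφs : ∀ (c : ℂ) (x : ℂ × ℂ), c ≠ 0 → φ (c • x) = φ x := by
    intro c x hc
    simp only [hφ, sphereChart_smul hc]
  obtain ⟨K, hK⟩ : ∃ K : NNReal, ∀ q, f q ≤ K := by
    refine ⟨nndist f 0, fun q => ?_⟩
    have := BoundedContinuousFunction.NNReal.upper_bound f q
    exact this
  have hb : ∀ x, φ x ≤ K := fun x => ENNReal.coe_le_coe.2 (hK _)
  -- for each starting point the averages converge to the mean of the limit
  have h1 : ∀ x : ℂ × ℂ, x ≠ 0 → Tendsto (fun n => (avgOp μ (rayStep σ))^[n] φ x) atTop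
      (𝓝 (∫⁻ ω, (f (ζ ω) : ℝ≥0∞) ∂P)) := by
    intro x hx
    have h2 : ∀ n, (avgOp μ (rayStep σ))^[n] φ x =
        ∫⁻ ω, φ (rayProd σ (fun k => a k ω) n x) ∂P := fun n =>
      (lintegral_rayProd hmeas hindep hlaw σ hφm n x).symm
    simp only [h2]
    refine tendsto_lintegral_of_dominated_convergence (fun _ => (K : ℝ≥0∞)) (fun n => ?_)
      (fun n => Eventually.of_forall fun ω => hb _) ?_ ?_
    · exact hφm.comp ((measurable_rayProd σ n).comp
        ((measurable_pi_lambda _ hmeas).prodMk measurable_const))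
    · rw [lintegral_const, measure_univ, mul_one]; exact ENNReal.coe_ne_top
    · filter_upwards [hlim x hx] with ω hω
      exact (ENNReal.continuous_coe.comp f.continuous).continuousAt.tendsto.comp hω
  have h3 : Tendsto (fun n => ∫⁻ z, (avgOp μ (rayStep σ))^[n] φ (homCoord z) ∂ν) atTop
      (𝓝 (∫⁻ _, (∫⁻ ω, (f (ζ ω) : ℝ≥0∞) ∂P) ∂ν)) := by
    refine tendsto_lintegral_of_dominated_convergence (fun _ => (K : ℝ≥0∞)) (fun n => ?_)
      (fun n => Eventually.of_forall fun z => ?_) ?_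
      (Eventually.of_forall fun z => h1 _ (homCoord_ne_zero z))
    · exact (measurable_iterate_avgOp (measurable_rayStep σ) hφm n).comp measurable_homCoord
    · change (avgOp μ (rayStep σ))^[n] φ (homCoord z) ≤ K
      rw [← lintegral_rayProd hmeas hindep hlaw σ hφm n]
      refine (lintegral_mono fun ω => hb _).trans ?_
      rw [lintegral_const, measure_univ, mul_one]
    · rw [lintegral_const, measure_univ, mul_one]; exact ENNReal.coe_ne_top
  simp only [lintegral_iterate_avgOp_homCoord hσ hα hν hφm hφs] at h3
  rw [lintegral_const, measure_univ, mul_one] at h3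
  exact tendsto_nhds_unique tendsto_const_nhds h3

end Uniqueness

lemma eq_of_map_sphereChart_homCoord_eq {ν ν' : Measure (OnePoint ℂ)}
    (h : ν.map (fun z => sphereChart (homCoord z)) = ν'.map fun z => sphereChart (homCoord z)) :
    ν = ν' := by
  have hch : Measurable fun z => sphereChart (homCoord z) :=
    measurable_sphereChart.comp measurable_homCoord
  have key : ∀ κ : Measure (OnePoint ℂ),
      (κ.map fun z => sphereChart (homCoord z)).map ofSphereChart = κ := by
    intro κ
    rw [Measure.map_map measurable_ofSphereChart hch]
    have : ofSphereChart ∘ (fun z => sphereChart (homCoord z)) = id := by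
      funext z; exact ofSphereChart_sphereChart_homCoord z
    rw [this, Measure.map_id]
  rw [← key ν, h, key ν']

/-! ### The measure on the imaginary axis -/

lemma measurable_axisDensity {p s σ : ℝ} (hp : 0 < p) (hs : 0 < s) (hσ : σ = 1 ∨ σ = -1) :
    Measurable (axisDensity p s σ) := by
  rcases hσ with rfl | rfl
  · exact measurable_axisDensity_one hp hs
  · have h : axisDensity p s (-1) = fun y => axisDensity p s 1 (-y) := by
      funext y; exact axisDensity_neg_sign p s y hp
    rw [h]
    exact (measurable_axisDensity_one hp hs).comp measurable_neg

lemma measurable_ofReal_mul_I : Measurable fun y : ℝ => (y : ℂ) * Complex.I :=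
  Complex.measurable_ofReal.mul_const _

/-- Integration along the axis, in the coordinate in which the density does not depend on the
sign. -/
lemma lintegral_axisMeasure {p s σ : ℝ} (hp : 0 < p) (hs : 0 < s) (hσ : σ = 1 ∨ σ = -1)
    {φ : ℂ → ℝ≥0∞} (hφ : Measurable φ) :
    ∫⁻ z, φ z ∂axisMeasure p s σ =
      ∫⁻ y : ℝ, ENNReal.ofReal (axisDensity p s 1 y) * φ (((σ * y : ℝ) : ℂ) * Complex.I) := by
  have hφ' : Measurable fun y : ℝ => φ ((y : ℂ) * Complex.I) := hφ.comp measurable_ofReal_mul_I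
  unfold axisMeasure
  rw [lintegral_map hφ measurable_ofReal_mul_I,
    lintegral_withDensity_eq_lintegral_mul _ (measurable_axisDensity hp hs hσ).ennreal_ofReal hφ']
  rcases hσ with rfl | rfl
  · simp only [one_mul, Pi.mul_apply]
  · rw [← lintegral_neg_eq_self]
    simp only [Pi.mul_apply, axisDensity_neg_sign p s _ hp, neg_neg, neg_mul, one_mul]

lemma isProbabilityMeasure_axisMeasure {p s σ : ℝ} (hp : 0 < p) (hs : 0 < s)
    (hσ : σ = 1 ∨ σ = -1) : IsProbabilityMeasure (axisMeasure p s σ) := by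
  constructor
  rw [← lintegral_one, lintegral_axisMeasure hp hs hσ measurable_const]
  simp only [mul_one]
  exact lintegral_axisDensity_one hp hs

lemma isProbabilityMeasure_axisMeasureProj {p s σ : ℝ} (hp : 0 < p) (hs : 0 < s)
    (hσ : σ = 1 ∨ σ = -1) : IsProbabilityMeasure (axisMeasureProj p s σ) := by
  have := isProbabilityMeasure_axisMeasure hp hs hσ
  exact Measure.isProbabilityMeasure_map measurable_coe_onePoint.aemeasurable

lemma axisMeasureProj_apply {p s σ : ℝ} (hp : 0 < p) (hs : 0 < s) (hσ : σ = 1 ∨ σ = -1)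
    {B : Set (OnePoint ℂ)} (hB : MeasurableSet B) :
    axisMeasureProj p s σ B = ∫⁻ y : ℝ, ENNReal.ofReal (axisDensity p s 1 y) *
      B.indicator 1 ((((σ * y : ℝ) : ℂ) * Complex.I : ℂ) : OnePoint ℂ) := by
  have hm : Measurable (B.indicator (1 : OnePoint ℂ → ℝ≥0∞)) := measurable_one.indicator hB
  have hm' : Measurable fun z : ℂ => B.indicator (1 : OnePoint ℂ → ℝ≥0∞) z :=
    hm.comp measurable_coe_onePoint
  rw [← lintegral_indicator_one hB, axisMeasureProj, lintegral_map hm measurable_coe_onePoint,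
    lintegral_axisMeasure hp hs hσ hm']

lemma cfMatrix_smul_axis {α σ : ℝ} (hσ : σ = 1 ∨ σ = -1)
    (hα : Complex.exp (Complex.I * α) = Complex.I * σ) (a : ℝ) {y : ℝ} (hy : y + a ≠ 0) :
    cfMatrix α a • ((((σ * y : ℝ) : ℂ) * Complex.I : ℂ) : OnePoint ℂ) =
      ((((σ * (-(y + a)⁻¹) : ℝ) : ℂ) * Complex.I : ℂ) : OnePoint ℂ) := by
  have e00 : (cfMatrix α a) 0 0 = 0 := rfl
  have e01 : (cfMatrix α a) 0 1 = 1 := rfl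
  have e10 : (cfMatrix α a) 1 0 = 1 := rfl
  have e11 : (cfMatrix α a) 1 1 = (a : ℂ) * (Complex.I * σ) := by rw [← hα]; rfl
  have hσ2 : (σ : ℂ) * σ = 1 := by rcases hσ with rfl | rfl <;> norm_num
  have hσ0 : (σ : ℂ) ≠ 0 := left_ne_zero_of_mul_eq_one hσ2
  have hy' : ((y : ℂ) + a) ≠ 0 := by exact_mod_cast hy
  have hd : 1 * (((σ * y : ℝ) : ℂ) * Complex.I) + (a : ℂ) * (Complex.I * σ) =
      (σ * Complex.I) * (y + a) := by push_cast; ring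
  rw [OnePoint.smul_some_eq_ite, e00, e01, e10, e11, hd,
    if_neg (mul_ne_zero (mul_ne_zero hσ0 Complex.I_ne_zero) hy')]
  congr 1
  rw [zero_mul, zero_add, div_eq_iff (mul_ne_zero (mul_ne_zero hσ0 Complex.I_ne_zero) hy')]
  push_cast
  have e : (σ : ℂ) * -(y + a : ℂ)⁻¹ * Complex.I * (σ * Complex.I * (y + a)) =
      -(σ * σ) * (Complex.I * Complex.I) * ((y + a : ℂ)⁻¹ * (y + a)) := by ring
  rw [e, hσ2, Complex.I_mul_I, inv_mul_cancel₀ hy']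
  norm_num

/-- The measure on the axis is invariant. -/
theorem isInvariantMeasure_axisMeasureProj {α p s σ : ℝ} (hp : 0 < p) (hs : 0 < s)
    (hσ : σ = 1 ∨ σ = -1) (hα : Complex.exp (Complex.I * α) = Complex.I * σ) :
    IsInvariantMeasure α (gammaMeasure p (1 / s)) (axisMeasureProj p s σ) := by
  have hσ' : σ * σ = 1 := by rcases hσ with rfl | rfl <;> norm_num
  have hprob : IsProbabilityMeasure (gammaMeasure p (1 / s)) :=
    isProbabilityMeasure_gammaMeasure hp (by positivity)
  intro B hB
  have hA : ∀ a, Measurable fun z : OnePoint ℂ => cfMatrix α a • z := by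
    intro a
    have h := measurable_cfMatrix_smul hσ' hα
    exact h.of_uncurry_left (f := fun a z => cfMatrix α a • z)
  set h : ℝ → ℝ≥0∞ := fun y =>
    B.indicator 1 ((((σ * y : ℝ) : ℂ) * Complex.I : ℂ) : OnePoint ℂ) with hh
  have hhm : Measurable h := by
    have h1 : Measurable fun y : ℝ => ((((σ * y : ℝ) : ℂ) * Complex.I : ℂ) : OnePoint ℂ) :=
      measurable_coe_onePoint.comp (measurable_ofReal_mul_I.comp (measurable_const_mul σ))
    exact (measurable_one.indicator hB).comp h1
  set d : ℝ → ℝ≥0∞ := fun y => ENNReal.ofReal (axisDensity p s 1 y) with hd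
  have hdm : Measurable d := (measurable_axisDensity_one hp hs).ennreal_ofReal
  have h1 : ∀ a, axisMeasureProj p s σ ((fun z : OnePoint ℂ => cfMatrix α a • z) ⁻¹' B) =
      ∫⁻ u, d (u - a) * h (-u⁻¹) := by
    intro a
    rw [axisMeasureProj_apply hp hs hσ (hA a hB),
      ← lintegral_sub_right_eq_self (fun y : ℝ => ENNReal.ofReal (axisDensity p s 1 y) * _) a]
    refine lintegral_congr_ae ?_
    have n1 : ∀ᵐ u : ℝ, u ≠ 0 := by simp [ae_iff]
    filter_upwards [n1] with u hu
    have h2 := cfMatrix_smul_axis hσ hα a (y := u - a) (by simpa using hu)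
    rw [sub_add_cancel] at h2
    have h3 : ∀ (f : OnePoint ℂ → OnePoint ℂ) z,
        (f ⁻¹' B).indicator (1 : OnePoint ℂ → ℝ≥0∞) z = B.indicator 1 (f z) := fun f z => rfl
    rw [h3 (fun z => cfMatrix α a • z)]
    simp only [h2, hh, hd]
  simp only [h1]
  have hjoint : Measurable fun q : ℝ × ℝ => d (q.2 - q.1) * h (-q.2⁻¹) :=
    (hdm.comp (measurable_snd.sub measurable_fst)).mul (hhm.comp measurable_snd.inv.neg)
  rw [lintegral_lintegral_swap hjoint.aemeasurable, axisMeasureProj_apply hp hs hσ hB,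
    lintegral_comp_inv_real, ← lintegral_neg_eq_self]
  refine lintegral_congr_ae ?_
  have n1 : ∀ᵐ u : ℝ, u ≠ 0 := by simp [ae_iff]
  filter_upwards [n1] with u hu
  have hm : Measurable fun a => d ((-u)⁻¹ - a) := hdm.comp (measurable_const.sub measurable_id)
  have e : -(-u)⁻¹⁻¹ = u := by rw [inv_inv, neg_neg]
  have e2 : ((-u) ^ 2)⁻¹ * (((-u)⁻¹) ^ 2)⁻¹ = 1 := by field_simp
  rw [lintegral_mul_const _ hm]
  simp only [hd]
  rw [lintegral_axisDensity_sub hp hs (inv_ne_zero (neg_ne_zero.2 hu)), e, ← mul_assoc, ← mul_assoc,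
    ← ENNReal.ofReal_mul (by positivity), e2, ENNReal.ofReal_one, one_mul]

lemma axisMeasureProj_compl_range (p s : ℝ) {σ : ℝ} :
    axisMeasureProj p s σ
      (Set.range fun y : ℝ => (((y : ℂ) * Complex.I : ℂ) : OnePoint ℂ))ᶜ = 0 := by
  have hr : (Set.range fun y : ℝ => (((y : ℂ) * Complex.I : ℂ) : OnePoint ℂ)) =
      homCoord ⁻¹' {x | x.2 = 1 ∧ x.1.re = 0} := by
    ext z
    induction z using OnePoint.rec with
    | infty => simp
    | coe w =>
      simp only [Set.mem_range, OnePoint.coe_eq_coe, Set.mem_preimage, homCoord_coe,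
        Set.mem_ofPred_eq, true_and]
      constructor
      · rintro ⟨y, rfl⟩; simp
      · intro h; exact ⟨w.im, Complex.ext (by simp [h]) (by simp)⟩
  have hm : MeasurableSet (Set.range fun y : ℝ => (((y : ℂ) * Complex.I : ℂ) : OnePoint ℂ)) := by
    rw [hr]
    refine measurable_homCoord ?_
    exact (measurable_snd (measurableSet_singleton 1)).inter
      ((Complex.measurable_re.comp measurable_fst) (measurableSet_singleton 0))
  rw [axisMeasureProj, axisMeasure, Measure.map_map measurable_coe_onePoint measurable_ofReal_mul_I,
    Measure.map_apply (measurable_coe_onePoint.comp measurable_ofReal_mul_I) hm.compl]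
  have : (((↑) : ℂ → OnePoint ℂ) ∘ fun y : ℝ => (y : ℂ) * Complex.I) ⁻¹'
      (Set.range fun y : ℝ => (((y : ℂ) * Complex.I : ℂ) : OnePoint ℂ))ᶜ = ∅ := by
    ext y; simp
  rw [this, measure_empty]

/-! ### Convergence of the continued fraction -/

lemma rayProd_succ_fst (σ : ℝ) (b : ℕ → ℝ) (n : ℕ) :
    rayProd σ b (n + 1) (1, 0) = (-(Complex.I * σ)) • rayProd σ b n (0, 1) := by
  rw [← rayProd_smul]
  simp only [rayProd]
  congr 1
  simp [rayStep]

lemma rayProd_succ_snd (σ : ℝ) (b : ℕ → ℝ) (n : ℕ) :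
    rayProd σ b (n + 1) (0, 1) =
      (-(Complex.I * σ)) • rayProd σ b n (1, 0) + (b n : ℂ) • rayProd σ b n (0, 1) := by
  rw [← rayProd_smul, ← rayProd_smul, ← rayProd_add]
  simp only [rayProd]
  congr 1
  simp [rayStep]

/-- The numerators and denominators of the convergents are, up to powers of `iσ`, the columns of
the matrix products. -/
lemma contsAux_rayContFract {α σ : ℝ} (hσ : σ * σ = 1)
    (hα : Complex.exp (Complex.I * α) = Complex.I * σ) (b : ℕ → ℝ) (n : ℕ) :
    ((rayContFract α b).contsAux n =
      ⟨(Complex.I * σ) ^ n * (rayProd σ b n (1, 0)).1,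
        (Complex.I * σ) ^ n * (rayProd σ b n (1, 0)).2⟩) ∧
    ((rayContFract α b).contsAux (n + 1) =
      ⟨(Complex.I * σ) ^ n * (rayProd σ b n (0, 1)).1,
        (Complex.I * σ) ^ n * (rayProd σ b n (0, 1)).2⟩) := by
  have hI := I_mul_ofReal_mul_self hσ
  induction n with
  | zero => simp [rayProd, GenContFract.contsAux, rayContFract]
  | succ n ih =>
    obtain ⟨h1, h2⟩ := ih
    refine ⟨?_, ?_⟩
    · rw [h2, rayProd_succ_fst]
      simp only [Prod.smul_fst, Prod.smul_snd, smul_eq_mul, pow_succ]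
      congr 1
      · linear_combination ((Complex.I * σ) ^ n * (rayProd σ b n (0, 1)).1) * hI
      · linear_combination ((Complex.I * σ) ^ n * (rayProd σ b n (0, 1)).2) * hI
    · have hs : (rayContFract α b).s.get? n =
          some ⟨1, (b n : ℂ) * Complex.exp (Complex.I * α)⟩ := rfl
      rw [GenContFract.contsAux_recurrence hs h1 h2, rayProd_succ_snd, hα]
      simp only [Prod.smul_fst, Prod.smul_snd, Prod.fst_add, Prod.snd_add, smul_eq_mul, pow_succ]
      congr 1
      · linear_combination ((Complex.I * σ) ^ n * (rayProd σ b n (1, 0)).1) * hI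
      · linear_combination ((Complex.I * σ) ^ n * (rayProd σ b n (1, 0)).2) * hI

lemma convs_rayContFract {α σ : ℝ} (hσ : σ * σ = 1)
    (hα : Complex.exp (Complex.I * α) = Complex.I * σ) (b : ℕ → ℝ) (n : ℕ) :
    (rayContFract α b).convs n = (sphereChart (rayProd σ b n (0, 1))).1 /
      ((sphereChart (rayProd σ b n (0, 1))).2 : ℂ) := by
  have hI := I_mul_ofReal_mul_self hσ
  have hI0 : Complex.I * (σ : ℂ) ≠ 0 := by
    intro h; rw [h] at hI; norm_num at hI
  have h := (contsAux_rayContFract hσ hα b n).2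
  have hx : rayProd σ b n (0, 1) ≠ 0 := rayProd_ne_zero hσ b n (by simp)
  set x := rayProd σ b n (0, 1)
  have hN : (sqNorm x : ℂ) ≠ 0 := by exact_mod_cast (sqNorm_pos hx).ne'
  have hl : (rayContFract α b).convs n = x.1 / x.2 := by
    rw [GenContFract.convs, GenContFract.nums, GenContFract.dens, GenContFract.conts]
    simp only [Stream'.map, Stream'.get, Stream'.tail]
    rw [h]
    exact mul_div_mul_left _ _ (pow_ne_zero n hI0)
  rw [hl]
  simp only [sphereChart, Complex.ofReal_div]
  rw [div_div_div_cancel_right₀ hN, ← Complex.mul_conj]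
  by_cases h2 : x.2 = 0
  · simp [h2]
  · have h3 : (starRingEnd ℂ) x.2 ≠ 0 := by simpa using h2
    rw [mul_div_mul_right _ _ h3]

/-- At `α = ±π/2` the ray is a half of the imaginary axis. -/
lemma sign_eq_and_exp_eq {α : ℝ} (hα : |α| = Real.pi / 2) :
    (Real.sign α = 1 ∨ Real.sign α = -1) ∧
      Complex.exp (Complex.I * α) = Complex.I * (Real.sign α : ℝ) := by
  have hpi := Real.pi_pos
  rcases (abs_eq (by positivity)).1 hα with h | h
  · have hs : Real.sign α = 1 := Real.sign_of_pos (by rw [h]; positivity)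
    refine ⟨Or.inl hs, ?_⟩
    rw [hs, h, mul_comm]
    push_cast
    rw [Complex.exp_pi_div_two_mul_I, mul_one]
  · have hs : Real.sign α = -1 := Real.sign_of_neg (by rw [h]; linarith)
    refine ⟨Or.inr hs, ?_⟩
    rw [hs, h, mul_comm]
    push_cast
    rw [← neg_div, Complex.exp_neg_pi_div_two_mul_I]
    ring

/-- The density decays like `1 / y ^ 2`. -/
lemma exists_tendsto_sq_mul_axisDensity {p s σ : ℝ} (hp : 0 < p) (hs : 0 < s)
    (hσ : σ = 1 ∨ σ = -1) :
    ∃ C : ℝ, 0 < C ∧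
      Tendsto (fun y : ℝ => y ^ 2 * axisDensity p s σ y) atTop (𝓝 C) ∧
      Tendsto (fun y : ℝ => y ^ 2 * axisDensity p s σ y) atBot (𝓝 C) := by
  refine ⟨normConst p s * s, mul_pos (normConst_pos hp hs) hs, ?_⟩
  have h1 := tendsto_sq_mul_axisDensity_atTop hp hs
  have h2 := tendsto_sq_mul_axisDensity_atBot hp hs
  rcases hσ with rfl | rfl
  · exact ⟨h1, h2⟩
  · have e : (fun y : ℝ => y ^ 2 * axisDensity p s (-1) y) =
        (fun y : ℝ => y ^ 2 * axisDensity p s 1 y) ∘ fun y => -y := by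
      funext y
      simp only [Function.comp_apply, axisDensity_neg_sign p s y hp, neg_sq]
    rw [e]
    exact ⟨h2.comp tendsto_neg_atTop_atBot, h1.comp tendsto_neg_atBot_atTop⟩

theorem mainTheorem2 {Ω : Type*} [MeasurableSpace Ω] (P : Measure Ω) [IsProbabilityMeasure P]
    (α p s : ℝ) (hα : |α| = Real.pi / 2) (hp : 0 < p) (hs : 0 < s)
    (a : ℕ → Ω → ℝ) (hmeas : ∀ n, Measurable (a n)) (hindep : iIndepFun a P)
    (hlaw : ∀ n, P.map (a n) = gammaMeasure p (1 / s)) :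
    -- the integral in the formula for the density converges
    (∀ y : ℝ, y ≠ 0 →
      IntegrableOn (innerIntegrand p s (Real.sign α)) (integrationRange (Real.sign α) y)) ∧
    -- the continued fraction converges almost surely, and its value has the given law
    (∃ Z : Ω → ℂ, Measurable Z ∧
      (∀ᵐ ω ∂P, Tendsto (fun n => (rayContFract α (fun k => a k ω)).convs n) atTop (𝓝 (Z ω))) ∧
      P.map Z = axisMeasure p s (Real.sign α)) ∧
    -- the same law is the unique invariant probability measure on the projective line
    IsProbabilityMeasure (axisMeasureProj p s (Real.sign α)) ∧
    (∀ ν : Measure (OnePoint ℂ), IsProbabilityMeasure ν →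
      (IsInvariantMeasure α (gammaMeasure p (1 / s)) ν ↔
        ν = axisMeasureProj p s (Real.sign α))) ∧
    -- it is supported on the imaginary axis
    axisMeasureProj p s (Real.sign α)
      (Set.range fun y : ℝ => (((y : ℂ) * Complex.I : ℂ) : OnePoint ℂ))ᶜ = 0 ∧
    -- the density decays like `1 / y ^ 2` at both ends of the axis
    (∃ C : ℝ, 0 < C ∧
      Tendsto (fun y : ℝ => y ^ 2 * axisDensity p s (Real.sign α) y) atTop (𝓝 C) ∧
      Tendsto (fun y : ℝ => y ^ 2 * axisDensity p s (Real.sign α) y) atBot (𝓝 C)) := by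
  obtain ⟨hσ, hexp⟩ := sign_eq_and_exp_eq hα
  set σ := Real.sign α with hσdef
  have hσ' : σ * σ = 1 := by rcases hσ with h | h <;> rw [h] <;> norm_num
  have hprob : IsProbabilityMeasure (gammaMeasure p (1 / s)) :=
    isProbabilityMeasure_gammaMeasure hp (by positivity)
  have hax := isProbabilityMeasure_axisMeasureProj hp hs hσ
  have hinv := isInvariantMeasure_axisMeasureProj hp hs hσ hexp
  obtain ⟨ζ, hζ, hlim⟩ := exists_limit_rayProd hp hs hmeas hindep hlaw hσ'
  have hlawζ := map_sphereChart_homCoord_eq hσ' hexp hmeas hindep hlaw hζ hlim hinv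
  have hch : Measurable fun z => sphereChart (homCoord z) :=
    measurable_sphereChart.comp measurable_homCoord
  refine ⟨fun y hy => ?_, ?_, hax, fun ν hν => ⟨fun h => ?_, fun h => ?_⟩,
    axisMeasureProj_compl_range p s, exists_tendsto_sq_mul_axisDensity hp hs hσ⟩
  · rcases hσ with h | h <;> rw [h]
    · exact integrableOn_innerIntegrand hp hs hy
    · exact integrableOn_innerIntegrand_neg_sign hy
        (integrableOn_innerIntegrand hp hs (neg_ne_zero.2 hy))
  · have hq : Measurable fun q : ℂ × ℝ => q.1 / (q.2 : ℂ) :=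
      measurable_fst.div (Complex.measurable_ofReal.comp measurable_snd)
    refine ⟨fun ω => (ζ ω).1 / ((ζ ω).2 : ℂ), hq.comp hζ, ?_, ?_⟩
    · -- the limit is almost surely not the point at infinity
      have hne : ∀ᵐ q ∂P.map ζ, q.2 ≠ 0 := by
        have hS : MeasurableSet {q : ℂ × ℝ | q.2 ≠ 0} :=
          (measurable_snd (measurableSet_singleton 0)).compl
        rw [← hlawζ, ae_map_iff hch.aemeasurable hS, axisMeasureProj,
          ae_map_iff (p := fun z => (sphereChart (homCoord z)).2 ≠ 0)
            measurable_coe_onePoint.aemeasurable (hch hS)]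
        refine Eventually.of_forall fun w => ?_
        have h := sqNorm_pos (x := (w, 1)) (by simp)
        simp [sphereChart, h.ne']
      filter_upwards [hlim (0, 1) (by simp), ae_of_ae_map hζ.aemeasurable hne] with ω h1 h2
      simp only [convs_rayContFract hσ' hexp]
      have h3 := (Prod.tendsto_iff _ _).1 h1
      exact h3.1.div ((Complex.continuous_ofReal.tendsto _).comp h3.2)
        (Complex.ofReal_ne_zero.2 h2)
    · have e : P.map (fun ω => (ζ ω).1 / ((ζ ω).2 : ℂ)) =
          (P.map ζ).map fun q : ℂ × ℝ => q.1 / (q.2 : ℂ) := (Measure.map_map hq hζ).symm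
      rw [e, ← hlawζ, Measure.map_map hq hch, axisMeasureProj,
        Measure.map_map (hq.comp hch) measurable_coe_onePoint]
      have hid : ((fun q : ℂ × ℝ => q.1 / (q.2 : ℂ)) ∘ fun z => sphereChart (homCoord z)) ∘
          ((↑) : ℂ → OnePoint ℂ) = id := by
        funext w
        have h : (sqNorm (w, 1) : ℂ) ≠ 0 := by
          exact_mod_cast (sqNorm_pos (x := (w, 1)) (by simp)).ne'
        simp only [Function.comp_apply, homCoord_coe, sphereChart, map_one, mul_one,
          Complex.ofReal_div, Complex.ofReal_one, id_eq]
        field_simp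
      rw [hid, Measure.map_id]
  · refine eq_of_map_sphereChart_homCoord_eq ?_
    rw [hlawζ]
    exact map_sphereChart_homCoord_eq hσ' hexp hmeas hindep hlaw hζ hlim h
  · rw [h]; exact hinv
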